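/- Let $\mathbb{K}$ be $\mathbb{R}$ or $\mathbb{C}$ and let $\mathfrak{g}$ be a finite-dimensional Lie algebra over $\mathbb{K}$. **Factorization envelope on $\mathbb{R}$.** A disk is a non-empty open interval $D\subseteq\mathbb{R}$, and $\Omega^\bullet_c(D)$ denotes the compactly supported smooth $\mathbb{K}$-valued forms on $D$. Let $\mathfrak{U}\mathfrak{g}^{\mathbb{R}}(D)$ be the graded symmetric algebra $\mathrm{Sym}\big((\mathfrak{g}\otimes\Omega_c^\bullet(D))[1]\big)$ with differential $\mathrm{d}=\mathrm{d}_{\mathrm{dR}[1]}+\mathrm{d}_{\mathrm{CE}}$. Here $\mathrm{d}_{\mathrm{dR}[1]}$ is the de Rham differential of the shifted complex (that is, $X\otimes f\mapsto -X\otimes \mathrm{d}f$) extended by the Leibniz rule, and $$\mathrm{d}_{\mathrm{CE}}\Big(\prod_{a=1}^n (X_a\otimes\omega_a)\Big)=\sum_{i<j}\pm(-1)^{|\omega_i|}\,\big([X_i,X_j]\otimes\omega_i\wedge\omega_j\big)\prod_{a\neq i,j}(X_a\otimes\omega_a),$$ where $\pm$ is the Koszul sign for moving the factors $i$ and $j$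 to the front. For mutually disjoint disks $D_1,\dots,D_n\subseteq D$, in any order and with $n\ge 0$, the structure map $$\mathfrak{U}\mathfrak{g}^{\mathbb{R}}(\iota_{\underline D}^D):\bigotimes_i \mathfrak{U}\mathfrak{g}^{\mathbb{R}}(D_i)\to\mathfrak{U}\mathfrak{g}^{\mathbb{R}}(D)$$ is extension of forms by zero followed by the product of the symmetric algebra. **Deformation retract.** Choose for every disk $D$ a form $\omega_D\in\Omega^1_c(D)$ with $\int_D\omega_D=1$. Regard $\mathrm{Sym}(\mathfrak{g})$ as a complex in degree $0$ with zero differential. Let $i_D:\mathrm{Sym}(\mathfrak{g})\to\mathfrak{U}\mathfrak{g}^{\mathbb{R}}(D)$ be the algebra map with $X\mapsto X\otimes\omega_D$. Let $p_D$ be the algebra map with $X\otimes\omega\mapsto X\int_D\omega$ on $1$-forms and $0$ on functions. Let $h_D$ be given in $\mathrm{Sym}$-degree $n$ by $$h_D^n=\frac1{n!}\sum_{j=1}^n\sum_{\sigma\in\Sigma_n}\tau_\sigma\big(\mathrm{id}^{\otimes(j-1)}\otimes h_D[1]\otimes(i_Dp_D)^{\otimes(n-j)}\big)\tau_{\sigma^{-1}},$$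 where $\tau_\sigma$ permutes the factors with Koszul signs, and $h_D[1](X\otimes\omega)=X\otimes\int(\omega-\omega_D\int_D\omega)$ on $1$-forms and $0$ on functions, with $(\int\eta)(x)=\int_{-\infty}^x\eta$. Put $$\widehat p_D=\sum_{j\ge0}p_D(\mathrm{d}_{\mathrm{CE}}h_D)^j,\qquad \widehat h_D=\sum_{j\ge0}h_D(\mathrm{d}_{\mathrm{CE}}h_D)^j .$$ **Claim.** 1. The structure maps of $\mathfrak{U}\mathfrak{g}^{\mathbb{R}}$ are cochain maps. For every disk $D$ and every choice of $\omega_D$, $(i_D,\widehat p_D,\widehat h_D)$ is a strong deformation retract of the cochain complex $\mathfrak{U}\mathfrak{g}^{\mathbb{R}}(D)$ onto $\mathrm{Sym}(\mathfrak{g})$: $\mathrm{d}^2=0$, the maps $i_D$ and $\widehat p_D$ are cochain maps of degree $0$, $\widehat h_D$ has degree $-1$, $\widehat p_D i_D=\mathrm{id}$, $\mathrm{d}\widehat h_D+\widehat h_D\mathrm{d}=i_D\widehat p_D-\mathrm{id}$, $\widehat h_D i_D=0$, $\widehat p_D\widehat h_D=0$ and $\widehat h_D^2=0$. 2. There is an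 associative bilinear product $\star$ on $\mathrm{Sym}(\mathfrak{g})$ with unit $1$, independent of the choice of the forms $\omega_D$, such that the transferred structure maps are the ordered $\star$-products: for all mutually disjoint disks $D_1,\dots,D_n\subseteq D$ with $n\geq 0$ there is a permutation $\sigma$ with $D_{\sigma(1)}<\dots<D_{\sigma(n)}$ and $$\widehat p_D\;\mathfrak{U}\mathfrak{g}^{\mathbb{R}}(\iota_{\underline D}^D)\;(i_{D_1}\otimes\cdots\otimes i_{D_n})\,(a_1\otimes\cdots\otimes a_n)=a_{\sigma(1)}\star\cdots\star a_{\sigma(n)}$$ for all $a_1,\dots,a_n\in\mathrm{Sym}(\mathfrak{g})$, the empty product being $1$. 3. For all $X,Y\in\mathfrak{g}$ and $n\ge0$, $$X^n\star Y=\sum_{j=0}^n(-1)^j\binom nj B_j\,X^{n-j}\,\mathrm{ad}_X^j(Y),$$ where $B_j$ are the Bernoulli numbers with $B_1=-\tfrac12$. 4. $\star$ is the Gutt star-product, that is, there is a linear isomorphism $\mathrm{Sym}(\mathfrak{g})\to U\mathfrak{g}$ with $X^n\mapsto X^n$ for all $X\in\mathfrak{g}$ and $n\ge 0$ (the symmetrization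 map) that carries $\star$ to the product of $U\mathfrak{g}$. In particular, the unital associative algebra $(\mathrm{Sym}(\mathfrak{g}),\star)$ is isomorphic to the universal enveloping algebra $U\mathfrak{g}$. -/

import Mathlib

open TopologicalSpace MeasureTheory
open scoped TensorProduct Distributions

noncomputable section

/-! ### Graded symmetric algebras of graded vector spaces with an even and an odd part -/

section SuperSymmetric

/-- The Koszul relations on the tensor algebra of `E ⊕ O`, with `E` even and `O` odd: an even
generator commutes with every generator, two odd generators anticommute. -/
inductive SuperSymRel (K E O : Type*) [Field K] [AddCommGroup E] [Module K E]
    [AddCommGroup O] [Module K O] :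
    TensorAlgebra K (E × O) → TensorAlgebra K (E × O) → Prop where
  | even_comm (e : E) (v : E × O) :
      SuperSymRel K E O (TensorAlgebra.ι K (e, (0 : O)) * TensorAlgebra.ι K v)
        (TensorAlgebra.ι K v * TensorAlgebra.ι K (e, (0 : O)))
  | odd_anticomm (a b : O) :
      SuperSymRel K E O (TensorAlgebra.ι K ((0 : E), a) * TensorAlgebra.ι K ((0 : E), b))
        (-(TensorAlgebra.ι K ((0 : E), b) * TensorAlgebra.ι K ((0 : E), a)))

/-- The graded symmetric algebra `Sym (E ⊕ O)` of a graded vector space with even part `E` and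
odd part `O`: the tensor algebra modulo the Koszul relations. -/
def SuperSym (K E O : Type*) [Field K] [AddCommGroup E] [Module K E]
    [AddCommGroup O] [Module K O] : Type _ :=
  (ringConGen (SuperSymRel K E O)).Quotient

namespace SuperSym

variable {K E O : Type*} [Field K] [AddCommGroup E] [Module K E] [AddCommGroup O] [Module K O]

instance : Ring (SuperSym K E O) :=
  inferInstanceAs (Ring (ringConGen (SuperSymRel K E O)).Quotient)

instance : Algebra K (SuperSym K E O) :=
  inferInstanceAs (Algebra K (ringConGen (SuperSymRel K E O)).Quotient)

/-- The quotient map from the tensor algebra. -/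
def mk : TensorAlgebra K (E × O) →ₐ[K] SuperSym K E O :=
  RingCon.mkₐ K (ringConGen (SuperSymRel K E O))

theorem mk_surjective : Function.Surjective (mk : TensorAlgebra K (E × O) →ₐ[K] SuperSym K E O) :=
  RingCon.mkₐ_surjective (α := K) (ringConGen (SuperSymRel K E O))

/-- The generators. -/
def gen : E × O →ₗ[K] SuperSym K E O := mk.toLinearMap ∘ₗ TensorAlgebra.ι K

theorem gen_even_comm (e : E) (v : E × O) :
    (gen (e, (0 : O)) * gen v : SuperSym K E O) = gen v * gen (e, (0 : O)) := by
  have := RingCon.le_ringConGen (r := SuperSymRel K E O) _ _ (.even_comm e v)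
  exact (RingCon.eq _).2 this

theorem gen_odd_anticomm (a b : O) :
    (gen ((0 : E), a) * gen ((0 : E), b) : SuperSym K E O) =
      -(gen ((0 : E), b) * gen ((0 : E), a)) := by
  have := RingCon.le_ringConGen (r := SuperSymRel K E O) _ _ (.odd_anticomm a b)
  exact (RingCon.eq _).2 this

/-- The universal property: a linear map into an associative algebra whose values satisfy the
Koszul relations extends to an algebra homomorphism. -/
def lift {B : Type*} [Ring B] [Algebra K B] (f : E × O →ₗ[K] B)
    (hE : ∀ (e : E) (v : E × O), f (e, 0) * f v = f v * f (e, 0))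
    (hO : ∀ a b : O, f (0, a) * f (0, b) = -(f (0, b) * f (0, a))) :
    SuperSym K E O →ₐ[K] B :=
  RingCon.liftₐ (ringConGen (SuperSymRel K E O)) (TensorAlgebra.lift K f) <| by
    refine RingCon.ringConGen_le.2 fun x y h => ?_
    rw [RingCon.ker_apply]
    cases h with
    | even_comm e v => simpa using hE e v
    | odd_anticomm a b => simpa using hO a b

@[simp]
theorem lift_gen {B : Type*} [Ring B] [Algebra K B] (f : E × O →ₗ[K] B) (hE) (hO) (v : E × O) :
    lift f hE hO (gen v) = f v :=
  TensorAlgebra.lift_ι_apply f v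

/-- Induction along left multiplication by generators. -/
theorem induction_left {P : SuperSym K E O → Prop} (one : P 1)
    (add : ∀ x y, P x → P y → P (x + y)) (smul : ∀ (c : K) x, P x → P (c • x))
    (gen_mul : ∀ v x, P x → P (gen v * x)) (x : SuperSym K E O) : P x := by
  suffices h : ∀ (t : TensorAlgebra K (E × O)) (x : SuperSym K E O), P x → P (mk t * x) by
    obtain ⟨t, rfl⟩ := mk_surjective x
    simpa using h t 1 one
  intro t
  induction t using TensorAlgebra.induction with
  | algebraMap r =>
    intro x hx
    rw [AlgHom.commutes, ← Algebra.smul_def]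
    exact smul r x hx
  | ι v => exact fun x hx => gen_mul v x hx
  | mul a b ha hb =>
    intro x hx
    rw [map_mul, mul_assoc]
    exact ha _ (hb _ hx)
  | add a b ha hb =>
    intro x hx
    rw [map_add, add_mul]
    exact add _ _ (ha _ hx) (hb _ hx)

/-- The parity automorphism, which is `(-1)^|x|` on a homogeneous element `x`. -/
def parity : SuperSym K E O →ₐ[K] SuperSym K E O :=
  lift (gen ∘ₗ LinearMap.prodMap LinearMap.id (-LinearMap.id))
    (by
      intro e v
      simpa using gen_even_comm e (v.1, -v.2))
    (by
      intro a b
      simpa using gen_odd_anticomm (E := E) (K := K) (-a) (-b))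

theorem parity_gen (v : E × O) : parity (gen v : SuperSym K E O) = gen (v.1, -v.2) := by
  simp [parity]

/-- The algebra homomorphism induced by a degree preserving linear map of generators. -/
def map {E' O' : Type*} [AddCommGroup E'] [Module K E'] [AddCommGroup O'] [Module K O']
    (f : E →ₗ[K] E') (g : O →ₗ[K] O') : SuperSym K E O →ₐ[K] SuperSym K E' O' :=
  lift (gen ∘ₗ LinearMap.prodMap f g)
    (by
      intro e v
      simpa using gen_even_comm (f e) (f v.1, g v.2))
    (by
      intro a b
      simpa using gen_odd_anticomm (E := E') (K := K) (g a) (g b))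

/-- The operator `(x, y) ↦ (v x, δ(v) x + θ(v) y)`. -/
def derOp (θ : SuperSym K E O →ₐ[K] SuperSym K E O) (δ : E × O →ₗ[K] SuperSym K E O) :
    E × O →ₗ[K] Module.End K (SuperSym K E O × SuperSym K E O) where
  toFun v :=
    { toFun := fun p => (gen v * p.1, δ v * p.1 + θ (gen v) * p.2)
      map_add' := by intro p q; ext <;> simp [mul_add]; abel
      map_smul' := by intro c p; ext <;> simp }
  map_add' := by intro v w; ext <;> simp [add_mul]
  map_smul' := by intro c v; ext <;> simp

section TwistedDer

variable (θ : SuperSym K E O →ₐ[K] SuperSym K E O) (δ : E × O →ₗ[K] SuperSym K E O)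
  (hE : ∀ (e : E) (v : E × O), δ (e, 0) * gen v + θ (gen (e, 0)) * δ v =
    δ v * gen (e, 0) + θ (gen v) * δ (e, 0))
  (hO : ∀ a b : O, δ (0, a) * gen (0, b) + θ (gen (0, a)) * δ (0, b) =
    -(δ (0, b) * gen (0, a) + θ (gen (0, b)) * δ (0, a)))

/-- The algebra homomorphism `a ↦ ((x, y) ↦ (a x, D(a) x + θ(a) y))`, where `D` is the
`θ`-derivation with values `δ` on generators. -/
def derHom : SuperSym K E O →ₐ[K] Module.End K (SuperSym K E O × SuperSym K E O) :=
  lift (B := Module.End K (SuperSym K E O × SuperSym K E O)) (derOp θ δ)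
    (by
      intro e v
      refine LinearMap.ext fun p => Prod.ext ?_ ?_
      · simp only [derOp, Module.End.mul_apply, LinearMap.coe_mk, AddHom.coe_mk]
        rw [← mul_assoc, ← mul_assoc, gen_even_comm]
      · simp only [derOp, Module.End.mul_apply, LinearMap.coe_mk, AddHom.coe_mk]
        simp only [mul_add, ← mul_assoc, ← add_assoc, ← add_mul, ← map_mul]
        rw [hE, gen_even_comm])
    (by
      intro a b
      refine LinearMap.ext fun p => Prod.ext ?_ ?_
      · simp only [derOp, Module.End.mul_apply, LinearMap.coe_mk, AddHom.coe_mk,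
          LinearMap.neg_apply, Prod.fst_neg]
        rw [← mul_assoc, ← mul_assoc, gen_odd_anticomm, neg_mul]
      · simp only [derOp, Module.End.mul_apply, LinearMap.coe_mk, AddHom.coe_mk,
          LinearMap.neg_apply, Prod.snd_neg]
        simp only [mul_add, ← mul_assoc, ← add_assoc, ← add_mul, ← map_mul]
        rw [hO, gen_odd_anticomm, map_neg, neg_mul, neg_mul, ← neg_add])

/-- The `θ`-derivation `D` of `Sym (E ⊕ O)` with values `δ` on generators, that is, the unique
linear map with `D (gen v) = δ v` and `D (x * y) = D x * y + θ x * D y`. -/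
def twistedDer : SuperSym K E O →ₗ[K] SuperSym K E O where
  toFun a := (derHom θ δ hE hO a (1, 0)).2
  map_add' := by intro a b; simp
  map_smul' := by intro c a; simp

theorem derHom_gen_apply (v : E × O) (p : SuperSym K E O × SuperSym K E O) :
    derHom θ δ hE hO (gen v) p = (gen v * p.1, δ v * p.1 + θ (gen v) * p.2) := by
  simp [derHom, derOp]

theorem derHom_apply_one_fst (x : SuperSym K E O) : (derHom θ δ hE hO x (1, 0)).1 = x := by
  induction x using induction_left with
  | one => simp
  | add x y hx hy => simp [hx, hy]
  | smul c x hx => simp [hx]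
  | gen_mul v x hx => rw [map_mul, Module.End.mul_apply, derHom_gen_apply, hx]

theorem twistedDer_one : twistedDer θ δ hE hO 1 = 0 := by
  simp [twistedDer]

theorem twistedDer_gen_mul (v : E × O) (x : SuperSym K E O) :
    twistedDer θ δ hE hO (gen v * x) = δ v * x + θ (gen v) * twistedDer θ δ hE hO x := by
  simp only [twistedDer, LinearMap.coe_mk, AddHom.coe_mk]
  rw [map_mul, Module.End.mul_apply, derHom_gen_apply, derHom_apply_one_fst]

theorem twistedDer_gen (v : E × O) : twistedDer θ δ hE hO (gen v) = δ v := by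
  have h := twistedDer_gen_mul θ δ hE hO v 1
  rwa [twistedDer_one, mul_one, mul_one, mul_zero, add_zero] at h

/-- The twisted Leibniz rule. -/
theorem twistedDer_mul (x y : SuperSym K E O) :
    twistedDer θ δ hE hO (x * y) = twistedDer θ δ hE hO x * y + θ x * twistedDer θ δ hE hO y := by
  induction x using induction_left with
  | one => simp [twistedDer_one]
  | add x y hx hy => simp only [add_mul, map_add, hx, hy]; abel
  | smul c x hx => simp [hx]
  | gen_mul v x hx =>
    rw [mul_assoc, twistedDer_gen_mul, hx, twistedDer_gen_mul, map_mul]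
    simp only [add_mul, mul_add, mul_assoc, add_assoc]

end TwistedDer

/-! #### Operators defined by graded symmetrization -/

variable (K) in
/-- The projection onto the even part (`false`) or onto the odd part (`true`). -/
def homPart (b : Bool) : E × O →ₗ[K] E × O :=
  if b then LinearMap.inr K E O ∘ₗ LinearMap.snd K E O
  else LinearMap.inl K E O ∘ₗ LinearMap.fst K E O

variable (K) in
/-- The Koszul sign of reordering homogeneous letters `v 0, …, v (n-1)`, of parities given by `ε`,
into `v (σ 0), …, v (σ (n-1))`: a factor `-1` for every inversion between two odd letters. -/
def koszul {n : ℕ} (σ : Equiv.Perm (Fin n)) (ε : Fin n → Bool) : K :=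
  ∏ i, ∏ j, if i < j ∧ σ.symm j < σ.symm i ∧ ε i = true ∧ ε j = true then -1 else 1

variable {W : Type*} [AddCommGroup W] [Module K W]

/-- The graded symmetrization `v ↦ (1 / n!) ∑ σ, ± f (v ∘ σ)` of a multilinear map, with the
Koszul sign `±`; a general argument is decomposed into its homogeneous parts. -/
def gradedSymm {n : ℕ} (f : MultilinearMap K (fun _ : Fin n => E × O) W) :
    MultilinearMap K (fun _ : Fin n => E × O) W :=
  ((n.factorial : K)⁻¹) • ∑ σ : Equiv.Perm (Fin n), ∑ ε : Fin n → Bool,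
    koszul K σ ε • (f.compLinearMap fun k => homPart K (ε (σ k))).domDomCongr σ

theorem gradedSymm_apply {n : ℕ} (f : MultilinearMap K (fun _ : Fin n => E × O) W)
    (v : Fin n → E × O) :
    gradedSymm f v = ((n.factorial : K)⁻¹) • ∑ σ : Equiv.Perm (Fin n), ∑ ε : Fin n → Bool,
      koszul K σ ε • f (fun k => homPart K (ε (σ k)) (v (σ k))) := by
  simp [gradedSymm]

theorem koszul_swap_mul {n : ℕ} (σ : Equiv.Perm (Fin n)) (ε : Fin n → Bool) (k l : Fin n)
    (hkl : k.val + 1 = l.val) :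
    koszul K (Equiv.swap k l * σ) (ε ∘ Equiv.swap k l) =
      (if ε k = true ∧ ε l = true then -1 else 1) * koszul K σ ε := by
  set s := Equiv.swap k l with hs
  have hne : k ≠ l := by intro h; rw [h] at hkl; omega
  have h1 : koszul K (s * σ) (ε ∘ s) =
      ∏ i, ∏ j, if s i < s j ∧ σ.symm j < σ.symm i ∧ ε i = true ∧ ε j = true then (-1 : K) else 1 := by
    unfold koszul
    rw [← Equiv.prod_comp s]
    refine Finset.prod_congr rfl fun i _ => ?_
    rw [← Equiv.prod_comp s]
    refine Finset.prod_congr rfl fun j _ => ?_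
    have e : ∀ x, (s * σ).symm (s x) = σ.symm x := by
      intro x
      rw [Equiv.symm_apply_eq]
      simp
    have e2 : ∀ x, s (s x) = x := fun x => Equiv.swap_apply_self k l x
    simp only [e, e2, Function.comp]
  have h2 : ∀ i j : Fin n,
      (if s i < s j ∧ σ.symm j < σ.symm i ∧ ε i = true ∧ ε j = true then (-1 : K) else 1) =
      ((if i = k then if j = l then
          (if σ.symm l < σ.symm k ∧ ε k = true ∧ ε l = true then -1 else 1) else 1 else 1) *
        (if i = l then if j = k then
          (if σ.symm k < σ.symm l ∧ ε k = true ∧ ε l = true then -1 else 1) else 1 else 1)) *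
      (if i < j ∧ σ.symm j < σ.symm i ∧ ε i = true ∧ ε j = true then -1 else 1) := by
    intro i j
    have key : ¬ (i = k ∧ j = l) → ¬ (i = l ∧ j = k) → (s i < s j ↔ i < j) := by
      intro ha hb
      simp only [hs, Equiv.swap_apply_def]
      simp only [Fin.ext_iff, Fin.lt_def] at *
      split_ifs <;> omega
    by_cases ha : i = k ∧ j = l
    · obtain ⟨rfl, rfl⟩ := ha
      have h3 : ¬ (j < i) := by rw [Fin.lt_def]; omega
      have h4 : i < j := by rw [Fin.lt_def]; omega
      simp only [hs, Equiv.swap_apply_left, Equiv.swap_apply_right, h3, h4, hne, hne.symm]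
      by_cases h5 : σ.symm j < σ.symm i ∧ ε i = true ∧ ε j = true <;> simp [h5]
    · by_cases hb : i = l ∧ j = k
      · obtain ⟨rfl, rfl⟩ := hb
        have h3 : ¬ (i < j) := by rw [Fin.lt_def]; omega
        have h4 : j < i := by rw [Fin.lt_def]; omega
        simp only [hs, Equiv.swap_apply_left, Equiv.swap_apply_right, h3, h4, hne, hne.symm]
        by_cases h5 : σ.symm j < σ.symm i ∧ ε i = true ∧ ε j = true
        · have h6 : σ.symm j < σ.symm i ∧ ε j = true ∧ ε i = true := ⟨h5.1, h5.2.2, h5.2.1⟩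
          simp [h5]
        · have h6 : ¬ (σ.symm j < σ.symm i ∧ ε j = true ∧ ε i = true) :=
            fun h => h5 ⟨h.1, h.2.2, h.2.1⟩
          simp [h5, h6]
      · simp only [key ha hb]
        have e1 : (if i = k then if j = l then
          (if σ.symm l < σ.symm k ∧ ε k = true ∧ ε l = true then (-1 : K) else 1) else 1 else 1) = 1 := by
          by_cases hi : i = k
          · have : ¬ j = l := fun h => ha ⟨hi, h⟩
            simp [this]
          · simp [hi]
        have e2 : (if i = l then if j = k then
          (if σ.symm k < σ.symm l ∧ ε k = true ∧ ε l = true then (-1 : K) else 1) else 1 else 1) = 1 := by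
          by_cases hi : i = l
          · have : ¬ j = k := fun h => hb ⟨hi, h⟩
            simp [this]
          · simp [hi]
        rw [e1, e2]; simp
  rw [h1]
  simp only [h2, Finset.prod_mul_distrib]
  unfold koszul
  congr 1
  have inner : ∀ (c : K) (a b : Fin n),
      (∏ i, ∏ j, if i = a then if j = b then c else 1 else 1) = c := by
    intro c a b
    rw [Finset.prod_eq_single a]
    · simp
    · intro i _ hi; simp [hi]
    · simp
  rw [inner, inner]
  have hσ : σ.symm k ≠ σ.symm l := fun h => hne (σ.symm.injective h)
  rcases lt_or_gt_of_ne hσ with h | h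
  · have h' := not_lt_of_gt h
    simp [h, h']
  · have h' := not_lt_of_gt h
    simp [h, h']

theorem gradedSymm_swap {n : ℕ} (f : MultilinearMap K (fun _ : Fin n => E × O) W)
    (u : Fin n → E × O) (k l : Fin n) (hkl : k.val + 1 = l.val) (a b : Bool)
    (ha : homPart K (!a) (u k) = 0) (hb : homPart K (!b) (u l) = 0) :
    gradedSymm f (u ∘ Equiv.swap k l) =
      (if a = true ∧ b = true then (-1 : K) else 1) • gradedSymm f u := by
  rw [gradedSymm_apply, gradedSymm_apply, smul_comm]
  congr 1
  rw [Finset.smul_sum, ← Equiv.sum_comp (Equiv.mulLeft (Equiv.swap k l))]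
  refine Finset.sum_congr rfl fun σ _ => ?_
  rw [Finset.smul_sum, ← Equiv.sum_comp (Equiv.arrowCongr (Equiv.swap k l) (Equiv.refl Bool))]
  refine Finset.sum_congr rfl fun ε _ => ?_
  have e0 : (Equiv.arrowCongr (Equiv.swap k l) (Equiv.refl Bool)) ε = ε ∘ Equiv.swap k l := by
    ext x; simp [Equiv.arrowCongr]
  rw [e0, Equiv.coe_mulLeft, koszul_swap_mul σ ε k l hkl]
  simp only [Function.comp, Equiv.Perm.mul_apply, Equiv.swap_apply_self]
  rw [mul_smul, smul_smul]
  by_cases h1 : ε k = a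
  · by_cases h2 : ε l = b
    · rw [h1, h2, ← smul_smul]
    · have hz : f (fun j => homPart K (ε (σ j)) (u (σ j))) = 0 := by
        refine f.map_coord_zero (σ.symm l) ?_
        have : ε l = !b := by revert h2; cases ε l <;> cases b <;> simp
        simp [this, hb]
      rw [hz]; simp
  · have hz : f (fun j => homPart K (ε (σ j)) (u (σ j))) = 0 := by
      refine f.map_coord_zero (σ.symm k) ?_
      have : ε k = !a := by revert h1; cases ε k <;> cases a <;> simp
      simp [this, ha]
    rw [hz]; simp

/-- The linear map on the tensor algebra given by `v 0 ⊗ ⋯ ⊗ v (n-1) ↦ gradedSymm (f n) v`. -/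
def tensorSymm (f : ∀ n : ℕ, MultilinearMap K (fun _ : Fin n => E × O) W) :
    TensorAlgebra K (E × O) →ₗ[K] W :=
  DirectSum.toModule K ℕ W (fun n => PiTensorProduct.lift (gradedSymm (f n))) ∘ₗ
    TensorAlgebra.toDirectSum.toLinearMap

theorem tensorSymm_tprod (f : ∀ n : ℕ, MultilinearMap K (fun _ : Fin n => E × O) W) {n : ℕ}
    (v : Fin n → E × O) :
    tensorSymm f (TensorAlgebra.tprod K (E × O) n v) = gradedSymm (f n) v := by
  rw [tensorSymm, LinearMap.comp_apply, AlgHom.toLinearMap_apply,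
    TensorAlgebra.toDirectSum_tensorPower_tprod]
  rw [← DirectSum.lof_eq_of K, DirectSum.toModule_lof, PiTensorProduct.lift.tprod]

theorem tensorSymm_swap (f : ∀ n : ℕ, MultilinearMap K (fun _ : Fin n => E × O) W)
    (v w : E × O) (a b : Bool)
    (ha : homPart K (!a) v = 0) (hb : homPart K (!b) w = 0)
    (x y : TensorAlgebra K (E × O)) :
    tensorSymm f (x * (TensorAlgebra.ι K w * TensorAlgebra.ι K v) * y) =
      (if a = true ∧ b = true then (-1 : K) else 1) •
        tensorSymm f (x * (TensorAlgebra.ι K v * TensorAlgebra.ι K w) * y) := by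
  have hspan : ∀ z : TensorAlgebra K (E × O), z ∈ Submodule.span K
      (Set.range fun l : List (E × O) => (l.map (TensorAlgebra.ι K)).prod) := by
    intro z
    induction z using TensorAlgebra.induction with
    | algebraMap r =>
      rw [Algebra.algebraMap_eq_smul_one]
      exact Submodule.smul_mem _ _ (Submodule.subset_span ⟨[], by simp⟩)
    | ι v => exact Submodule.subset_span ⟨[v], by simp⟩
    | mul p q hp hq =>
      have := Submodule.mul_mem_mul hp hq
      rw [Submodule.span_mul_span] at this
      refine Submodule.span_mono ?_ this
      rintro _ ⟨_, ⟨l, rfl⟩, _, ⟨m, rfl⟩, rfl⟩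
      exact ⟨l ++ m, by simp⟩
    | add p q hp hq => exact Submodule.add_mem _ hp hq
  have hx := hspan x
  have hy := hspan y
  induction hx using Submodule.span_induction with
  | zero => simp
  | add p q _ _ hp hq => simp only [add_mul, map_add, smul_add, hp, hq]
  | smul c p _ hp => simp only [smul_mul_assoc, map_smul, hp, smul_comm c]
  | mem p hp =>
    obtain ⟨l, rfl⟩ := hp
    induction hy using Submodule.span_induction with
    | zero => simp
    | add p q _ _ hp hq => simp only [mul_add, map_add, smul_add, hp, hq]
    | smul c p _ hp => simp only [mul_smul_comm, map_smul, hp, smul_comm c]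
    | mem p hp =>
      obtain ⟨m, rfl⟩ := hp
      have hp : ∀ t : List (E × O), (t.map (TensorAlgebra.ι K)).prod =
          TensorAlgebra.tprod K (E × O) t.length t.get := by
        intro t
        rw [TensorAlgebra.tprod_apply]
        congr 1
        conv_lhs => rw [← List.ofFn_get t, List.map_ofFn]
        rfl
      have e1 : (l.map (TensorAlgebra.ι K)).prod * (TensorAlgebra.ι K v * TensorAlgebra.ι K w) *
          (m.map (TensorAlgebra.ι K)).prod = ((l ++ v :: w :: m).map (TensorAlgebra.ι K)).prod := by
        simp [mul_assoc]
      have hk : l.length < (l ++ v :: w :: m).length := by simp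
      have hk' : l.length + 1 < (l ++ v :: w :: m).length := by simp
      have e2 : (l.map (TensorAlgebra.ι K)).prod * (TensorAlgebra.ι K w * TensorAlgebra.ι K v) *
          (m.map (TensorAlgebra.ι K)).prod = TensorAlgebra.tprod K (E × O) _
          ((l ++ v :: w :: m).get ∘ Equiv.swap ⟨l.length, hk⟩ ⟨l.length + 1, hk'⟩) := by
        have : (l.map (TensorAlgebra.ι K)).prod * (TensorAlgebra.ι K w * TensorAlgebra.ι K v) *
          (m.map (TensorAlgebra.ι K)).prod = ((l ++ w :: v :: m).map (TensorAlgebra.ι K)).prod := by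
          simp [mul_assoc]
        rw [this, TensorAlgebra.tprod_apply]
        congr 1
        refine List.ext_getElem (by simp; omega) fun i h1 h2 => ?_
        simp only [List.getElem_map, List.getElem_ofFn, Function.comp]
        congr 1
        rw [List.get_eq_getElem]
        simp only [Equiv.swap_apply_def, Fin.ext_iff]
        split_ifs with h3 h4
        · subst h3; simp
        · subst h4; simp
        · rw [List.getElem_append, List.getElem_append]
          split_ifs with h5
          · rfl
          · obtain ⟨d, rfl⟩ : ∃ d, i = l.length + 2 + d := ⟨i - (l.length + 2), by omega⟩
            have : l.length + 2 + d - l.length = d + 2 := by omega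
            simp [this]
      rw [e1, e2, hp, tensorSymm_tprod, tensorSymm_tprod]
      refine gradedSymm_swap _ _ _ _ rfl a b ?_ ?_
      · simpa using ha
      · simpa using hb

/-- The linear map on `Sym (E ⊕ O)` induced by graded symmetrization of a family of multilinear
maps: `v 0 ⋯ v (n-1) ↦ (1 / n!) ∑ σ, ± f n (v ∘ σ)` for homogeneous `v 0, …, v (n-1)`. -/
def symLift (f : ∀ n : ℕ, MultilinearMap K (fun _ : Fin n => E × O) W) : SuperSym K E O →ₗ[K] W :=
  let c : RingCon (TensorAlgebra K (E × O)) :=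
    { r := fun x y => ∀ a b, tensorSymm f (a * x * b) = tensorSymm f (a * y * b)
      iseqv := ⟨fun _ _ _ => rfl, fun h a b => (h a b).symm,
        fun h h' a b => (h a b).trans (h' a b)⟩
      add' := by
        intro w x y z h h' a b
        simp only [mul_add, add_mul, map_add, h a b, h' a b]
      mul' := by
        intro w x y z h h' a b
        have e1 := h a (y * b)
        have e2 := h' (a * x) b
        simp only [mul_assoc] at e1 e2 ⊢
        exact e1.trans e2 }
  have hc : ringConGen (SuperSymRel K E O) ≤ c := by
    refine RingCon.ringConGen_le.2 fun x y h => ?_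
    intro a b
    cases h with
    | even_comm e v =>
      have hv : v = (v.1, 0) + (0, v.2) := by simp
      rw [hv, map_add]
      simp only [mul_add, add_mul, map_add]
      have h1 := tensorSymm_swap f (v.1, (0 : O)) (e, 0) false false (by simp [homPart])
        (by simp [homPart]) a b
      have h2 := tensorSymm_swap f ((0 : E), v.2) (e, 0) true false (by simp [homPart])
        (by simp [homPart]) a b
      simp only [Bool.false_eq_true, and_false, if_false, one_smul] at h1 h2
      rw [h1, h2]
    | odd_anticomm p q =>
      have h1 := tensorSymm_swap f ((0 : E), q) ((0 : E), p) true true (by simp [homPart])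
        (by simp [homPart]) a b
      simp only [and_self, if_true, neg_smul, one_smul] at h1
      rw [h1]
      simp
  { toFun := fun x => Quotient.liftOn x (tensorSymm f) fun x y h => by
      have := hc h 1 1
      simpa using this
    map_add' := by
      rintro ⟨x⟩ ⟨y⟩
      exact map_add (tensorSymm f) x y
    map_smul' := by
      rintro r ⟨x⟩
      exact map_smul (tensorSymm f) r x }

theorem symLift_prod (f : ∀ n : ℕ, MultilinearMap K (fun _ : Fin n => E × O) W) {n : ℕ}
    (v : Fin n → E × O) :
    symLift f (List.ofFn fun i => (gen (v i) : SuperSym K E O)).prod = gradedSymm (f n) v := by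
  have : (List.ofFn fun i => (gen (v i) : SuperSym K E O)).prod =
      mk (TensorAlgebra.tprod K (E × O) n v) := by
    rw [TensorAlgebra.tprod_apply, map_list_prod, List.map_ofFn]
    rfl
  rw [this, ← tensorSymm_tprod]
  rfl

/-- The symmetrized homotopy on `Sym V`, `V = E ⊕ O`, determined by a degree `-1` map `h` and a
degree `0` map `q` of `V` (in a deformation retract `q = i p`). On `Sym^n V` it is
`(1 / n!) ∑ j, ∑ σ, τ_σ (id^{⊗ j} ⊗ h ⊗ q^{⊗ (n-1-j)}) τ_σ⁻¹`. The parity operator on the first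
`j` factors is the Koszul sign for moving the odd map `h` past them. -/
def symHomotopy (h q : E × O →ₗ[K] E × O) : SuperSym K E O →ₗ[K] SuperSym K E O :=
  symLift fun n => ∑ j : Fin n,
    (MultilinearMap.mkPiAlgebraFin K n (SuperSym K E O)).compLinearMap fun k =>
      if k < j then gen ∘ₗ LinearMap.prodMap LinearMap.id (-LinearMap.id)
      else if k = j then gen ∘ₗ h
      else gen ∘ₗ q

/-! #### Word length and cohomological degree -/

variable (K E O) in
/-- The subspace `Sym^n (E ⊕ O)` of `Sym (E ⊕ O)`, spanned by the products of `n` generators. -/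
def symPow (n : ℕ) : Submodule K (SuperSym K E O) :=
  Submodule.span K {x | ∃ l : List (E × O), l.length = n ∧ (l.map gen).prod = x}

variable (K E O) in
/-- The part of cohomological degree `k` of `Sym (E ⊕ O)`, when `E` sits in degree `0` and `O` in
degree `-1`: it is spanned by the products of generators from `E` and `O` of which exactly `-k`
are from `O`. -/
def cohDegree (k : ℤ) : Submodule K (SuperSym K E O) :=
  Submodule.span K {x | ∃ l : List (E ⊕ O), -(l.countP Sum.isRight : ℤ) = k ∧
    (l.map (Sum.elim (fun e => gen (e, 0)) fun o => gen (0, o))).prod = x}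

theorem one_mem_symPow : (1 : SuperSym K E O) ∈ symPow K E O 0 :=
  Submodule.subset_span ⟨[], rfl, by simp⟩

theorem gen_mul_mem_symPow {n : ℕ} (v : E × O) {x : SuperSym K E O} (hx : x ∈ symPow K E O n) :
    gen v * x ∈ symPow K E O (n + 1) := by
  induction hx using Submodule.span_induction with
  | zero => simp
  | add p q _ _ hp hq => rw [mul_add]; exact Submodule.add_mem _ hp hq
  | smul c p _ hp => rw [mul_smul_comm]; exact Submodule.smul_mem _ _ hp
  | mem p hp =>
    obtain ⟨l, rfl, rfl⟩ := hp
    exact Submodule.subset_span ⟨v :: l, by simp, by simp⟩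

theorem symPow_zero_le : symPow K E O 0 ≤ Submodule.span K {1} := by
  refine Submodule.span_le.2 ?_
  rintro _ ⟨l, hl, rfl⟩
  obtain rfl := List.length_eq_zero_iff.1 hl
  exact Submodule.subset_span (by simp)

theorem symPow_induction {P : ℕ → SuperSym K E O → Prop} (one : P 0 1)
    (hzero : ∀ n, P n 0) (add : ∀ n x y, P n x → P n y → P n (x + y))
    (smul : ∀ n (c : K) x, P n x → P n (c • x))
    (gen_mul : ∀ n v x, x ∈ symPow K E O n → P n x → P (n + 1) (gen v * x))
    {n : ℕ} {x : SuperSym K E O} (hx : x ∈ symPow K E O n) : P n x := by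
  induction hx using Submodule.span_induction with
  | zero => exact hzero n
  | add p q _ _ hp hq => exact add n p q hp hq
  | smul c p _ hp => exact smul n c p hp
  | mem p hp =>
    obtain ⟨l, rfl, rfl⟩ := hp
    induction l with
    | nil => simpa using one
    | cons v l ih =>
      rw [List.map_cons, List.prod_cons, List.length_cons]
      exact gen_mul _ _ _ (Submodule.subset_span ⟨l, rfl, rfl⟩) ih

theorem exists_mem_iSup_symPow (x : SuperSym K E O) : x ∈ ⨆ n, symPow K E O n := by
  induction x using induction_left with
  | one => exact Submodule.mem_iSup_of_mem 0 one_mem_symPow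
  | add x y hx hy => exact Submodule.add_mem _ hx hy
  | smul c x hx => exact Submodule.smul_mem _ _ hx
  | gen_mul v x hx =>
    induction hx using Submodule.iSup_induction' with
    | mem n x hx => exact Submodule.mem_iSup_of_mem (n + 1) (gen_mul_mem_symPow v hx)
    | zero => simp
    | add x y _ _ hx hy => rw [mul_add]; exact Submodule.add_mem _ hx hy

theorem symHomotopy_mem_symPow (h q : E × O →ₗ[K] E × O) {n : ℕ} {x : SuperSym K E O}
    (hx : x ∈ symPow K E O n) : symHomotopy h q x ∈ symPow K E O n := by
  induction hx using Submodule.span_induction with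
  | zero => simp
  | add p r _ _ hp hr => rw [map_add]; exact Submodule.add_mem _ hp hr
  | smul c p _ hp => rw [map_smul]; exact Submodule.smul_mem _ _ hp
  | mem p hp =>
    obtain ⟨l, rfl, rfl⟩ := hp
    have e : (l.map (gen : E × O →ₗ[K] SuperSym K E O)).prod =
        (List.ofFn fun i => (gen (l.get i) : SuperSym K E O)).prod := by
      congr 1
      conv_lhs => rw [← List.ofFn_get l, List.map_ofFn]
      rfl
    rw [e, symHomotopy, symLift_prod, gradedSymm_apply]
    refine Submodule.smul_mem _ _ (Submodule.sum_mem _ fun σ _ => Submodule.sum_mem _ fun ε _ =>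
      Submodule.smul_mem _ _ ?_)
    rw [sum_apply]
    refine Submodule.sum_mem _ fun j _ => ?_
    rw [MultilinearMap.compLinearMap_apply, MultilinearMap.mkPiAlgebraFin_apply]
    refine Submodule.subset_span ⟨List.ofFn fun k =>
      (if k < j then LinearMap.prodMap LinearMap.id (-LinearMap.id)
        else if k = j then h else q) (homPart K (ε (σ k)) (l.get (σ k))), by simp, ?_⟩
    rw [List.map_ofFn]
    congr 2
    funext k
    simp only [Function.comp]
    split_ifs <;> rfl

/-- The odd derivation of `Sym (E ⊕ O)` with values `(e, o) ↦ (D o, 0)` on generators: the linear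
map `d` with `d (gen (e, o)) = gen (D o, 0)` and `d (x y) = (d x) y + (-1)^|x| x (d y)`. -/
def oddDer (D : O →ₗ[K] E) : SuperSym K E O →ₗ[K] SuperSym K E O :=
  twistedDer parity (gen ∘ₗ LinearMap.inl K E O ∘ₗ D ∘ₗ LinearMap.snd K E O)
    (by
      intro e' v
      have h1 := gen_even_comm (K := K) (O := O) e' (D v.2, 0)
      simp only [LinearMap.comp_apply, LinearMap.snd_apply, LinearMap.inl_apply, parity_gen,
        map_zero, neg_zero, zero_mul, mul_zero, zero_add, add_zero, h1])
    (by
      intro a b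
      have h1 := gen_even_comm (K := K) (D b) ((0 : E), a)
      have h2 := gen_even_comm (K := K) (D a) ((0 : E), b)
      have h3 : ∀ c : O, (gen ((0 : E), -c) : SuperSym K E O) = -gen ((0 : E), c) := by
        intro c; rw [← map_neg]; simp
      simp only [LinearMap.comp_apply, LinearMap.snd_apply,
        LinearMap.inl_apply, parity_gen, h3, neg_mul]
      rw [h1, h2]
      abel)

theorem oddDer_one (D : O →ₗ[K] E) : oddDer D 1 = 0 := twistedDer_one ..

theorem oddDer_gen_mul (D : O →ₗ[K] E) (w : E × O) (x : SuperSym K E O) :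
    oddDer D (gen w * x) = gen (D w.2, 0) * x + gen (w.1, -w.2) * oddDer D x := by
  rw [oddDer, twistedDer_gen_mul, parity_gen]
  rfl

/-! #### The Chevalley-Eilenberg differential -/

section ChevalleyEilenberg

variable {M : Type*} [AddCommGroup M] [Module K M] (β : M →ₗ[K] M →ₗ[K] M)

/-- For an even generator `(e, 0)`, the odd derivation with `(e', o') ↦ (-β e o', 0)`. -/
def adEven (e : M) : SuperSym K M M →ₗ[K] SuperSym K M M := oddDer (-β e)

/-- For an odd generator `(0, o)`, the even derivation with `(e', o') ↦ (β o e', β o o')`. -/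
def adOdd (o : M) : SuperSym K M M →ₗ[K] SuperSym K M M :=
  twistedDer (AlgHom.id K _) (gen ∘ₗ LinearMap.prodMap (β o) (β o))
    (by
      intro e' v
      have h1 := gen_even_comm (K := K) (β o e') v
      have h2 := gen_even_comm (K := K) e' (β o v.1, β o v.2)
      simp only [LinearMap.comp_apply, LinearMap.prodMap_apply, map_zero, AlgHom.id_apply]
      rw [h1, h2, add_comm])
    (by
      intro a b
      have h1 := gen_odd_anticomm (K := K) (E := M) (β o a) b
      have h2 := gen_odd_anticomm (K := K) (E := M) a (β o b)
      simp only [LinearMap.comp_apply, LinearMap.prodMap_apply, map_zero, AlgHom.id_apply]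
      rw [h1, h2]
      abel)

theorem adEven_one (e : M) : adEven β e 1 = 0 := oddDer_one _

theorem adOdd_one (o : M) : adOdd β o 1 = 0 := twistedDer_one ..

theorem adEven_gen_mul (e : M) (w : M × M) (x : SuperSym K M M) :
    adEven β e (gen w * x) = gen (-β e w.2, 0) * x + gen (w.1, -w.2) * adEven β e x := by
  rw [adEven, oddDer_gen_mul]
  rfl

theorem adOdd_gen_mul (o : M) (w : M × M) (x : SuperSym K M M) :
    adOdd β o (gen w * x) = gen (β o w.1, β o w.2) * x + gen w * adOdd β o x := by
  rw [adOdd, twistedDer_gen_mul]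
  rfl

/-- `adEven` as a linear map. -/
def adEvenLin : M →ₗ[K] Module.End K (SuperSym K M M) where
  toFun := adEven β
  map_add' e f := by
    refine LinearMap.ext fun x => ?_
    rw [LinearMap.add_apply]
    induction x using induction_left with
    | one => simp [adEven_one]
    | add x y hx hy => simp only [map_add, hx, hy]; abel
    | smul c x hx => simp only [map_smul, hx, smul_add]
    | gen_mul u x hx =>
      have : (gen (-β (e + f) u.2, (0 : M)) : SuperSym K M M) =
          gen (-β e u.2, (0 : M)) + gen (-β f u.2, (0 : M)) := by
        rw [← map_add]; simp [add_comm]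
      simp only [adEven_gen_mul, hx, this, add_mul, mul_add]
      abel
  map_smul' c e := by
    refine LinearMap.ext fun x => ?_
    rw [LinearMap.smul_apply, RingHom.id_apply]
    induction x using induction_left with
    | one => simp [adEven_one]
    | add x y hx hy => simp only [map_add, hx, hy, smul_add]
    | smul d x hx => simp only [map_smul, hx, smul_comm c]
    | gen_mul u x hx =>
      have : (gen (-β (c • e) u.2, (0 : M)) : SuperSym K M M) = c • gen (-β e u.2, (0 : M)) := by
        rw [← map_smul]; simp
      simp only [adEven_gen_mul, hx, this, smul_add, smul_mul_assoc, mul_smul_comm]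

/-- `adOdd` as a linear map. -/
def adOddLin : M →ₗ[K] Module.End K (SuperSym K M M) where
  toFun := adOdd β
  map_add' e f := by
    refine LinearMap.ext fun x => ?_
    rw [LinearMap.add_apply]
    induction x using induction_left with
    | one => simp [adOdd_one]
    | add x y hx hy => simp only [map_add, hx, hy]; abel
    | smul c x hx => simp only [map_smul, hx, smul_add]
    | gen_mul u x hx =>
      have : (gen (β (e + f) u.1, β (e + f) u.2) : SuperSym K M M) =
          gen (β e u.1, β e u.2) + gen (β f u.1, β f u.2) := by
        rw [← map_add]; simp
      simp only [adOdd_gen_mul, hx, this, add_mul, mul_add]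
      abel
  map_smul' c e := by
    refine LinearMap.ext fun x => ?_
    rw [LinearMap.smul_apply, RingHom.id_apply]
    induction x using induction_left with
    | one => simp [adOdd_one]
    | add x y hx hy => simp only [map_add, hx, hy, smul_add]
    | smul d x hx => simp only [map_smul, hx, smul_comm c]
    | gen_mul u x hx =>
      have : (gen (β (c • e) u.1, β (c • e) u.2) : SuperSym K M M) =
          c • gen (β e u.1, β e u.2) := by
        rw [← map_smul]; simp
      simp only [adOdd_gen_mul, hx, this, smul_add, smul_mul_assoc, mul_smul_comm]

/-- The operator `ad v`, for a generator `v`: the graded derivation of degree `|v| + 1` with values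
`ad v w = b(v, w)` on generators. Here `b` is the degree `1` graded symmetric pairing with
`b(o, o') = β o o'` (odd), `b(o, e') = β o e'` and `b(e, o') = -β e o'` (even) and `b(e, e') = 0`,
for `e, e'` even and `o, o'` odd. -/
def adGen : M × M →ₗ[K] Module.End K (SuperSym K M M) :=
  LinearMap.coprod (adEvenLin β) (adOddLin β)

theorem adGen_apply (v : M × M) (x : SuperSym K M M) :
    adGen β v x = adEven β v.1 x + adOdd β v.2 x := rfl

theorem adGen_even (e : M) (x : SuperSym K M M) : adGen β (e, 0) x = adEven β e x := by
  have : adOddLin β 0 x = 0 := by rw [map_zero]; rfl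
  rw [adGen_apply]
  exact (congrArg (adEven β e x + ·) this).trans (add_zero _)

theorem adGen_odd (o : M) (x : SuperSym K M M) : adGen β (0, o) x = adOdd β o x := by
  have : adEvenLin β 0 x = 0 := by rw [map_zero]; rfl
  rw [adGen_apply]
  exact (congrArg (· + adOdd β o x) this).trans (zero_add _)

theorem adGen_one (v : M × M) : adGen β v 1 = 0 := by
  rw [adGen_apply, adEven_one, adOdd_one, add_zero]

variable (hβ : ∀ x y, β x y = -β y x)

/-- The operator `(x, y) ↦ (v x, ad v x + (-1)^|v| v y)`. -/
def ceOp : M × M →ₗ[K] Module.End K (SuperSym K M M × SuperSym K M M) where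
  toFun v :=
    { toFun := fun p => (gen v * p.1, adGen β v p.1 + parity (gen v) * p.2)
      map_add' := by intro p q; ext <;> simp [mul_add]; abel
      map_smul' := by intro c p; ext <;> simp }
  map_add' := by
    intro v w
    ext <;> simp [add_mul]
  map_smul' := by intro c v; ext <;> simp

/-- The algebra homomorphism `a ↦ ((x, y) ↦ (a x, …))` extending `ceOp`. -/
def ceHom : SuperSym K M M →ₐ[K] Module.End K (SuperSym K M M × SuperSym K M M) :=
  lift (B := Module.End K (SuperSym K M M × SuperSym K M M)) (ceOp β)
    (by
      intro e v
      refine LinearMap.ext fun p => Prod.ext ?_ ?_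
      · simp only [ceOp, Module.End.mul_apply, LinearMap.coe_mk, AddHom.coe_mk]
        rw [← mul_assoc, ← mul_assoc, gen_even_comm]
      · simp only [ceOp, Module.End.mul_apply, LinearMap.coe_mk, AddHom.coe_mk]
        have hv : adGen β v (gen (e, 0) * p.1) =
            gen (β v.2 e, 0) * p.1 + gen (e, 0) * adGen β v p.1 := by
          rw [adGen_apply, adGen_apply, adEven_gen_mul, adOdd_gen_mul]
          have h2 : gen ((0 : M), (0 : M)) = (0 : SuperSym K M M) := map_zero gen
          simp only [map_zero, neg_zero, h2, zero_mul, zero_add, mul_add]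
          abel
        rw [hv, adGen_even, adGen_even, adEven_gen_mul, hβ v.2 e, parity_gen, parity_gen]
        simp only [neg_zero, mul_add, ← mul_assoc]
        rw [gen_even_comm e (v.1, -v.2)]
        abel)
    (by
      intro a b
      refine LinearMap.ext fun p => Prod.ext ?_ ?_
      · simp only [ceOp, Module.End.mul_apply, LinearMap.coe_mk, AddHom.coe_mk,
          LinearMap.neg_apply, Prod.fst_neg]
        rw [← mul_assoc, ← mul_assoc, gen_odd_anticomm, neg_mul]
      · simp only [ceOp, Module.End.mul_apply, LinearMap.coe_mk, AddHom.coe_mk,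
          LinearMap.neg_apply, Prod.snd_neg]
        have h3 : ∀ c : M, (gen ((0 : M), -c) : SuperSym K M M) = -gen ((0 : M), c) := by
          intro c; rw [← map_neg]; simp
        simp only [adGen_odd, adOdd_gen_mul, parity_gen, h3, map_zero, hβ b a, neg_mul, mul_add,
          mul_neg, neg_neg, ← mul_assoc]
        rw [gen_odd_anticomm a b]
        simp only [neg_mul]
        abel)

/-- The Chevalley-Eilenberg differential of a bracket `β` (skew-symmetric, of degree `1` in the
shifted grading): the linear map with `d 1 = 0` and `d (v x) = ad v x + (-1)^|v| v d x` for a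
homogeneous generator `v`. Iterating this rule gives
`d (v 1 ⋯ v n) = ∑_{i < j} ± b(v i, v j) v 1 ⋯ v n` (the letters `v i`, `v j` omitted in the last
product), where `±` is the Koszul sign of moving `v i` and `v j` to the front. -/
def chevalleyEilenberg : SuperSym K M M →ₗ[K] SuperSym K M M where
  toFun a := (ceHom β hβ a (1, 0)).2
  map_add' := by intro a b; simp
  map_smul' := by intro c a; simp

theorem ceHom_gen_apply (v : M × M) (p : SuperSym K M M × SuperSym K M M) :
    ceHom β hβ (gen v) p = (gen v * p.1, adGen β v p.1 + parity (gen v) * p.2) := by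
  simp [ceHom, ceOp]

theorem ceHom_apply_one_fst (x : SuperSym K M M) : (ceHom β hβ x (1, 0)).1 = x := by
  induction x using induction_left with
  | one => simp
  | add x y hx hy => simp [hx, hy]
  | smul c x hx => simp [hx]
  | gen_mul v x hx => rw [map_mul, Module.End.mul_apply, ceHom_gen_apply, hx]

theorem chevalleyEilenberg_one : chevalleyEilenberg β hβ 1 = 0 := by
  simp [chevalleyEilenberg]

theorem chevalleyEilenberg_gen_mul (v : M × M) (x : SuperSym K M M) :
    chevalleyEilenberg β hβ (gen v * x) =
      adGen β v x + parity (gen v) * chevalleyEilenberg β hβ x := by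
  simp only [chevalleyEilenberg, LinearMap.coe_mk, AddHom.coe_mk]
  rw [map_mul, Module.End.mul_apply, ceHom_gen_apply, ceHom_apply_one_fst]

theorem adGen_mem_symPow (v : M × M) {n : ℕ} {x : SuperSym K M M} (hx : x ∈ symPow K M M n) :
    adGen β v x ∈ symPow K M M n := by
  have h1 : adEven β v.1 x ∈ symPow K M M n := by
    refine symPow_induction (P := fun n x => adEven β v.1 x ∈ symPow K M M n) ?_ ?_ ?_ ?_ ?_ hx
    · rw [adEven_one]; exact Submodule.zero_mem _
    · intro n; rw [map_zero]; exact Submodule.zero_mem _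
    · intro n x y hx hy; rw [map_add]; exact Submodule.add_mem _ hx hy
    · intro n c x hx; rw [map_smul]; exact Submodule.smul_mem _ _ hx
    · intro n w x hx hx'
      rw [adEven_gen_mul]
      exact Submodule.add_mem _ (gen_mul_mem_symPow _ hx) (gen_mul_mem_symPow _ hx')
  have h2 : adOdd β v.2 x ∈ symPow K M M n := by
    refine symPow_induction (P := fun n x => adOdd β v.2 x ∈ symPow K M M n) ?_ ?_ ?_ ?_ ?_ hx
    · rw [adOdd_one]; exact Submodule.zero_mem _
    · intro n; rw [map_zero]; exact Submodule.zero_mem _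
    · intro n x y hx hy; rw [map_add]; exact Submodule.add_mem _ hx hy
    · intro n c x hx; rw [map_smul]; exact Submodule.smul_mem _ _ hx
    · intro n w x hx hx'
      rw [adOdd_gen_mul]
      exact Submodule.add_mem _ (gen_mul_mem_symPow _ hx) (gen_mul_mem_symPow _ hx')
  exact Submodule.add_mem _ h1 h2

theorem chevalleyEilenberg_mem_symPow {n : ℕ} {x : SuperSym K M M} (hx : x ∈ symPow K M M n) :
    chevalleyEilenberg β hβ x = 0 ∨ 0 < n ∧
      chevalleyEilenberg β hβ x ∈ symPow K M M (n - 1) := by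
  suffices h : (n = 0 → chevalleyEilenberg β hβ x = 0) ∧
      chevalleyEilenberg β hβ x ∈ symPow K M M (n - 1) by
    rcases Nat.eq_zero_or_pos n with h0 | h0
    · exact Or.inl (h.1 h0)
    · exact Or.inr ⟨h0, h.2⟩
  refine symPow_induction (P := fun n x => (n = 0 → chevalleyEilenberg β hβ x = 0) ∧
    chevalleyEilenberg β hβ x ∈ symPow K M M (n - 1)) ?_ ?_ ?_ ?_ ?_ hx
  · rw [chevalleyEilenberg_one]; exact ⟨fun _ => rfl, Submodule.zero_mem _⟩
  · intro n; rw [map_zero]; exact ⟨fun _ => rfl, Submodule.zero_mem _⟩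
  · intro n x y hx hy
    rw [map_add]
    exact ⟨fun h => by rw [hx.1 h, hy.1 h, add_zero], Submodule.add_mem _ hx.2 hy.2⟩
  · intro n c x hx
    rw [map_smul]
    exact ⟨fun h => by rw [hx.1 h, smul_zero], Submodule.smul_mem _ _ hx.2⟩
  · intro n v x hx hx'
    refine ⟨fun h => absurd h (Nat.succ_ne_zero n), ?_⟩
    rw [chevalleyEilenberg_gen_mul, Nat.add_sub_cancel]
    refine Submodule.add_mem _ (adGen_mem_symPow β v hx) ?_
    rcases Nat.eq_zero_or_pos n with h0 | h0
    · rw [hx'.1 h0, mul_zero]; exact Submodule.zero_mem _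
    · obtain ⟨m, rfl⟩ : ∃ m, n = m + 1 := ⟨n - 1, by omega⟩
      rw [parity_gen]
      exact gen_mul_mem_symPow _ hx'.2

/-- The perturbation `d_CE h` is locally nilpotent, since `d_CE` lowers the `Sym`-degree by one. -/
theorem exists_pow_apply_eq_zero (h q : M × M →ₗ[K] M × M) (x : SuperSym K M M) :
    ∃ N : ℕ, ∀ j, N ≤ j →
      ((chevalleyEilenberg β hβ ∘ₗ symHomotopy h q : Module.End K (SuperSym K M M)) ^ j) x = 0 := by
  have key : ∀ (n : ℕ) (x : SuperSym K M M), x ∈ symPow K M M n → ∀ j, n < j →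
      ((chevalleyEilenberg β hβ ∘ₗ symHomotopy h q : Module.End K (SuperSym K M M)) ^ j) x = 0 := by
    intro n
    induction n with
    | zero =>
      intro x hx j hj
      obtain ⟨i, rfl⟩ : ∃ i, j = i + 1 := ⟨j - 1, by omega⟩
      rw [pow_succ, Module.End.mul_apply, LinearMap.comp_apply]
      rcases chevalleyEilenberg_mem_symPow β hβ (symHomotopy_mem_symPow h q hx) with h0 | h0
      · rw [h0, map_zero]
      · exact absurd h0.1 (lt_irrefl 0)
    | succ n ih =>
      intro x hx j hj
      obtain ⟨i, rfl⟩ : ∃ i, j = i + 1 := ⟨j - 1, by omega⟩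
      rw [pow_succ, Module.End.mul_apply, LinearMap.comp_apply]
      rcases chevalleyEilenberg_mem_symPow β hβ (symHomotopy_mem_symPow h q hx) with h0 | h0
      · rw [h0, map_zero]
      · exact ih _ h0.2 i (by omega)
  induction exists_mem_iSup_symPow x using Submodule.iSup_induction' with
  | mem n x hx => exact ⟨n + 1, fun j hj => key n x hx j hj⟩
  | zero => exact ⟨0, fun j _ => map_zero _⟩
  | add x y _ _ hx hy =>
    obtain ⟨N, hN⟩ := hx
    obtain ⟨N', hN'⟩ := hy
    exact ⟨max N N', fun j hj => by
      rw [map_add, hN j (le_of_max_le_left hj), hN' j (le_of_max_le_right hj), add_zero]⟩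

/-- The operator `∑_{j ≥ 0} (d_CE h)^j`; the sum is finite on every element. -/
def perturbationSeries (h q : M × M →ₗ[K] M × M) : SuperSym K M M →ₗ[K] SuperSym K M M where
  toFun x := ∑ᶠ j : ℕ,
    ((chevalleyEilenberg β hβ ∘ₗ symHomotopy h q : Module.End K (SuperSym K M M)) ^ j) x
  map_add' x y := by
    have fin : ∀ x, (Function.support fun j : ℕ => ((chevalleyEilenberg β hβ ∘ₗ symHomotopy h q :
        Module.End K (SuperSym K M M)) ^ j) x).Finite := by
      intro x
      obtain ⟨N, hN⟩ := exists_pow_apply_eq_zero β hβ h q x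
      exact (Set.finite_lt_nat N).subset fun j hj => by
        by_contra hlt
        exact hj (hN j (not_lt.1 hlt))
    simp only [map_add]
    exact finsum_add_distrib (fin x) (fin y)
  map_smul' c x := by
    have fin : (Function.support fun j : ℕ => ((chevalleyEilenberg β hβ ∘ₗ symHomotopy h q :
        Module.End K (SuperSym K M M)) ^ j) x).Finite := by
      obtain ⟨N, hN⟩ := exists_pow_apply_eq_zero β hβ h q x
      exact (Set.finite_lt_nat N).subset fun j hj => by
        by_contra hlt
        exact hj (hN j (not_lt.1 hlt))
    simp only [map_smul, RingHom.id_apply]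
    exact (smul_finsum' c fin).symm

end ChevalleyEilenberg

end SuperSym
end SuperSymmetric

/-! ### Compactly supported forms on open intervals -/

/-- The disks of `ℝ`, i.e. its open subsets diffeomorphic to `ℝ`: the non-empty open intervals. -/
def Disk : Type := {D : Opens ℝ // IsConnected (D : Set ℝ)}

namespace FactorizationEnvelope

section Forms

variable (𝕜 : Type*) [RCLike 𝕜]

/-- Smooth `𝕜`-valued functions with compact support in `D`. They serve both as the space
`Ω⁰_c(D)` and, through `f ↦ f dx`, as the space `Ω¹_c(D)`. -/
abbrev CptFun (D : Disk) : Type _ := 𝓓(D.1, 𝕜)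

variable {𝕜}

/-- The de Rham differential `f ↦ f' dx`. -/
def deRham (D : Disk) : CptFun 𝕜 D →ₗ[𝕜] CptFun 𝕜 D where
  toFun f :=
    { toFun := deriv f
      contDiff' := (contDiff_infty_iff_deriv.1 f.contDiff).2
      hasCompactSupport' := f.hasCompactSupport.deriv
      tsupport_subset' := tsupport_deriv_subset.trans f.tsupport_subset }
  map_add' f g := by
    ext x
    exact deriv_add (f.contDiff.differentiable (by simp) x) (g.contDiff.differentiable (by simp) x)
  map_smul' c f := by
    ext x
    exact deriv_const_smul c (f.contDiff.differentiable (by simp) x)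

/-- The product of functions, which is also the product of a function and a `1`-form. -/
def mulFun (D : Disk) : CptFun 𝕜 D →ₗ[𝕜] CptFun 𝕜 D →ₗ[𝕜] CptFun 𝕜 D :=
  LinearMap.mk₂ 𝕜
    (fun f g =>
      { toFun := fun x => f x * g x
        contDiff' := f.contDiff.mul g.contDiff
        hasCompactSupport' := f.hasCompactSupport.mul_right
        tsupport_subset' := (tsupport_mul_subset_left (f := f) (g := g)).trans f.tsupport_subset })
    (fun f g h => by ext x; exact add_mul (f x) (g x) (h x))
    (fun c f g => by ext x; exact mul_assoc c (f x) (g x))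
    (fun f g h => by ext x; exact mul_add (f x) (g x) (h x))
    (fun c f g => by ext x; exact mul_left_comm (f x) c (g x))

/-- Extension by zero along an inclusion of disks. -/
def extend {D D' : Disk} (h : D.1 ≤ D'.1) : CptFun 𝕜 D →ₗ[𝕜] CptFun 𝕜 D' where
  toFun f := ⟨f, f.contDiff, f.hasCompactSupport, f.tsupport_subset.trans h⟩
  map_add' _ _ := rfl
  map_smul' _ _ := rfl

theorem integrable_cptFun {D : Disk} (f : CptFun 𝕜 D) : Integrable f :=
  f.continuous.integrable_of_hasCompactSupport f.hasCompactSupport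

/-- The integral of a `1`-form. -/
def integralForm (D : Disk) : CptFun 𝕜 D →ₗ[𝕜] 𝕜 where
  toFun f := ∫ x, f x
  map_add' f g := integral_add (integrable_cptFun f) (integrable_cptFun g)
  map_smul' c f := integral_const_mul c f

variable (𝕜) in
/-- The `1`-forms `ω_D dx` on `D` with compact support and `∫ ω_D dx = 1`. -/
def UnitForm (D : Disk) : Type _ := {ω : CptFun 𝕜 D // ∫ x, ω x = 1}

variable (𝕜) in
theorem nonempty_unitForm (D : Disk) : Nonempty (UnitForm 𝕜 D) := by
  obtain ⟨c, hc⟩ := D.2.nonempty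
  obtain ⟨r, hr, hball⟩ := Metric.isOpen_iff.1 D.1.isOpen c hc
  let b : ContDiffBump c := ⟨r / 4, r / 2, by positivity, by linarith⟩
  have hint : ∫ x, ((b.normed volume x : ℝ) : 𝕜) = 1 := by
    rw [integral_ofReal, b.integral_normed, RCLike.ofReal_one]
  refine ⟨⟨⟨fun x => ((b.normed volume x : ℝ) : 𝕜), ?_, ?_, ?_⟩, hint⟩⟩
  · exact (RCLike.ofRealCLM (K := 𝕜)).contDiff.comp b.contDiff_normed
  · exact b.hasCompactSupport_normed.comp_left RCLike.ofReal_zero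
  · refine (closure_mono (Function.support_comp_subset RCLike.ofReal_zero _)).trans ?_
    change tsupport (b.normed volume) ⊆ _
    rw [b.tsupport_normed_eq]
    exact (Metric.closedBall_subset_ball (by change r / 2 < r; linarith)).trans hball

/-- The primitive `x ↦ ∫_{-∞}^x f` of a `1`-form `f dx` with vanishing integral. -/
def primitive {D : Disk} (f : CptFun 𝕜 D) (hf : ∫ x, f x = 0) : CptFun 𝕜 D :=
  have hsupp : ∃ K : Set ℝ, IsCompact K ∧ K ⊆ D.1 ∧ ∀ x, x ∉ K → ∫ t in Set.Iic x, f t = 0 := by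
    have hc : IsCompact (tsupport f) := f.hasCompactSupport
    rcases (tsupport f).eq_empty_or_nonempty with he | hne
    · refine ⟨∅, isCompact_empty, Set.empty_subset _, fun x _ => ?_⟩
      have : ∀ t, f t = 0 := fun t => image_eq_zero_of_notMem_tsupport (by simp [he])
      simp [this]
    · obtain ⟨a, ha, ha'⟩ := hc.exists_isLeast hne
      obtain ⟨b, hb, hb'⟩ := hc.exists_isGreatest hne
      refine ⟨Set.Icc a b, isCompact_Icc,
        D.2.isPreconnected.Icc_subset (f.tsupport_subset ha) (f.tsupport_subset hb), ?_⟩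
      intro x hx
      by_cases hxa : x < a
      · refine setIntegral_eq_zero_of_forall_eq_zero fun t ht => ?_
        refine image_eq_zero_of_notMem_tsupport fun h => ?_
        exact absurd ((ha' h).trans ht) (not_le.2 hxa)
      · have hxb : b < x := by
          by_contra h
          exact hx ⟨not_lt.1 hxa, not_lt.1 h⟩
        rw [setIntegral_eq_integral_of_forall_compl_eq_zero, hf]
        intro t ht
        refine image_eq_zero_of_notMem_tsupport fun h => ht ?_
        exact (hb' h).trans hxb.le
  have hderiv : ∀ x, HasDerivAt (fun x => ∫ t in Set.Iic x, f t) (f x) x := by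
    intro x
    have h1 : (fun x => ∫ t in Set.Iic x, f t) =
        fun x => (∫ t in Set.Iic (0 : ℝ), f t) + ∫ t in (0 : ℝ)..x, f t := by
      funext y
      rw [← intervalIntegral.integral_Iic_sub_Iic (integrable_cptFun f).integrableOn
        (integrable_cptFun f).integrableOn]
      ring
    rw [h1]
    exact ((f.continuous.integral_hasStrictDerivAt 0 x).hasDerivAt).const_add _
  { toFun := fun x => ∫ t in Set.Iic x, f t
    contDiff' := by
      refine contDiff_infty_iff_deriv.2 ⟨fun x => (hderiv x).differentiableAt, ?_⟩
      have : deriv (fun x => ∫ t in Set.Iic x, f t) = f := funext fun x => (hderiv x).deriv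
      rw [this]
      exact f.contDiff
    hasCompactSupport' := by
      obtain ⟨K, hK, -, h0⟩ := hsupp
      exact HasCompactSupport.intro hK fun x hx => h0 x hx
    tsupport_subset' := by
      obtain ⟨K, hK, hKD, h0⟩ := hsupp
      refine (closure_minimal (fun x hx => ?_) hK.isClosed).trans hKD
      by_contra h
      exact hx (h0 x h) }

/-- The operator `h¹_D(f dx) = ∫ (f dx - (∫_D f dx) ω_D)`, with `∫` the primitive that vanishes at
the left end of `D`. -/
def homotopyForm {D : Disk} (ω : UnitForm 𝕜 D) : CptFun 𝕜 D →ₗ[𝕜] CptFun 𝕜 D :=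
  have hz : ∀ f : CptFun 𝕜 D, ∫ x, (f - (∫ x, f x) • ω.1) x = 0 := by
    intro f
    have h1 : ∀ x, (f - (∫ x, f x) • ω.1) x = f x - (∫ x, f x) * ω.1 x := fun x => rfl
    simp only [h1]
    rw [integral_sub (integrable_cptFun f) ((integrable_cptFun ω.1).const_mul _),
      integral_const_mul, ω.2, mul_one, sub_self]
  { toFun := fun f => primitive (f - (∫ x, f x) • ω.1) (hz f)
    map_add' := by
      intro f g
      ext x
      change ∫ t in Set.Iic x, ((f t + g t) - (∫ x, (f x + g x)) * ω.1 t) =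
        (∫ t in Set.Iic x, (f t - (∫ x, f x) * ω.1 t)) +
          ∫ t in Set.Iic x, (g t - (∫ x, g x) * ω.1 t)
      rw [← integral_add]
      · rw [integral_add (integrable_cptFun f) (integrable_cptFun g)]
        congr 1
        funext t
        ring
      · exact ((integrable_cptFun f).sub ((integrable_cptFun ω.1).const_mul _)).integrableOn
      · exact ((integrable_cptFun g).sub ((integrable_cptFun ω.1).const_mul _)).integrableOn
    map_smul' := by
      intro c f
      ext x
      change ∫ t in Set.Iic x, (c * f t - (∫ x, c * f x) * ω.1 t) =
        c * ∫ t in Set.Iic x, (f t - (∫ x, f x) * ω.1 t)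
      rw [← integral_const_mul, integral_const_mul (μ := volume) c f]
      congr 1
      funext t
      ring }

end Forms


section Envelope

variable (𝕜 : Type*) [RCLike 𝕜] (𝔤 : Type*) [LieRing 𝔤] [LieAlgebra 𝕜 𝔤]

/-- `𝔤 ⊗ Ωʳ_c(D)`, for `r = 0` and for `r = 1`. -/
abbrev LieForms (D : Disk) : Type _ := 𝔤 ⊗[𝕜] CptFun 𝕜 D

/-- The graded vector space `Sym ((𝔤 ⊗ Ω_c(D))[1])` underlying the factorization envelope on the
disk `D`. The even generators are the elements of `𝔤 ⊗ Ω¹_c(D)`, in degree `0`, and the odd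
generators are the elements of `𝔤 ⊗ Ω⁰_c(D)`, in degree `-1`. -/
abbrev FactEnv (D : Disk) : Type _ := SuperSym 𝕜 (LieForms 𝕜 𝔤 D) (LieForms 𝕜 𝔤 D)

/-- The bracket `[X ⊗ f, Y ⊗ g] = [X, Y] ⊗ f g` of `𝔤`-valued forms. It stands for the bracket of
two functions and for that of a function and a `1`-form; that of two `1`-forms vanishes. -/
def bracket (D : Disk) : LieForms 𝕜 𝔤 D →ₗ[𝕜] LieForms 𝕜 𝔤 D →ₗ[𝕜] LieForms 𝕜 𝔤 D :=
  TensorProduct.map₂ (LieModule.toEnd 𝕜 𝔤 𝔤 : 𝔤 →ₗ[𝕜] Module.End 𝕜 𝔤) (mulFun D)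

theorem bracket_tmul (D : Disk) (X Y : 𝔤) (f g : CptFun 𝕜 D) :
    bracket 𝕜 𝔤 D (X ⊗ₜ f) (Y ⊗ₜ g) = ⁅X, Y⁆ ⊗ₜ mulFun D f g := rfl

theorem bracket_skew (D : Disk) (x y : LieForms 𝕜 𝔤 D) :
    bracket 𝕜 𝔤 D x y = -bracket 𝕜 𝔤 D y x := by
  induction x using TensorProduct.induction_on with
  | zero => simp
  | add x x' hx hx' => rw [map_add, map_add, LinearMap.add_apply, hx, hx', neg_add]
  | tmul X f =>
    induction y using TensorProduct.induction_on with
    | zero => simp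
    | add y y' hy hy' => rw [map_add, map_add, LinearMap.add_apply, hy, hy', neg_add]
    | tmul Y g =>
      rw [bracket_tmul, bracket_tmul, ← lie_skew X Y, TensorProduct.neg_tmul]
      congr 2
      ext t
      exact mul_comm _ _

/-- The de Rham differential of the shifted complex `(𝔤 ⊗ Ω_c(D))[1]`, which is
`X ⊗ f ↦ -X ⊗ df` by the sign convention of the shift, extended by the Leibniz rule. -/
def dDR (D : Disk) : FactEnv 𝕜 𝔤 D →ₗ[𝕜] FactEnv 𝕜 𝔤 D :=
  SuperSym.oddDer (-(deRham D).lTensor 𝔤)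

/-- The Chevalley-Eilenberg differential of the dg Lie algebra `𝔤 ⊗ Ω_c(D)`. -/
def dCE (D : Disk) : FactEnv 𝕜 𝔤 D →ₗ[𝕜] FactEnv 𝕜 𝔤 D :=
  SuperSym.chevalleyEilenberg (bracket 𝕜 𝔤 D) (bracket_skew 𝕜 𝔤 D)

/-- The differential of the factorization envelope. -/
def differential (D : Disk) : FactEnv 𝕜 𝔤 D →ₗ[𝕜] FactEnv 𝕜 𝔤 D :=
  dDR 𝕜 𝔤 D + dCE 𝕜 𝔤 D

variable {𝕜} {D : Disk} (ω : UnitForm 𝕜 D)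

/-- The homotopy `X ⊗ f dx ↦ X ⊗ h¹_D(f dx)` on `(𝔤 ⊗ Ω_c(D))[1]`. -/
def homotopyGen : LieForms 𝕜 𝔤 D × LieForms 𝕜 𝔤 D →ₗ[𝕜] LieForms 𝕜 𝔤 D × LieForms 𝕜 𝔤 D :=
  LinearMap.inr 𝕜 _ _ ∘ₗ (homotopyForm ω).lTensor 𝔤 ∘ₗ LinearMap.fst 𝕜 _ _

/-- The projection `X ⊗ f dx ↦ X ⊗ (∫_D f dx) ω_D` on `(𝔤 ⊗ Ω_c(D))[1]`, which vanishes on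
functions. -/
def projGen : LieForms 𝕜 𝔤 D × LieForms 𝕜 𝔤 D →ₗ[𝕜] LieForms 𝕜 𝔤 D × LieForms 𝕜 𝔤 D :=
  LinearMap.inl 𝕜 _ _ ∘ₗ ((integralForm D).smulRight ω.1).lTensor 𝔤 ∘ₗ LinearMap.fst 𝕜 _ _

/-- The homotopy of the unperturbed deformation retract. -/
def hMap : FactEnv 𝕜 𝔤 D →ₗ[𝕜] FactEnv 𝕜 𝔤 D :=
  SuperSym.symHomotopy (homotopyGen 𝔤 ω) (projGen 𝔤 ω)

/-- The projection of the unperturbed deformation retract: the algebra homomorphism with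
`X ⊗ f dx ↦ (∫_D f dx) X`, which vanishes on functions. -/
def pMap (D : Disk) : FactEnv 𝕜 𝔤 D →ₐ[𝕜] SymmetricAlgebra 𝕜 𝔤 :=
  SuperSym.lift
    (SymmetricAlgebra.ι 𝕜 𝔤 ∘ₗ (TensorProduct.rid 𝕜 𝔤).toLinearMap ∘ₗ
      (integralForm D).lTensor 𝔤 ∘ₗ LinearMap.fst 𝕜 _ _)
    (fun _ _ => mul_comm _ _) (by intro a b; simp)

/-- The inclusion `i` of the deformation retract: the algebra homomorphism with `X ↦ X ⊗ ω_D`. -/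
def iMap : SymmetricAlgebra 𝕜 𝔤 →ₐ[𝕜] FactEnv 𝕜 𝔤 D :=
  RingCon.liftₐ _ (TensorAlgebra.lift 𝕜
    (SuperSym.gen ∘ₗ LinearMap.inl 𝕜 _ _ ∘ₗ (TensorProduct.mk 𝕜 𝔤 (CptFun 𝕜 D)).flip ω.1)) <| by
    unfold TensorAlgebra.symRingCon
    refine RingCon.ringConGen_le.2 fun x y h => ?_
    rw [RingCon.ker_apply]
    cases h with
    | mul_comm X Y => simpa using SuperSym.gen_even_comm (X ⊗ₜ[𝕜] ω.1) (Y ⊗ₜ[𝕜] ω.1, 0)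

theorem iMap_ι (X : 𝔤) :
    iMap 𝔤 ω (SymmetricAlgebra.ι 𝕜 𝔤 X) = SuperSym.gen (X ⊗ₜ[𝕜] ω.1, 0) :=
  TensorAlgebra.lift_ι_apply _ X

/-- The series `∑_{j ≥ 0} (d_CE h)^j`. -/
def pertSeries : FactEnv 𝕜 𝔤 D →ₗ[𝕜] FactEnv 𝕜 𝔤 D :=
  SuperSym.perturbationSeries (bracket 𝕜 𝔤 D) (bracket_skew 𝕜 𝔤 D) (homotopyGen 𝔤 ω)
    (projGen 𝔤 ω)

/-- The perturbed projection `∑_{j ≥ 0} p (d_CE h)^j`. -/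
def pHat : FactEnv 𝕜 𝔤 D →ₗ[𝕜] SymmetricAlgebra 𝕜 𝔤 :=
  (pMap 𝔤 D).toLinearMap ∘ₗ pertSeries 𝔤 ω

/-- The perturbed homotopy `∑_{j ≥ 0} h (d_CE h)^j`. -/
def hHat : FactEnv 𝕜 𝔤 D →ₗ[𝕜] FactEnv 𝕜 𝔤 D :=
  hMap 𝔤 ω ∘ₗ pertSeries 𝔤 ω

/-- The maps `(i, p̂, ĥ)` form a strong deformation retract of the cochain complex
`(Sym ((𝔤 ⊗ Ω_c(D))[1]), d_dR + d_CE)` onto `Sym 𝔤`, which is concentrated in degree `0` and has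
zero differential. -/
structure IsStrongDeformationRetract : Prop where
  /-- The differential raises the degree by one. -/
  d_degree : ∀ k, ∀ x ∈ SuperSym.cohDegree 𝕜 (LieForms 𝕜 𝔤 D) (LieForms 𝕜 𝔤 D) k,
    differential 𝕜 𝔤 D x ∈ SuperSym.cohDegree 𝕜 (LieForms 𝕜 𝔤 D) (LieForms 𝕜 𝔤 D) (k + 1)
  d_d : ∀ x, differential 𝕜 𝔤 D (differential 𝕜 𝔤 D x) = 0
  /-- The inclusion has degree zero. -/
  i_degree : ∀ a, iMap 𝔤 ω a ∈ SuperSym.cohDegree 𝕜 (LieForms 𝕜 𝔤 D) (LieForms 𝕜 𝔤 D) 0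
  d_i : ∀ a, differential 𝕜 𝔤 D (iMap 𝔤 ω a) = 0
  /-- The projection has degree zero. -/
  p_degree : ∀ k, k ≠ 0 →
    ∀ x ∈ SuperSym.cohDegree 𝕜 (LieForms 𝕜 𝔤 D) (LieForms 𝕜 𝔤 D) k, pHat 𝔤 ω x = 0
  p_d : ∀ x, pHat 𝔤 ω (differential 𝕜 𝔤 D x) = 0
  p_i : ∀ a, pHat 𝔤 ω (iMap 𝔤 ω a) = a
  /-- The homotopy lowers the degree by one. -/
  h_degree : ∀ k, ∀ x ∈ SuperSym.cohDegree 𝕜 (LieForms 𝕜 𝔤 D) (LieForms 𝕜 𝔤 D) k,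
    hHat 𝔤 ω x ∈ SuperSym.cohDegree 𝕜 (LieForms 𝕜 𝔤 D) (LieForms 𝕜 𝔤 D) (k - 1)
  /-- The boundary of the homotopy. -/
  d_h : ∀ x, differential 𝕜 𝔤 D (hHat 𝔤 ω x) + hHat 𝔤 ω (differential 𝕜 𝔤 D x) =
    iMap 𝔤 ω (pHat 𝔤 ω x) - x
  h_i : ∀ a, hHat 𝔤 ω (iMap 𝔤 ω a) = 0
  p_h : ∀ x, pHat 𝔤 ω (hHat 𝔤 ω x) = 0
  h_h : ∀ x, hHat 𝔤 ω (hHat 𝔤 ω x) = 0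

/-- The operations `(D₁, …, Dₙ) → D` of the prefactorization operad: families of mutually disjoint
disks `Dᵢ ⊆ D`. -/
def IsOperation {n : ℕ} (Ds : Fin n → Disk) (D : Disk) : Prop :=
  (∀ k, (Ds k).1 ≤ D.1) ∧ Pairwise fun k l => Disjoint ((Ds k).1 : Set ℝ) ((Ds l).1 : Set ℝ)

variable {n : ℕ} {Ds : Fin n → Disk}

/-- The structure maps of the factorization envelope: extension of forms by zero, followed by the
product of the symmetric algebra, in the order of the tuple. -/
def structureMap (h : IsOperation Ds D) :
    MultilinearMap 𝕜 (fun k => FactEnv 𝕜 𝔤 (Ds k)) (FactEnv 𝕜 𝔤 D) :=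
  (MultilinearMap.mkPiAlgebraFin 𝕜 n (FactEnv 𝕜 𝔤 D)).compLinearMap fun k =>
    (SuperSym.map ((extend (h.1 k)).lTensor 𝔤) ((extend (h.1 k)).lTensor 𝔤)).toLinearMap

/-- The structure maps are cochain maps out of the tensor product of complexes:
`d F(x₁ ⊗ ⋯ ⊗ xₙ) = ∑ₖ (-1)^(|x₁| + ⋯ + |xₖ₋₁|) F(x₁ ⊗ ⋯ ⊗ d xₖ ⊗ ⋯ ⊗ xₙ)`. -/
def IsCochainMap (h : IsOperation Ds D) : Prop :=
  ∀ x : ∀ k, FactEnv 𝕜 𝔤 (Ds k),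
    differential 𝕜 𝔤 D (structureMap 𝔤 h x) = ∑ k, structureMap 𝔤 h fun l =>
      if l < k then SuperSym.parity (x l)
      else if l = k then differential 𝕜 𝔤 (Ds l) (x l)
      else x l

/-- The structure maps `p̂_D ∘ F(ι) ∘ (i_{D₁} ⊗ ⋯ ⊗ i_{Dₙ})` obtained by transfer along the
perturbed deformation retracts. -/
def transferred (ω : ∀ D : Disk, UnitForm 𝕜 D) (h : IsOperation Ds D) :
    MultilinearMap 𝕜 (fun _ : Fin n => SymmetricAlgebra 𝕜 𝔤) (SymmetricAlgebra 𝕜 𝔤) :=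
  (pHat 𝔤 (ω D)).compMultilinearMap
    ((structureMap 𝔤 h).compLinearMap fun k => (iMap 𝔤 (ω (Ds k))).toLinearMap)

/-- The disk `D` lies to the left of the disk `D'`. -/
def Disk.LeftOf (D D' : Disk) : Prop := ∀ x ∈ D.1, ∀ y ∈ D'.1, x < y

variable (𝕜) in
/-- The Gutt star-product: the product of the universal enveloping algebra transported to `Sym 𝔤`
along the symmetrization map, the linear isomorphism with `Xⁿ ↦ Xⁿ` for `X ∈ 𝔤`, equivalently
`X₁ ⋯ Xₙ ↦ (1 / n!) ∑ σ, X_{σ 1} ⋯ X_{σ n}`. -/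
def IsGuttStarProduct
    (star : SymmetricAlgebra 𝕜 𝔤 →ₗ[𝕜] SymmetricAlgebra 𝕜 𝔤 →ₗ[𝕜] SymmetricAlgebra 𝕜 𝔤) : Prop :=
  ∃ e : SymmetricAlgebra 𝕜 𝔤 ≃ₗ[𝕜] UniversalEnvelopingAlgebra 𝕜 𝔤,
    (∀ (X : 𝔤) (n : ℕ), e (SymmetricAlgebra.ι 𝕜 𝔤 X ^ n) =
      UniversalEnvelopingAlgebra.ι 𝕜 X ^ n) ∧
    ∀ a b, e (star a b) = e a * e b

end Envelope

end FactorizationEnvelope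

end

/-!
Write `A_D` for the factorization envelope on a disk `D`, `d` for its de Rham differential and `δ`
for its Chevalley-Eilenberg differential.

**The deformation retract.** `d` is an odd derivation, and `δ` is one up to brackets between the
factors, so that `(d + δ)² = 0` and the compatibility with extension by zero can be checked on
generators (`IsOddDer`, `oddDer_chevalleyEilenberg`, `chevalleyEilenberg_comp_self`). Split the
generators into those in the image of the projection `q = i p` and those in its complement, and let
`b` be the number of factors of the second kind in a monomial. If `H` is the odd derivation that
extends `h` from generators, then counting permutations by the position of the last factor of the
second kind gives `b • h x = H x` (`card_smul_symHomotopy`): the symmetrized homotopy is the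
derivation `H` normalized by `b`. Since `d H + H d = -b`, this gives the unperturbed retract. The
operator `δ h` lowers the word length, so that the series `T = ∑ (δ h)^j` is finite, and `T` turns
the unperturbed into the perturbed retract, as in the homological perturbation lemma
(`isStrongDeformationRetract`). Forms on disjoint disks have bracket zero; hence the structure maps
are cochain maps (`isCochainMap`).

**The star product.** On the subalgebra generated by forms with values in a line of `𝔤`, `δ`
vanishes and `p̂ = p`. As powers of vectors span `Sym 𝔤`, `p̂ i' = id` for the inclusion `i'` of any
other unit form (`pHat_iMap`). An element `x` of degree zero is cohomologous to `i p̂ x`, so `p̂ x` is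
a function of the cohomology class and can be computed after extension to `ℝ` (`pHat_toLine`); and
in a product of elements from disjoint disks, each factor can be replaced by a cohomologous one.
Define `a ⋆ b` as the projection of the product of a representative of `a` on `(-∞, 0)` and a
representative of `b` on `(0, ∞)`. Then the projection of `u v` is the star product of the
projections of `u` and `v`, whenever a point separates `u` on the left from `v` on the right
(`linePHat_mul`). Associativity and the description of all structure maps follow by splitting
products at separating points (`star_assoc`, `transferred_eq_foldr`).

**Comparison with the enveloping algebra.** Forms with values in a line do not interact, whence
`X^m ⋆ X^n = X^(m + n)`. If `g` is the primitive of the difference of a unit form to the left and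
one to the right of the disk of `η`, then `g = 1` on the support of `η`, and the differential of
`(X ⊗ g) (Y ⊗ η)` shows `X ⋆ Y - Y ⋆ X = [X, Y]` (`star_ι_sub_star_ι`). Therefore `U𝔤` acts on
`Sym 𝔤` by star multiplications, and `u ↦ u · 1` maps `X^n` to `X^n`. Symmetrization maps `X^n` to
`X^n` in the other direction. These powers span both sides, so the two maps are mutually inverse,
without recourse to the Poincaré-Birkhoff-Witt theorem (`symmetrizationEquiv`), and
`f (u v) = f u ⋆ f v` for `f u = u · 1` (`symmetrizationEquiv_star`).

**The formula.** Polarization of `X^n ↦ X^n` shows that symmetrization maps `X^m Z` to the mean of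
the products `X^i Z X^(m - i)`. In `U𝔤` these can be written through `X^(m - k) (ad X)^k Z`, and the
recursion `∑ j < s + 1, (s + 1 choose j) B_j = 0` for `s > 0` collapses the sum over `j` to `X^n Y`
(`pow_mul_ι`).
-/

/-! ### Derivations of graded symmetric algebras -/

namespace SuperSym

section Derivations

variable {K E O : Type*} [Field K] [AddCommGroup E] [Module K E] [AddCommGroup O] [Module K O]

/-- The parity of a generator, `(e, o) ↦ (e, -o)`. -/
def parityGen : E × O →ₗ[K] E × O := LinearMap.prodMap LinearMap.id (-LinearMap.id)

theorem parityGen_apply (v : E × O) : parityGen (K := K) v = (v.1, -v.2) := rfl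

@[simp]
theorem parityGen_parityGen (v : E × O) : parityGen (K := K) (parityGen (K := K) v) = v := by
  simp [parityGen_apply]

theorem parity_gen_eq (v : E × O) :
    parity (gen v : SuperSym K E O) = gen (parityGen (K := K) v) := parity_gen v

/-- `T` is the derivation `T (x y) = (T x) y + x (T y)` that extends the map `φ` of generators. -/
structure IsEvenDer (φ : E × O →ₗ[K] E × O) (T : SuperSym K E O →ₗ[K] SuperSym K E O) : Prop where
  map_one : T 1 = 0
  gen_mul : ∀ v x, T (gen v * x) = gen (φ v) * x + gen v * T x

/-- `T` is the odd derivation `T (x y) = (T x) y + (-1)^|x| x (T y)` that extends the map `φ` of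
generators. -/
structure IsOddDer (φ : E × O →ₗ[K] E × O) (T : SuperSym K E O →ₗ[K] SuperSym K E O) : Prop where
  map_one : T 1 = 0
  gen_mul : ∀ v x, T (gen v * x) = gen (φ v) * x + gen (parityGen (K := K) v) * T x

variable {φ ψ : E × O →ₗ[K] E × O} {S T : SuperSym K E O →ₗ[K] SuperSym K E O}

theorem IsEvenDer.ext (hS : IsEvenDer φ S) (hT : IsEvenDer φ T) : S = T := by
  refine LinearMap.ext fun x => ?_
  induction x using induction_left with
  | one => rw [hS.map_one, hT.map_one]
  | add x y hx hy => simp [hx, hy]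
  | smul c x hx => simp [hx]
  | gen_mul v x hx => rw [hS.gen_mul, hT.gen_mul, hx]

theorem IsOddDer.ext (hS : IsOddDer φ S) (hT : IsOddDer φ T) : S = T := by
  refine LinearMap.ext fun x => ?_
  induction x using induction_left with
  | one => rw [hS.map_one, hT.map_one]
  | add x y hx hy => simp [hx, hy]
  | smul c x hx => simp [hx]
  | gen_mul v x hx => rw [hS.gen_mul, hT.gen_mul, hx]

theorem isEvenDer_zero : IsEvenDer (0 : E × O →ₗ[K] E × O) 0 :=
  ⟨by simp, fun v x => by simp⟩

theorem IsEvenDer.leibniz (hT : IsEvenDer φ T) (x y : SuperSym K E O) :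
    T (x * y) = T x * y + x * T y := by
  induction x using induction_left with
  | one => simp [hT.map_one]
  | add x y hx hy => simp only [add_mul, map_add, hx, hy]; abel
  | smul c x hx => simp [hx]
  | gen_mul v x hx =>
    rw [mul_assoc, hT.gen_mul, hx, hT.gen_mul]
    simp only [add_mul, mul_add, mul_assoc, add_assoc]

theorem IsOddDer.leibniz (hT : IsOddDer φ T) (x y : SuperSym K E O) :
    T (x * y) = T x * y + parity x * T y := by
  induction x using induction_left with
  | one => simp [hT.map_one]
  | add x y hx hy => simp only [add_mul, map_add, hx, hy]; abel
  | smul c x hx => simp [hx]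
  | gen_mul v x hx =>
    rw [mul_assoc, hT.gen_mul, hx, hT.gen_mul, map_mul, parity_gen_eq]
    simp only [add_mul, mul_add, mul_assoc, add_assoc]

theorem IsOddDer.anticommutator (hS : IsOddDer φ S) (hT : IsOddDer ψ T)
    (hφ : ∀ v, φ (parityGen (K := K) v) = -parityGen (K := K) (φ v))
    (hψ : ∀ v, ψ (parityGen (K := K) v) = -parityGen (K := K) (ψ v)) :
    IsEvenDer (φ ∘ₗ ψ + ψ ∘ₗ φ) (S ∘ₗ T + T ∘ₗ S) where
  map_one := by simp [hS.map_one, hT.map_one]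
  gen_mul v x := by
    simp only [LinearMap.add_apply, LinearMap.comp_apply, hS.gen_mul, hT.gen_mul, map_add, hφ, hψ,
      parityGen_parityGen, map_neg, neg_mul, add_mul, mul_add]
    abel

theorem IsEvenDer.commutator (hS : IsEvenDer φ S) (hT : IsEvenDer ψ T) :
    IsEvenDer (φ ∘ₗ ψ - ψ ∘ₗ φ) (S ∘ₗ T - T ∘ₗ S) where
  map_one := by simp [hS.map_one, hT.map_one]
  gen_mul v x := by
    simp only [LinearMap.sub_apply, LinearMap.comp_apply, hS.gen_mul, hT.gen_mul, map_add, map_sub,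
      sub_mul, mul_sub]
    abel

theorem IsEvenDer.commutator_odd (hS : IsEvenDer φ S) (hT : IsOddDer ψ T)
    (hφ : ∀ v, φ (parityGen (K := K) v) = parityGen (K := K) (φ v)) :
    IsOddDer (φ ∘ₗ ψ - ψ ∘ₗ φ) (S ∘ₗ T - T ∘ₗ S) where
  map_one := by simp [hS.map_one, hT.map_one]
  gen_mul v x := by
    simp only [LinearMap.sub_apply, LinearMap.comp_apply, hS.gen_mul, hT.gen_mul, map_add, map_sub,
      hφ, sub_mul, mul_sub]
    abel

/-- The map of generators `(e, o) ↦ (D o, 0)`. -/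
def oddToEven (D : O →ₗ[K] E) : E × O →ₗ[K] E × O :=
  LinearMap.inl K E O ∘ₗ D ∘ₗ LinearMap.snd K E O

theorem oddToEven_apply (D : O →ₗ[K] E) (v : E × O) : oddToEven D v = (D v.2, 0) := rfl

theorem oddToEven_parityGen (D : O →ₗ[K] E) (v : E × O) :
    oddToEven D (parityGen (K := K) v) = -parityGen (K := K) (oddToEven D v) := by
  simp [oddToEven_apply, parityGen_apply]

theorem isOddDer_oddDer (D : O →ₗ[K] E) : IsOddDer (oddToEven D) (oddDer D) :=
  ⟨oddDer_one D, oddDer_gen_mul D⟩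

/-- Odd derivations which map odd generators to even generators and kill the even generators
anticommute. -/
theorem oddDer_anticomm (D D' : O →ₗ[K] E) (x : SuperSym K E O) :
    oddDer D (oddDer D' x) + oddDer D' (oddDer D x) = 0 := by
  have h := (isOddDer_oddDer D).anticommutator (isOddDer_oddDer D') (oddToEven_parityGen D)
    (oddToEven_parityGen D')
  have h0 : oddToEven D ∘ₗ oddToEven D' + oddToEven D' ∘ₗ oddToEven D = 0 := by
    refine LinearMap.ext fun v => ?_
    simp [oddToEven_apply]
  rw [h0] at h
  exact LinearMap.congr_fun (h.ext isEvenDer_zero) x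

/-- The square of an odd derivation vanishes if it vanishes on generators. -/
theorem IsOddDer.comp_self (hT : IsOddDer φ T) (h2 : ∀ v, φ (φ v) = 0)
    (hφ : ∀ v, φ (parityGen (K := K) v) = -parityGen (K := K) (φ v)) (x : SuperSym K E O) :
    T (T x) = 0 := by
  induction x using induction_left with
  | one => simp [hT.map_one]
  | add x y hx hy => simp [hx, hy]
  | smul c x hx => simp [hx]
  | gen_mul v x hx =>
    simp [hT.gen_mul, hx, h2, hφ]

/-- The values of a linear operator `T` with the graded Leibniz rule along a product. -/
theorem map_prod_ofFn_of_leibniz (T : SuperSym K E O →ₗ[K] SuperSym K E O) (h1 : T 1 = 0) :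
    ∀ {n : ℕ} (y : Fin n → SuperSym K E O)
      (_ : ∀ k : Fin n, T (y k * ((List.ofFn y).drop (k + 1)).prod) =
        T (y k) * ((List.ofFn y).drop (k + 1)).prod +
          parity (y k) * T ((List.ofFn y).drop (k + 1)).prod),
      T (List.ofFn y).prod = ∑ k, (List.ofFn fun l =>
        if l < k then parity (y l) else if l = k then T (y l) else y l).prod
  | 0, y, _ => by simpa using h1
  | n + 1, y, hy => by
    have ih := map_prod_ofFn_of_leibniz T h1 (fun k => y k.succ) fun k => by
      have := hy k.succ
      rw [List.ofFn_succ] at this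
      simpa using this
    have h0 := hy 0
    rw [List.ofFn_succ] at h0
    simp only [Fin.val_zero, zero_add, List.drop_succ_cons, List.drop_zero] at h0
    rw [List.ofFn_succ, List.prod_cons, h0, ih, Fin.sum_univ_succ, Finset.mul_sum]
    congr 1
    · rw [List.ofFn_succ, List.prod_cons]
      simp
    · refine Finset.sum_congr rfl fun k _ => ?_
      rw [List.ofFn_succ, List.prod_cons]
      simp

theorem IsOddDer.map_prod_ofFn (hT : IsOddDer φ T) {n : ℕ} (y : Fin n → SuperSym K E O) :
    T (List.ofFn y).prod = ∑ k, (List.ofFn fun l =>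
      if l < k then parity (y l) else if l = k then T (y l) else y l).prod :=
  map_prod_ofFn_of_leibniz T hT.map_one y fun _ => hT.leibniz _ _

end Derivations

section Functoriality

variable {K E O E' O' E'' O'' : Type*} [Field K] [AddCommGroup E] [Module K E]
  [AddCommGroup O] [Module K O] [AddCommGroup E'] [Module K E'] [AddCommGroup O'] [Module K O']
  [AddCommGroup E''] [Module K E''] [AddCommGroup O''] [Module K O'']

@[simp]
theorem map_gen (f : E →ₗ[K] E') (g : O →ₗ[K] O') (v : E × O) :
    map f g (gen v : SuperSym K E O) = gen (f v.1, g v.2) := by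
  rw [map, lift_gen]
  rfl

theorem map_map (f : E →ₗ[K] E') (g : O →ₗ[K] O') (f' : E' →ₗ[K] E'') (g' : O' →ₗ[K] O'')
    (x : SuperSym K E O) : map f' g' (map f g x) = map (f' ∘ₗ f) (g' ∘ₗ g) x := by
  induction x using induction_left with
  | one => simp
  | add x y hx hy => simp only [_root_.map_add, hx, hy]
  | smul c x hx => simp only [_root_.map_smul, hx]
  | gen_mul v x hx => simp [hx]

theorem parity_map (f : E →ₗ[K] E') (g : O →ₗ[K] O') (x : SuperSym K E O) :
    parity (map f g x) = map f g (parity x) := by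
  induction x using induction_left with
  | one => simp
  | add x y hx hy => simp only [_root_.map_add, hx, hy]
  | smul c x hx => simp only [_root_.map_smul, hx]
  | gen_mul v x hx => simp [hx, parity_gen]

theorem oddDer_map (f : E →ₗ[K] E') (g : O →ₗ[K] O') (D : O →ₗ[K] E) (D' : O' →ₗ[K] E')
    (h : ∀ o, D' (g o) = f (D o)) (x : SuperSym K E O) :
    oddDer D' (map f g x) = map f g (oddDer D x) := by
  induction x using induction_left with
  | one => simp [oddDer_one]
  | add x y hx hy => simp only [_root_.map_add, hx, hy]
  | smul c x hx => simp only [_root_.map_smul, hx]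
  | gen_mul v x hx => simp [oddDer_gen_mul, hx, h]

end Functoriality

/-! ### The square of the differential -/

section ChevalleyEilenberg

variable {K M : Type*} [Field K] [AddCommGroup M] [Module K M] (β : M →ₗ[K] M →ₗ[K] M)

theorem isOddDer_adEven (e : M) : IsOddDer (oddToEven (-β e)) (adEven β e) :=
  isOddDer_oddDer _

theorem isEvenDer_adOdd (o : M) : IsEvenDer (LinearMap.prodMap (β o) (β o)) (adOdd β o) :=
  ⟨adOdd_one β o, adOdd_gen_mul β o⟩

theorem adOdd_neg (e : M) : adOdd β (-e) = -adOdd β e :=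
  map_neg (adOddLin β) e

variable {β}

section Jacobi

variable (hβ : ∀ x y, β x y = -β y x)
  (jac : ∀ x y z, β x (β y z) = β (β x y) z + β y (β x z))

include jac in
theorem adOdd_commutator (o o' : M) (x : SuperSym K M M) :
    adOdd β o (adOdd β o' x) - adOdd β o' (adOdd β o x) = adOdd β (β o o') x := by
  have h := (isEvenDer_adOdd β o).commutator (isEvenDer_adOdd β o')
  have h' := isEvenDer_adOdd β (β o o')
  have e : LinearMap.prodMap (β o) (β o) ∘ₗ LinearMap.prodMap (β o') (β o') -
      LinearMap.prodMap (β o') (β o') ∘ₗ LinearMap.prodMap (β o) (β o) =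
      LinearMap.prodMap (β (β o o')) (β (β o o')) := by
    refine LinearMap.ext fun v => ?_
    simp [jac o o']
  rw [e] at h
  exact LinearMap.congr_fun (h.ext h') x

include jac in
theorem adOdd_adEven_commutator (o e : M) (x : SuperSym K M M) :
    adOdd β o (adEven β e x) - adEven β e (adOdd β o x) = adEven β (β o e) x := by
  have h := (isEvenDer_adOdd β o).commutator_odd (isOddDer_adEven β e) (fun v => by
    simp [parityGen_apply])
  have h' := isOddDer_adEven β (β o e)
  have e : LinearMap.prodMap (β o) (β o) ∘ₗ oddToEven (-β e) -
      oddToEven (-β e) ∘ₗ LinearMap.prodMap (β o) (β o) = oddToEven (-β (β o e)) := by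
    refine LinearMap.ext fun v => ?_
    simp [oddToEven_apply, jac o e]
  rw [e] at h
  exact LinearMap.congr_fun (h.ext h') x

include jac in
theorem chevalleyEilenberg_adOdd (o : M) (x : SuperSym K M M) :
    chevalleyEilenberg β hβ (adOdd β o x) = adOdd β o (chevalleyEilenberg β hβ x) := by
  induction x using induction_left with
  | one => simp [adOdd_one, chevalleyEilenberg_one]
  | add x y hx hy => simp only [map_add, hx, hy]
  | smul c x hx => simp only [map_smul, hx]
  | gen_mul w x hx =>
    have h1 := adOdd_commutator jac o w.2 x
    have h2 := adOdd_adEven_commutator jac o w.1 x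
    rw [sub_eq_iff_eq_add] at h1 h2
    simp only [adOdd_gen_mul, map_add, chevalleyEilenberg_gen_mul, parity_gen, adGen_apply, hx,
      h1, h2, map_neg]
    abel

include jac in
theorem chevalleyEilenberg_adEven (e : M) (x : SuperSym K M M) :
    chevalleyEilenberg β hβ (adEven β e x) = -adEven β e (chevalleyEilenberg β hβ x) := by
  induction x using induction_left with
  | one => simp [adEven_one, chevalleyEilenberg_one]
  | add x y hx hy => simp only [map_add, hx, hy, neg_add]
  | smul c x hx => simp only [map_smul, hx, smul_neg]
  | gen_mul w x hx =>
    have h1 := oddDer_anticomm (-β e) (-β w.1) x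
    have h2 := adOdd_adEven_commutator jac w.2 e x
    rw [sub_eq_iff_eq_add] at h2
    have h1' : adEven β w.1 (adEven β e x) = -adEven β e (adEven β w.1 x) :=
      (neg_eq_of_add_eq_zero_right h1).symm
    have h3 : gen (β e w.2, (0 : M)) = -(gen (-β e w.2, (0 : M)) : SuperSym K M M) := by
      rw [← map_neg]; simp
    have h4 : adGen β (w.1, -w.2) (adEven β e x) =
        adEven β w.1 (adEven β e x) - adOdd β w.2 (adEven β e x) := by
      rw [adGen_apply, adOdd_neg, LinearMap.neg_apply, sub_eq_add_neg]
    have h5 : adGen β (-β e w.2, 0) x = adEven β (β w.2 e) x := by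
      rw [adGen_even, hβ w.2 e]
    simp only [adEven_gen_mul, map_add, chevalleyEilenberg_gen_mul, parity_gen, h4, h5, hx,
      h1', h2, map_neg, neg_neg, neg_zero, h3, adGen_apply β w]
    simp only [neg_mul, mul_neg]
    abel

include jac in
/-- The Chevalley-Eilenberg differential squares to zero, by the Jacobi identity. -/
theorem chevalleyEilenberg_comp_self (x : SuperSym K M M) :
    chevalleyEilenberg β hβ (chevalleyEilenberg β hβ x) = 0 := by
  induction x using induction_left with
  | one => simp [chevalleyEilenberg_one]
  | add x y hx hy => simp only [map_add, hx, hy, add_zero]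
  | smul c x hx => simp only [map_smul, hx, smul_zero]
  | gen_mul w x hx =>
    have h4 : adGen β (w.1, -w.2) (chevalleyEilenberg β hβ x) =
        adEven β w.1 (chevalleyEilenberg β hβ x) - adOdd β w.2 (chevalleyEilenberg β hβ x) := by
      rw [adGen_apply, adOdd_neg, LinearMap.neg_apply, sub_eq_add_neg]
    rw [chevalleyEilenberg_gen_mul, map_add, parity_gen, chevalleyEilenberg_gen_mul, hx, mul_zero,
      add_zero, h4, adGen_apply, map_add, chevalleyEilenberg_adEven hβ jac,
      chevalleyEilenberg_adOdd hβ jac]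
    abel

end Jacobi

section Leibniz

variable (hβ : ∀ x y, β x y = -β y x) {D : M →ₗ[K] M}
  (leib : ∀ x y, D (β x y) = β (D x) y + β x (D y))

include leib in
theorem oddDer_adOdd (o : M) (x : SuperSym K M M) :
    adOdd β o (oddDer D x) - oddDer D (adOdd β o x) = adEven β (D o) x := by
  have h := (isEvenDer_adOdd β o).commutator_odd (isOddDer_oddDer D) (fun v => by
    simp [parityGen_apply])
  have h' := isOddDer_adEven β (D o)
  have e : LinearMap.prodMap (β o) (β o) ∘ₗ oddToEven D -
      oddToEven D ∘ₗ LinearMap.prodMap (β o) (β o) = oddToEven (-β (D o)) := by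
    refine LinearMap.ext fun v => ?_
    simp [oddToEven_apply, leib]
  rw [e] at h
  exact LinearMap.congr_fun (h.ext h') x

include leib in
/-- The Chevalley-Eilenberg differential anticommutes with the internal differential, which is a
derivation of the bracket. -/
theorem oddDer_chevalleyEilenberg (x : SuperSym K M M) :
    oddDer D (chevalleyEilenberg β hβ x) = -chevalleyEilenberg β hβ (oddDer D x) := by
  induction x using induction_left with
  | one => simp [chevalleyEilenberg_one, oddDer_one]
  | add x y hx hy => simp only [map_add, hx, hy, neg_add]
  | smul c x hx => simp only [map_smul, hx, smul_neg]
  | gen_mul w x hx =>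
    have h1 := oddDer_anticomm D (-β w.1) x
    have h1' : oddDer D (adEven β w.1 x) = -adEven β w.1 (oddDer D x) :=
      (neg_eq_of_add_eq_zero_left h1).symm
    have h2 := oddDer_adOdd leib w.2 x
    rw [sub_eq_iff_eq_add] at h2
    have h3 : gen (D (-w.2), (0 : M)) = -(gen (D w.2, (0 : M)) : SuperSym K M M) := by
      rw [← map_neg]; simp
    have h4 : adGen β (w.1, -w.2) (oddDer D x) =
        adEven β w.1 (oddDer D x) - adOdd β w.2 (oddDer D x) := by
      rw [adGen_apply, adOdd_neg, LinearMap.neg_apply, sub_eq_add_neg]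
    simp only [oddDer_gen_mul, map_add, chevalleyEilenberg_gen_mul, parity_gen, h4, h3, hx,
      h1', h2, neg_neg, neg_zero, adGen_apply β w, adGen_even]
    simp only [neg_mul, mul_neg]
    abel

end Leibniz

section Map

variable {M' : Type*} [AddCommGroup M'] [Module K M'] {β' : M' →ₗ[K] M' →ₗ[K] M'}
  (hβ : ∀ x y, β x y = -β y x) (hβ' : ∀ x y, β' x y = -β' y x)
  {f : M →ₗ[K] M'} (hf : ∀ x y, β' (f x) (f y) = f (β x y))

include hf in
theorem adEven_map (e : M) (x : SuperSym K M M) :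
    adEven β' (f e) (map f f x) = map f f (adEven β e x) :=
  oddDer_map f f _ _ (fun o => by simp [hf]) x

include hf in
theorem adOdd_map (o : M) (x : SuperSym K M M) :
    adOdd β' (f o) (map f f x) = map f f (adOdd β o x) := by
  induction x using induction_left with
  | one => simp [adOdd_one]
  | add x y hx hy => simp only [_root_.map_add, hx, hy]
  | smul c x hx => simp only [_root_.map_smul, hx]
  | gen_mul v x hx => simp [adOdd_gen_mul, hx, hf]

include hf in
theorem chevalleyEilenberg_map (x : SuperSym K M M) :
    chevalleyEilenberg β' hβ' (map f f x) = map f f (chevalleyEilenberg β hβ x) := by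
  induction x using induction_left with
  | one => simp [chevalleyEilenberg_one]
  | add x y hx hy => simp only [_root_.map_add, hx, hy]
  | smul c x hx => simp only [_root_.map_smul, hx]
  | gen_mul v x hx =>
    simp [chevalleyEilenberg_gen_mul, hx, parity_gen, adGen_apply, adEven_map hf, adOdd_map hf]

/-- The Chevalley-Eilenberg differential satisfies the Leibniz rule for a product `x y` if the
generators in `x` have vanishing bracket with `y`. -/
theorem chevalleyEilenberg_map_mul (y : SuperSym K M' M')
    (hy : ∀ v : M × M, adEven β' (f v.1) y = 0 ∧ adOdd β' (f v.2) y = 0) (x : SuperSym K M M) :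
    chevalleyEilenberg β' hβ' (map f f x * y) =
      chevalleyEilenberg β' hβ' (map f f x) * y +
        parity (map f f x) * chevalleyEilenberg β' hβ' y := by
  induction x using induction_left with
  | one => simp [chevalleyEilenberg_one]
  | add x y hx hy => simp only [_root_.map_add, hx, hy, add_mul]; abel
  | smul c x hx => simp only [_root_.map_smul, hx, smul_mul_assoc, smul_add]
  | gen_mul v x hx =>
    have h1 := (isOddDer_adEven β' (f v.1)).leibniz (map f f x) y
    have h2 := (isEvenDer_adOdd β' (f v.2)).leibniz (map f f x) y
    rw [(hy v).1, mul_zero, add_zero] at h1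
    rw [(hy v).2, mul_zero, add_zero] at h2
    simp only [map_mul, map_gen, mul_assoc, chevalleyEilenberg_gen_mul, adGen_apply, h1, h2, hx,
      add_mul, mul_add]
    abel

end Map

end ChevalleyEilenberg

end SuperSym

/-! ### Reordering products with Koszul signs -/

namespace SuperSym

section Koszul

variable {K : Type*} [Field K] {R : Type*} [Ring R] [Algebra K R]

theorem koszul_one {n : ℕ} (ε : Fin n → Bool) : koszul K 1 ε = 1 := by
  unfold koszul
  refine Finset.prod_eq_one fun i _ => Finset.prod_eq_one fun j _ => if_neg ?_
  rintro ⟨h, h', -⟩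
  exact absurd (h.trans h') (lt_irrefl _)

/-- The sign for exchanging two letters of the given parities. -/
def swapSign (K : Type*) [Field K] (a b : Bool) : K := if a = true ∧ b = true then -1 else 1

theorem prod_ofFn_comp_swap : ∀ {n : ℕ} (i : Fin n) (c : K) (a : Fin (n + 1) → R)
    (_ : a i.succ * a i.castSucc = c • (a i.castSucc * a i.succ)),
    (List.ofFn (a ∘ Equiv.swap i.castSucc i.succ)).prod = c • (List.ofFn a).prod
  | n + 1, i, c, a, h => by
    induction i using Fin.cases with
    | zero =>
      have e : ∀ k : Fin n, Equiv.swap (Fin.castSucc 0) (Fin.succ 0) k.succ.succ = k.succ.succ :=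
        fun k => Equiv.swap_apply_of_ne_of_ne (by simp [Fin.ext_iff]) (by simp [Fin.ext_iff])
      have e0 : Equiv.swap (Fin.castSucc 0) (Fin.succ 0) (0 : Fin (n + 2)) = Fin.succ 0 :=
        Equiv.swap_apply_left _ _
      have e1 : Equiv.swap (Fin.castSucc 0) (Fin.succ 0) (Fin.succ 0 : Fin (n + 2)) = 0 :=
        Equiv.swap_apply_right _ _
      rw [List.ofFn_succ, List.ofFn_succ, List.ofFn_succ (f := a), List.ofFn_succ]
      simp only [Function.comp, e, e0, e1, List.prod_cons, ← mul_assoc]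
      rw [← smul_mul_assoc]
      congr 1
    | succ i =>
      have e0 : Equiv.swap i.succ.castSucc i.succ.succ (0 : Fin (n + 2)) = 0 :=
        Equiv.swap_apply_of_ne_of_ne (by simp [Fin.ext_iff]) (by simp [Fin.ext_iff])
      have e : ∀ k : Fin (n + 1), Equiv.swap i.succ.castSucc i.succ.succ k.succ =
          (Equiv.swap i.castSucc i.succ k).succ := by
        intro k
        rw [← Fin.succ_castSucc]
        simp only [Equiv.swap_apply_def, Fin.succ_inj]
        split_ifs <;> rfl
      have ih := prod_ofFn_comp_swap i c (fun k => a k.succ) h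
      rw [List.ofFn_succ, List.ofFn_succ (f := a)]
      simp only [Function.comp, e, e0, List.prod_cons]
      rw [← mul_smul_comm, ← ih]
      rfl

/-- Reordering factors which commute up to the Koszul signs of their parities. -/
theorem koszul_smul_prod_ofFn {n : ℕ} (σ : Equiv.Perm (Fin n)) (ε : Fin n → Bool) (a : Fin n → R)
    (h : ∀ i j, i ≠ j → a i * a j = swapSign K (ε i) (ε j) • (a j * a i)) :
    koszul K σ ε • (List.ofFn (a ∘ σ)).prod = (List.ofFn a).prod := by
  cases n with
  | zero => rw [Subsingleton.elim σ 1, koszul_one, one_smul]; rfl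
  | succ n =>
    have hσ : σ ∈ Submonoid.closure
        (Set.range fun i : Fin n => Equiv.swap i.castSucc i.succ) := by
      rw [Equiv.Perm.mclosure_swap_castSucc_succ]; trivial
    induction hσ using Submonoid.closure_induction_left generalizing ε a with
    | one => rw [koszul_one, one_smul]; rfl
    | mul_left s hs σ _ ih =>
      obtain ⟨i, rfl⟩ := hs
      set s := Equiv.swap i.castSucc i.succ with hs
      have ih' := ih (ε ∘ s) (a ∘ s) fun k l hkl => h _ _ (s.injective.ne hkl)
      have e1 : koszul K (s * σ) ε = swapSign K (ε i.castSucc) (ε i.succ) * koszul K σ (ε ∘ s) := by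
        have := koszul_swap_mul (K := K) σ (ε ∘ s) i.castSucc i.succ (by simp)
        have e2 : (ε ∘ s) ∘ s = ε := by
          funext x
          simp [hs]
        rw [← hs, e2] at this
        rw [this]
        simp [swapSign, hs, and_comm]
      have e3 : (a ∘ s) ∘ σ = a ∘ (s * σ : Equiv.Perm _) := rfl
      rw [e3] at ih'
      have hne : i.castSucc ≠ i.succ := (Fin.castSucc_lt_succ).ne
      have h2 : a i.succ * a i.castSucc =
          swapSign K (ε i.castSucc) (ε i.succ) • (a i.castSucc * a i.succ) := by
        rw [h _ _ hne.symm]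
        simp [swapSign, and_comm]
      have hh : swapSign K (ε i.castSucc) (ε i.succ) * swapSign K (ε i.castSucc) (ε i.succ) = 1 := by
        unfold swapSign; split_ifs <;> simp
      rw [e1, mul_smul, ih', hs, prod_ofFn_comp_swap i _ a h2, smul_smul, hh, one_smul]

end Koszul

section Homogeneous

variable {K E O W : Type*} [Field K] [AddCommGroup E] [Module K E] [AddCommGroup O] [Module K O]
  [AddCommGroup W] [Module K W]

/-- On homogeneous letters the graded symmetrization is a signed sum over permutations. -/
theorem gradedSymm_homogeneous {n : ℕ} (f : MultilinearMap K (fun _ : Fin n => E × O) W)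
    (v : Fin n → E × O) (ε : Fin n → Bool) (hv : ∀ i, homPart K (ε i) (v i) = v i) :
    gradedSymm f v = ((n.factorial : K)⁻¹) • ∑ σ : Equiv.Perm (Fin n),
      koszul K σ ε • f (fun k => v (σ k)) := by
  rw [gradedSymm_apply]
  congr 1
  refine Finset.sum_congr rfl fun σ _ => ?_
  rw [Finset.sum_eq_single ε]
  · simp only [hv]
  · intro ε' _ hne
    obtain ⟨i, hi⟩ := Function.ne_iff.1 hne
    rw [f.map_coord_zero (σ.symm i), smul_zero]
    rw [Equiv.apply_symm_apply, ← hv i]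
    revert hi
    cases ε' i <;> cases ε i <;> simp [homPart]
  · simp

theorem gen_mul_gen_homogeneous {v w : E × O} {a b : Bool} (hv : homPart K a v = v)
    (hw : homPart K b w = w) :
    (gen v * gen w : SuperSym K E O) = swapSign K a b • (gen w * gen v) := by
  cases a with
  | false =>
    have : v = (v.1, 0) := by rw [← hv]; simp [homPart]
    rw [this, gen_even_comm]; simp [swapSign]
  | true =>
    have hv' : v = (0, v.2) := by rw [← hv]; simp [homPart]
    cases b with
    | false =>
      have : w = (w.1, 0) := by rw [← hw]; simp [homPart]
      rw [this, gen_even_comm]; simp [swapSign]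
    | true =>
      have : w = (0, w.2) := by rw [← hw]; simp [homPart]
      rw [this, hv', gen_odd_anticomm]; simp [swapSign]

theorem parity_gen_homogeneous {v : E × O} {a : Bool} (hv : homPart K a v = v) :
    (parity (gen v) : SuperSym K E O) = swapSign K a true • gen v := by
  rw [parity_gen]
  cases a with
  | false =>
    have : v = (v.1, 0) := by rw [← hv]; simp [homPart]
    rw [this]; simp [swapSign]
  | true =>
    have hv' : v = (0, v.2) := by rw [← hv]; simp [homPart]
    rw [hv']; simp [swapSign, ← map_neg]

/-- The matrix that represents `x` on `Sym ⊕ η Sym`, where `η` is an additional odd variable. -/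
def diagMat (x : SuperSym K E O) : Matrix (Fin 2) (Fin 2) (SuperSym K E O) := !![parity x, 0; 0, x]

/-- The matrix that represents `η y` on `Sym ⊕ η Sym`, where `η` is an additional odd variable. -/
def offMat (y : SuperSym K E O) : Matrix (Fin 2) (Fin 2) (SuperSym K E O) := !![0, y; 0, 0]

theorem diagMat_mul (x y : SuperSym K E O) : diagMat x * diagMat y = diagMat (x * y) := by
  simp [diagMat]

theorem diagMat_mul_offMat (x y : SuperSym K E O) :
    diagMat x * offMat y = offMat (parity x * y) := by
  ext i j
  fin_cases i <;> fin_cases j <;> simp [diagMat, offMat]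

theorem offMat_mul_diagMat (x y : SuperSym K E O) : offMat x * diagMat y = offMat (x * y) := by
  ext i j
  fin_cases i <;> fin_cases j <;> simp [diagMat, offMat]

theorem diagMat_smul (c : K) (x : SuperSym K E O) : diagMat (c • x) = c • diagMat x := by
  simp [diagMat, Matrix.smul_of]

theorem offMat_smul (c : K) (x : SuperSym K E O) : offMat (c • x) = c • offMat x := by
  simp [offMat, Matrix.smul_of]

theorem offMat_injective : Function.Injective (offMat : SuperSym K E O → _) := fun x y h => by
  have := congrFun (congrFun h 0) 1
  simpa [offMat] using this

theorem prod_ofFn_diagMat {n : ℕ} (x : Fin n → SuperSym K E O) :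
    (List.ofFn fun i => diagMat (x i)).prod = diagMat (List.ofFn x).prod := by
  induction n with
  | zero =>
    simp [diagMat, Matrix.one_fin_two]
  | succ n ih => rw [List.ofFn_succ, List.ofFn_succ, List.prod_cons, List.prod_cons, ih, diagMat_mul]

/-- A product with exactly one factor of the form `η y`. -/
theorem prod_ofFn_offMat {n : ℕ} (x : Fin n → SuperSym K E O) (y : SuperSym K E O) (m : Fin n) :
    (List.ofFn fun i => if i = m then offMat y else diagMat (x i)).prod =
      offMat (List.ofFn fun i => if i < m then parity (x i) else if i = m then y else x i).prod := by
  induction n with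
  | zero => exact m.elim0
  | succ n ih =>
    rw [List.ofFn_succ, List.ofFn_succ, List.prod_cons, List.prod_cons]
    induction m using Fin.cases with
    | zero =>
      simp only [Fin.succ_ne_zero, if_true, if_false, Fin.not_lt_zero]
      rw [prod_ofFn_diagMat, offMat_mul_diagMat]
    | succ m =>
      simp only [Fin.succ_inj, Fin.succ_lt_succ_iff, (Fin.succ_ne_zero m).symm, Fin.succ_pos,
        if_true, if_false]
      rw [ih, diagMat_mul_offMat]

end Homogeneous

/-! ### The symmetrized homotopy as a normalized derivation -/

section Homotopy

variable {K E O : Type*} [Field K] [AddCommGroup E] [Module K E] [AddCommGroup O] [Module K O]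

/-- The map of generators `(e, o) ↦ (0, h e)`. -/
def evenToOdd (h : E →ₗ[K] O) : E × O →ₗ[K] E × O :=
  LinearMap.inr K E O ∘ₗ h ∘ₗ LinearMap.fst K E O

/-- The map of generators `(e, o) ↦ (q e, 0)`. -/
def evenToEven (q : E →ₗ[K] E) : E × O →ₗ[K] E × O :=
  LinearMap.inl K E O ∘ₗ q ∘ₗ LinearMap.fst K E O

theorem evenToOdd_apply (h : E →ₗ[K] O) (v : E × O) : evenToOdd h v = (0, h v.1) := rfl

theorem evenToEven_apply (q : E →ₗ[K] E) (v : E × O) : evenToEven q v = (q v.1, 0) := rfl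

theorem evenToOdd_parityGen (h : E →ₗ[K] O) (v : E × O) :
    evenToOdd h (parityGen (K := K) v) = -parityGen (K := K) (evenToOdd h v) := by
  simp [evenToOdd_apply, parityGen_apply]

theorem gen_zero_zero : gen ((0 : E), (0 : O)) = (0 : SuperSym K E O) := map_zero gen

/-- The odd derivation of `Sym (E ⊕ O)` with values `(e, o) ↦ (0, h e)` on generators. -/
def homotopyDer (h : E →ₗ[K] O) : SuperSym K E O →ₗ[K] SuperSym K E O :=
  twistedDer parity (gen ∘ₗ evenToOdd h)
    (by
      intro e v
      have hv : v = (v.1, 0) + (0, v.2) := by simp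
      have h1 := gen_even_comm (K := K) e ((0 : E), h v.1)
      have h2 : (gen ((0 : E), h e) * gen v : SuperSym K E O) =
          gen (v.1, -v.2) * gen ((0 : E), h e) := by
        have h3 : (v.1, -v.2) = (v.1, 0) - (0, v.2) := by simp
        rw [h3, map_sub]
        conv_lhs => rw [hv]
        rw [map_add, mul_add, sub_mul, gen_odd_anticomm, gen_even_comm]
        abel
      simp only [LinearMap.comp_apply, evenToOdd_apply, parity_gen, neg_zero, h1, h2]
      abel)
    (by
      intro a b
      have h0 : gen ((0 : E), (0 : O)) = (0 : SuperSym K E O) := map_zero gen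
      simp [evenToOdd_apply, h0])

theorem isOddDer_homotopyDer (h : E →ₗ[K] O) : IsOddDer (evenToOdd h) (homotopyDer h) where
  map_one := twistedDer_one ..
  gen_mul v x := by rw [homotopyDer, twistedDer_gen_mul, parity_gen_eq]; rfl

theorem IsOddDer.gen {φ : E × O →ₗ[K] E × O} {T : SuperSym K E O →ₗ[K] SuperSym K E O}
    (hT : IsOddDer φ T) (v : E × O) : T (gen v) = SuperSym.gen (φ v) := by
  simpa [hT.map_one] using hT.gen_mul v 1

variable {h : E →ₗ[K] O} {q : E →ₗ[K] E}

/-- The summand of the symmetrized homotopy on homogeneous letters that belongs to a permutation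
`σ` and applies `h` to the letter `v m`, in position `σ⁻¹ m`: sorting the factors absorbs all
Koszul signs. -/
theorem koszul_smul_homotopy_summand {n : ℕ} (v : Fin n → E × O) (ε : Fin n → Bool)
    (hv : ∀ i, homPart K (ε i) (v i) = v i) (σ : Equiv.Perm (Fin n)) (m : Fin n) :
    koszul K σ ε • (List.ofFn fun k => if k < σ.symm m then parity (gen (v (σ k)))
        else if k = σ.symm m then gen (evenToOdd h (v (σ k)))
        else (gen (evenToEven q (v (σ k))) : SuperSym K E O)).prod =
      (List.ofFn fun i => if i < m then
          parity (gen (if σ.symm i < σ.symm m then v i else evenToEven q (v i)))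
        else if i = m then gen (evenToOdd h (v m))
        else gen (if σ.symm i < σ.symm m then v i else evenToEven q (v i))).prod := by
  set x : Fin n → SuperSym K E O := fun i =>
    gen (if σ.symm i < σ.symm m then v i else evenToEven q (v i)) with hx
  set y : SuperSym K E O := gen (evenToOdd h (v m)) with hy
  set b : Fin n → Matrix (Fin 2) (Fin 2) (SuperSym K E O) := fun i =>
    if i = m then offMat y else diagMat (x i) with hb
  have hq : ∀ i, homPart K (ε i) (if σ.symm i < σ.symm m then v i else evenToEven q (v i)) =
      if σ.symm i < σ.symm m then v i else evenToEven q (v i) := by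
    intro i
    split_ifs
    · exact hv i
    · rw [← hv i]
      cases ε i <;> simp [homPart, evenToEven_apply]
  have hoff : ∀ i, y * x i = swapSign K (ε m) (ε i) • (parity (x i) * y) := by
    intro i
    rw [hx, hy, parity_gen_homogeneous (hq i), smul_mul_assoc, smul_smul]
    cases hm : ε m with
    | false =>
      have : homPart K true (evenToOdd h (v m)) = evenToOdd h (v m) := by
        simp [homPart, evenToOdd_apply]
      rw [gen_mul_gen_homogeneous this (hq i)]
      congr 1
      cases ε i <;> simp [swapSign]
    | true =>
      have : evenToOdd h (v m) = 0 := by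
        rw [← hv m, hm]
        simp [homPart, evenToOdd_apply]
      rw [this]; simp
  have hcomm : ∀ i j, i ≠ j → b i * b j = swapSign K (ε i) (ε j) • (b j * b i) := by
    intro i j hij
    have hs : ∀ a c : Bool, swapSign K a c * swapSign K c a = 1 := by
      intro a c; cases a <;> cases c <;> simp [swapSign]
    by_cases hi : i = m
    · have hj : j ≠ m := fun hj => hij (hi.trans hj.symm)
      subst hi
      simp only [hb, if_true, if_neg hj, offMat_mul_diagMat, diagMat_mul_offMat, hoff j, offMat_smul]
    · by_cases hj : j = m
      · subst hj
        simp only [hb, if_true, if_neg hi, offMat_mul_diagMat, diagMat_mul_offMat, hoff i,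
          offMat_smul, smul_smul, hs, one_smul]
      · simp only [hb, if_neg hi, if_neg hj, diagMat_mul]
        rw [hx, gen_mul_gen_homogeneous (hq i) (hq j), diagMat_smul]
  have key := koszul_smul_prod_ofFn σ ε b hcomm
  have e1 : (List.ofFn (b ∘ σ)).prod = offMat (List.ofFn fun k => if k < σ.symm m then
      parity (x (σ k)) else if k = σ.symm m then y else x (σ k)).prod := by
    rw [← prod_ofFn_offMat]
    congr 2
    funext k
    simp only [hb, Function.comp, Equiv.eq_symm_apply]
  have e2 : (List.ofFn b).prod = offMat (List.ofFn fun i => if i < m then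
      parity (x i) else if i = m then y else x i).prod := prod_ofFn_offMat x y m
  rw [e1, e2, ← offMat_smul] at key
  rw [← offMat_injective key]
  congr 3
  funext k
  by_cases h1 : k < σ.symm m
  · simp [h1, hx]
  · by_cases h2 : k = σ.symm m
    · simp [h2, hy]
    · simp [h1, h2, hx]

/-- Each element of a non-empty set `S` comes last among the elements of `S` in the same proportion
of all permutations. -/
theorem card_mul_card_perm_last {n : ℕ} (S : Finset (Fin n)) {m : Fin n} (hm : m ∈ S) :
    S.card * (Finset.univ.filter fun σ : Equiv.Perm (Fin n) =>
      ∀ i ∈ S, σ.symm i ≤ σ.symm m).card = n.factorial := by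
  set c : Fin n → ℕ := fun m => (Finset.univ.filter fun σ : Equiv.Perm (Fin n) =>
    ∀ i ∈ S, σ.symm i ≤ σ.symm m).card with hc
  have h1 : ∀ m' ∈ S, c m' = c m := by
    intro m' hm'
    refine Finset.card_equiv (Equiv.mulLeft (Equiv.swap m m')) fun σ => ?_
    simp only [Finset.mem_filter, Finset.mem_univ, true_and, Equiv.coe_mulLeft]
    have e : ∀ i, (Equiv.swap m m' * σ).symm i = σ.symm (Equiv.swap m m' i) := by
      intro i
      rw [Equiv.symm_apply_eq]
      simp
    have hS : ∀ i, i ∈ S → Equiv.swap m m' i ∈ S := by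
      intro i hi
      rw [Equiv.swap_apply_def]
      split_ifs <;> assumption
    simp only [e, Equiv.swap_apply_left]
    constructor
    · exact fun H i hi => H _ (hS i hi)
    · intro H i hi
      simpa using H _ (hS i hi)
  have h2 : ∑ m' ∈ S, c m' = n.factorial := by
    simp only [hc, Finset.card_filter]
    rw [Finset.sum_comm]
    have : ∀ σ : Equiv.Perm (Fin n), ∑ m' ∈ S,
        (if ∀ i ∈ S, σ.symm i ≤ σ.symm m' then 1 else 0) = 1 := by
      intro σ
      obtain ⟨j, hj, hj'⟩ := S.exists_max_image σ.symm ⟨m, hm⟩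
      rw [Finset.sum_eq_single_of_mem j hj]
      · rw [if_pos hj']
      · intro k hk hkj
        refine if_neg fun H => hkj ?_
        exact σ.symm.injective (le_antisymm (hj' k hk) (H j hj))
    simp only [this]
    simp [Fintype.card_perm]
  rw [← h2, Finset.sum_congr rfl h1, Finset.sum_const, smul_eq_mul]

/-- The symmetrized homotopy on a product of homogeneous letters each of which is either fixed by
`q` and killed by `h` or killed by `q`. -/
theorem factorial_smul_symHomotopy [CharZero K] {n : ℕ} (v : Fin n → E × O) (ε : Fin n → Bool)
    (hv : ∀ i, homPart K (ε i) (v i) = v i) (S : Finset (Fin n))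
    (hS : ∀ i ∈ S, evenToEven q (v i) = 0) (hS' : ∀ i ∉ S, evenToEven q (v i) = v i) :
    (n.factorial : K) • symHomotopy (evenToOdd h) (evenToEven q)
        (List.ofFn fun i => (gen (v i) : SuperSym K E O)).prod =
      ∑ m, ((Finset.univ.filter fun σ : Equiv.Perm (Fin n) =>
        ∀ i ∈ S, σ.symm i ≤ σ.symm m).card : K) • (List.ofFn fun l =>
        if l < m then parity (gen (v l)) else if l = m then gen (evenToOdd h (v m))
        else (gen (v l) : SuperSym K E O)).prod := by
  have hn : (n.factorial : K) ≠ 0 := Nat.cast_ne_zero.2 n.factorial_ne_zero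
  rw [symHomotopy, symLift_prod, gradedSymm_homogeneous _ v ε hv, smul_smul, mul_inv_cancel₀ hn,
    one_smul]
  have key : ∀ (σ : Equiv.Perm (Fin n)) (m : Fin n),
      koszul K σ ε • (List.ofFn fun k => if k < σ.symm m then parity (gen (v (σ k)))
        else if k = σ.symm m then gen (evenToOdd h (v (σ k)))
        else (gen (evenToEven q (v (σ k))) : SuperSym K E O)).prod =
      if ∀ i ∈ S, σ.symm i ≤ σ.symm m then (List.ofFn fun l =>
        if l < m then parity (gen (v l)) else if l = m then gen (evenToOdd h (v m))
        else (gen (v l) : SuperSym K E O)).prod else 0 := by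
    intro σ m
    rw [koszul_smul_homotopy_summand v ε hv σ m]
    split_ifs with hc
    · congr 2
      funext i
      by_cases him : i = m
      · simp [him]
      · have : (if σ.symm i < σ.symm m then v i else evenToEven q (v i)) = v i := by
          split_ifs with h1
          · rfl
          · refine hS' i fun hi => ?_
            exact h1 (lt_of_le_of_ne (hc i hi) (σ.symm.injective.ne him))
        rw [this]
    · push Not at hc
      obtain ⟨i, hi, hlt⟩ := hc
      refine List.prod_eq_zero ?_
      rw [List.mem_ofFn]
      have him : i ≠ m := by rintro rfl; exact lt_irrefl _ hlt
      refine ⟨i, ?_⟩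
      simp [him, hlt.not_gt, hS i hi]
  have e : ∀ σ : Equiv.Perm (Fin n), koszul K σ ε • (∑ j : Fin n,
      (MultilinearMap.mkPiAlgebraFin K n (SuperSym K E O)).compLinearMap fun k =>
        if k < j then gen ∘ₗ LinearMap.prodMap LinearMap.id (-LinearMap.id)
        else if k = j then gen ∘ₗ evenToOdd h
        else gen ∘ₗ evenToEven q) (fun k => v (σ k)) =
      ∑ m, if ∀ i ∈ S, σ.symm i ≤ σ.symm m then (List.ofFn fun l =>
        if l < m then parity (gen (v l)) else if l = m then gen (evenToOdd h (v m))
        else (gen (v l) : SuperSym K E O)).prod else 0 := by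
    intro σ
    rw [sum_apply, Finset.smul_sum, ← Equiv.sum_comp σ.symm]
    refine Finset.sum_congr rfl fun m _ => ?_
    rw [← key σ m, MultilinearMap.compLinearMap_apply, MultilinearMap.mkPiAlgebraFin_apply]
    congr 3
    funext k
    split_ifs
    · rw [parity_gen]; rfl
    · rfl
    · rfl
  rw [Finset.sum_congr rfl fun σ _ => e σ, Finset.sum_comm]
  refine Finset.sum_congr rfl fun m _ => ?_
  rw [← Finset.sum_filter, Finset.sum_const, ← Nat.cast_smul_eq_nsmul K]

/-- On a product of letters of which `b` are killed by `q`, the symmetrized homotopy is `1 / b`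
times the derivation that extends `h`. -/
theorem card_smul_symHomotopy [CharZero K] {n : ℕ} (v : Fin n → E × O) (ε : Fin n → Bool)
    (hv : ∀ i, homPart K (ε i) (v i) = v i) (S : Finset (Fin n))
    (hS : ∀ i ∈ S, evenToEven q (v i) = 0) (hS' : ∀ i ∉ S, evenToEven q (v i) = v i)
    (hhq : ∀ e, h (q e) = 0) :
    (S.card : K) • symHomotopy (evenToOdd h) (evenToEven q)
        (List.ofFn fun i => (gen (v i) : SuperSym K E O)).prod =
      homotopyDer h (List.ofFn fun i => (gen (v i) : SuperSym K E O)).prod := by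
  have hn : (n.factorial : K) ≠ 0 := Nat.cast_ne_zero.2 n.factorial_ne_zero
  refine smul_right_injective _ hn ?_
  simp only
  rw [smul_comm, factorial_smul_symHomotopy v ε hv S hS hS',
    (isOddDer_homotopyDer h).map_prod_ofFn, Finset.smul_sum, Finset.smul_sum]
  refine Finset.sum_congr rfl fun m _ => ?_
  have e : (List.ofFn fun l => if l < m then parity (gen (v l)) else if l = m then
      homotopyDer h (gen (v l)) else (gen (v l) : SuperSym K E O)) = List.ofFn fun l =>
        if l < m then parity (gen (v l)) else if l = m then gen (evenToOdd h (v m))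
        else (gen (v l) : SuperSym K E O) := by
    congr 1
    funext l
    by_cases hl : l = m
    · simp [hl, (isOddDer_homotopyDer h).gen]
    · simp [hl]
  rw [e]
  by_cases hm : m ∈ S
  · rw [smul_smul, ← card_mul_card_perm_last S hm]
    push_cast
    rfl
  · have : (List.ofFn fun l => if l < m then parity (gen (v l)) else if l = m then
        gen (evenToOdd h (v m)) else (gen (v l) : SuperSym K E O)).prod = 0 := by
      refine List.prod_eq_zero ?_
      rw [List.mem_ofFn]
      refine ⟨m, ?_⟩
      rw [← hS' m hm]
      simp [evenToOdd_apply, evenToEven_apply, hhq, gen_zero_zero]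
    rw [this, smul_zero, smul_zero, smul_zero]

theorem symHomotopy_eq_zero [CharZero K] {n : ℕ} (v : Fin n → E × O) (ε : Fin n → Bool)
    (hv : ∀ i, homPart K (ε i) (v i) = v i) (hS' : ∀ i, evenToEven q (v i) = v i)
    (hhq : ∀ e, h (q e) = 0) :
    symHomotopy (evenToOdd h) (evenToEven q)
        (List.ofFn fun i => (gen (v i) : SuperSym K E O)).prod = 0 := by
  have hn : (n.factorial : K) ≠ 0 := Nat.cast_ne_zero.2 n.factorial_ne_zero
  refine (smul_eq_zero.1 ?_).resolve_left hn
  rw [factorial_smul_symHomotopy v ε hv ∅ (by simp) (fun i _ => hS' i)]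
  refine Finset.sum_eq_zero fun m _ => ?_
  rw [List.prod_eq_zero, smul_zero]
  rw [List.mem_ofFn]
  refine ⟨m, ?_⟩
  rw [← hS' m]
  simp [evenToOdd_apply, evenToEven_apply, hhq, gen_zero_zero]

end Homotopy

end SuperSym

namespace SuperSym

/-! ### Cohomological degrees -/

section Degree

variable {K E O : Type*} [Field K] [AddCommGroup E] [Module K E] [AddCommGroup O] [Module K O]

theorem one_mem_cohDegree : (1 : SuperSym K E O) ∈ cohDegree K E O 0 :=
  Submodule.subset_span ⟨[], by simp, by simp⟩

theorem gen_even_mul_mem_cohDegree {k : ℤ} (e : E) {x : SuperSym K E O}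
    (hx : x ∈ cohDegree K E O k) : gen (e, 0) * x ∈ cohDegree K E O k := by
  induction hx using Submodule.span_induction with
  | zero => simp
  | add p q _ _ hp hq => rw [mul_add]; exact Submodule.add_mem _ hp hq
  | smul c p _ hp => rw [mul_smul_comm]; exact Submodule.smul_mem _ _ hp
  | mem p hp =>
    obtain ⟨l, rfl, rfl⟩ := hp
    exact Submodule.subset_span ⟨Sum.inl e :: l, by simp, by simp⟩

theorem gen_odd_mul_mem_cohDegree {k : ℤ} (o : O) {x : SuperSym K E O}
    (hx : x ∈ cohDegree K E O k) : gen (0, o) * x ∈ cohDegree K E O (k - 1) := by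
  induction hx using Submodule.span_induction with
  | zero => simp
  | add p q _ _ hp hq => rw [mul_add]; exact Submodule.add_mem _ hp hq
  | smul c p _ hp => rw [mul_smul_comm]; exact Submodule.smul_mem _ _ hp
  | mem p hp =>
    obtain ⟨l, rfl, rfl⟩ := hp
    refine Submodule.subset_span ⟨Sum.inr o :: l, ?_, by simp⟩
    rw [List.countP_cons]
    push_cast
    simp only [Sum.isRight_inr, if_true]
    ring

theorem cohDegree_induction {P : ℤ → SuperSym K E O → Prop} (one : P 0 1) (zero : ∀ k, P k 0)
    (add : ∀ k x y, P k x → P k y → P k (x + y)) (smul : ∀ k (c : K) x, P k x → P k (c • x))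
    (even : ∀ k e x, x ∈ cohDegree K E O k → P k x → P k (gen (e, 0) * x))
    (odd : ∀ k o x, x ∈ cohDegree K E O k → P k x → P (k - 1) (gen (0, o) * x))
    {k : ℤ} {x : SuperSym K E O} (hx : x ∈ cohDegree K E O k) : P k x := by
  induction hx using Submodule.span_induction with
  | zero => exact zero k
  | add p q _ _ hp hq => exact add k p q hp hq
  | smul c p _ hp => exact smul k c p hp
  | mem p hp =>
    obtain ⟨l, rfl, rfl⟩ := hp
    induction l with
    | nil => simpa using one
    | cons a l ih =>
      cases a with
      | inl e => simpa using even _ e _ (Submodule.subset_span ⟨l, rfl, rfl⟩) ih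
      | inr o =>
        have := odd _ o _ (Submodule.subset_span ⟨l, rfl, rfl⟩) ih
        rw [List.countP_cons]
        simpa [sub_eq_add_neg, add_comm] using this

theorem cohDegree_eq_zero {k : ℤ} (hk : 0 < k) {x : SuperSym K E O}
    (hx : x ∈ cohDegree K E O k) : x = 0 := by
  revert hk
  refine cohDegree_induction (P := fun k x => 0 < k → x = 0) ?_ ?_ ?_ ?_ ?_ ?_ hx
  · intro h; exact absurd h (lt_irrefl 0)
  · intro _ _; rfl
  · intro k x y hx hy hk; rw [hx hk, hy hk, add_zero]
  · intro k c x hx hk; rw [hx hk, smul_zero]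
  · intro k e x _ hx hk; rw [hx hk, mul_zero]
  · intro k o x _ hx hk; rw [hx (by omega), mul_zero]

/-- An algebra homomorphism that kills the odd generators kills all elements of non-zero degree. -/
theorem algHom_eq_zero_of_mem_cohDegree {B : Type*} [Ring B] [Algebra K B]
    (p : SuperSym K E O →ₐ[K] B) (hp : ∀ o, p (gen (0, o)) = 0) {k : ℤ} (hk : k ≠ 0)
    {x : SuperSym K E O} (hx : x ∈ cohDegree K E O k) : p x = 0 := by
  revert hk
  refine cohDegree_induction (P := fun k x => k ≠ 0 → p x = 0) ?_ ?_ ?_ ?_ ?_ ?_ hx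
  · intro h; exact absurd rfl h
  · intro _ _; exact map_zero p
  · intro k x y hx hy hk; rw [map_add, hx hk, hy hk, add_zero]
  · intro k c x hx hk; rw [map_smul, hx hk, smul_zero]
  · intro k e x _ hx hk; rw [map_mul, hx hk, mul_zero]
  · intro k o x _ hx hk; rw [map_mul, hp, zero_mul]

theorem mul_mem_cohDegree {j k : ℤ} {x y : SuperSym K E O} (hx : x ∈ cohDegree K E O j)
    (hy : y ∈ cohDegree K E O k) : x * y ∈ cohDegree K E O (j + k) := by
  refine cohDegree_induction (P := fun j x => x * y ∈ cohDegree K E O (j + k)) ?_ ?_ ?_ ?_ ?_ ?_ hx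
  · simpa using hy
  · intro j; simp
  · intro j x y hx hy; rw [add_mul]; exact Submodule.add_mem _ hx hy
  · intro j c x hx; rw [smul_mul_assoc]; exact Submodule.smul_mem _ _ hx
  · intro j e x _ hx; rw [mul_assoc]; exact gen_even_mul_mem_cohDegree e hx
  · intro j o x _ hx
    rw [mul_assoc, show j - 1 + k = j + k - 1 by ring]
    exact gen_odd_mul_mem_cohDegree o hx

theorem commute_of_mem_cohDegree_zero {x : SuperSym K E O} (hx : x ∈ cohDegree K E O 0)
    (y : SuperSym K E O) : Commute x y := by
  have hgen : ∀ (e : E) (y : SuperSym K E O), Commute (gen (e, 0)) y := by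
    intro e y
    induction y using induction_left with
    | one => exact Commute.one_right _
    | add x y hx hy => exact hx.add_right hy
    | smul c x hx => exact hx.smul_right c
    | gen_mul v x hx =>
      have : Commute (gen (e, 0) : SuperSym K E O) (gen v) := gen_even_comm e v
      exact this.mul_right hx
  -- Elements of degree zero are the ones whose words contain no odd letter.
  refine Submodule.span_induction (p := fun x _ => Commute x y) ?_ (Commute.zero_left y)
    (fun x x' _ _ h h' => h.add_left h') (fun c x _ h => h.smul_left c) hx
  rintro _ ⟨l, hl, rfl⟩
  have hl' : l.countP Sum.isRight = 0 := by omega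
  refine Commute.list_prod_left _ _ fun z hz => ?_
  obtain ⟨a, ha, rfl⟩ := List.mem_map.1 hz
  cases a with
  | inl e => exact hgen e y
  | inr o => exact absurd rfl (List.countP_eq_zero.1 hl' _ ha)

theorem map_mem_cohDegree {E' O' : Type*} [AddCommGroup E'] [Module K E'] [AddCommGroup O']
    [Module K O'] (f : E →ₗ[K] E') (g : O →ₗ[K] O') {k : ℤ} {x : SuperSym K E O}
    (hx : x ∈ cohDegree K E O k) : map f g x ∈ cohDegree K E' O' k := by
  refine cohDegree_induction (P := fun k x => map f g x ∈ cohDegree K E' O' k) ?_ ?_ ?_ ?_ ?_ ?_ hx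
  · rw [_root_.map_one]; exact one_mem_cohDegree
  · intro k; simp
  · intro k x y hx hy; rw [_root_.map_add]; exact Submodule.add_mem _ hx hy
  · intro k c x hx; rw [_root_.map_smul]; exact Submodule.smul_mem _ _ hx
  · intro k e x _ hx
    rw [map_mul, map_gen, _root_.map_zero]; exact gen_even_mul_mem_cohDegree _ hx
  · intro k o x _ hx
    rw [map_mul, map_gen, _root_.map_zero]; exact gen_odd_mul_mem_cohDegree _ hx

theorem oddDer_mem_cohDegree (D : O →ₗ[K] E) {k : ℤ} {x : SuperSym K E O}
    (hx : x ∈ cohDegree K E O k) : oddDer D x ∈ cohDegree K E O (k + 1) := by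
  refine cohDegree_induction (P := fun k x => oddDer D x ∈ cohDegree K E O (k + 1))
    ?_ ?_ ?_ ?_ ?_ ?_ hx
  · rw [oddDer_one]; exact Submodule.zero_mem _
  · intro k; simp
  · intro k x y hx hy; rw [map_add]; exact Submodule.add_mem _ hx hy
  · intro k c x hx; rw [map_smul]; exact Submodule.smul_mem _ _ hx
  · intro k e x _ hx
    rw [oddDer_gen_mul, map_zero, gen_zero_zero, zero_mul, zero_add, neg_zero]
    exact gen_even_mul_mem_cohDegree _ hx
  · intro k o x hx hx'
    rw [oddDer_gen_mul, show k - 1 + 1 = k by ring]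
    refine Submodule.add_mem _ (gen_even_mul_mem_cohDegree _ hx) ?_
    simpa using gen_odd_mul_mem_cohDegree (-o) hx'

theorem homotopyDer_mem_cohDegree (h : E →ₗ[K] O) {k : ℤ} {x : SuperSym K E O}
    (hx : x ∈ cohDegree K E O k) : homotopyDer h x ∈ cohDegree K E O (k - 1) := by
  have hH := isOddDer_homotopyDer h
  refine cohDegree_induction (P := fun k x => homotopyDer h x ∈ cohDegree K E O (k - 1))
    ?_ ?_ ?_ ?_ ?_ ?_ hx
  · rw [hH.map_one]; exact Submodule.zero_mem _
  · intro k; simp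
  · intro k x y hx hy; rw [map_add]; exact Submodule.add_mem _ hx hy
  · intro k c x hx; rw [map_smul]; exact Submodule.smul_mem _ _ hx
  · intro k e x hx hx'
    rw [hH.gen_mul, parityGen_apply, neg_zero]
    exact Submodule.add_mem _ (gen_odd_mul_mem_cohDegree _ hx) (gen_even_mul_mem_cohDegree _ hx')
  · intro k o x _ hx
    rw [hH.gen_mul, evenToOdd_apply, map_zero, gen_zero_zero, zero_mul, zero_add]
    exact gen_odd_mul_mem_cohDegree (-o) hx

variable {M : Type*} [AddCommGroup M] [Module K M] (β : M →ₗ[K] M →ₗ[K] M)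

theorem adOdd_mem_cohDegree (o : M) {k : ℤ} {x : SuperSym K M M} (hx : x ∈ cohDegree K M M k) :
    adOdd β o x ∈ cohDegree K M M k := by
  refine cohDegree_induction (P := fun k x => adOdd β o x ∈ cohDegree K M M k) ?_ ?_ ?_ ?_ ?_ ?_ hx
  · rw [adOdd_one]; exact Submodule.zero_mem _
  · intro k; simp
  · intro k x y hx hy; rw [map_add]; exact Submodule.add_mem _ hx hy
  · intro k c x hx; rw [map_smul]; exact Submodule.smul_mem _ _ hx
  · intro k e x hx hx'
    rw [adOdd_gen_mul, map_zero]
    exact Submodule.add_mem _ (gen_even_mul_mem_cohDegree _ hx) (gen_even_mul_mem_cohDegree _ hx')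
  · intro k o x hx hx'
    rw [adOdd_gen_mul, map_zero]
    exact Submodule.add_mem _ (gen_odd_mul_mem_cohDegree _ hx) (gen_odd_mul_mem_cohDegree _ hx')

theorem chevalleyEilenberg_mem_cohDegree (hβ : ∀ x y, β x y = -β y x) {k : ℤ}
    {x : SuperSym K M M} (hx : x ∈ cohDegree K M M k) :
    chevalleyEilenberg β hβ x ∈ cohDegree K M M (k + 1) := by
  refine cohDegree_induction (P := fun k x => chevalleyEilenberg β hβ x ∈ cohDegree K M M (k + 1))
    ?_ ?_ ?_ ?_ ?_ ?_ hx
  · rw [chevalleyEilenberg_one]; exact Submodule.zero_mem _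
  · intro k; simp
  · intro k x y hx hy; rw [map_add]; exact Submodule.add_mem _ hx hy
  · intro k c x hx; rw [map_smul]; exact Submodule.smul_mem _ _ hx
  · intro k e x hx hx'
    rw [chevalleyEilenberg_gen_mul, adGen_even, parity_gen, neg_zero]
    exact Submodule.add_mem _ (oddDer_mem_cohDegree _ hx) (gen_even_mul_mem_cohDegree _ hx')
  · intro k o x hx hx'
    rw [chevalleyEilenberg_gen_mul, adGen_odd, parity_gen, show k - 1 + 1 = k by ring]
    refine Submodule.add_mem _ (adOdd_mem_cohDegree β o hx) ?_
    simpa using gen_odd_mul_mem_cohDegree (-o) hx'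

end Degree

/-! ### The decomposition by the number of contractible letters -/

section Weight

variable {K E O : Type*} [Field K] [AddCommGroup E] [Module K E] [AddCommGroup O] [Module K O]

/-- The letters adapted to a projection `q` of the even generators: the image of `q`, and the
letters killed by `q`, which are the even letters `e - q e` and all the odd letters. -/
def adaptedLetter (q : E →ₗ[K] E) : E ⊕ (E ⊕ O) → E × O :=
  Sum.elim (fun e => (q e, 0)) (Sum.elim (fun e => (e - q e, 0)) fun o => (0, o))

/-- The span of the products of letters of which exactly `b` are killed by the projection `q`. -/
def weightPart (q : E →ₗ[K] E) (b : ℕ) : Submodule K (SuperSym K E O) :=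
  Submodule.span K {x | ∃ l : List (E ⊕ (E ⊕ O)), l.countP Sum.isRight = b ∧
    (l.map (gen ∘ adaptedLetter q)).prod = x}

variable {q : E →ₗ[K] E}

theorem gen_mul_mem_weightPart {b : ℕ} (a : E ⊕ (E ⊕ O)) {x : SuperSym K E O}
    (hx : x ∈ weightPart q b) :
    gen (adaptedLetter q a) * x ∈ weightPart (K := K) (O := O) q (b + if a.isRight then 1 else 0) := by
  induction hx using Submodule.span_induction with
  | zero => simp
  | add p r _ _ hp hr => rw [mul_add]; exact Submodule.add_mem _ hp hr
  | smul c p _ hp => rw [mul_smul_comm]; exact Submodule.smul_mem _ _ hp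
  | mem p hp =>
    obtain ⟨l, rfl, rfl⟩ := hp
    exact Submodule.subset_span ⟨a :: l, by rw [List.countP_cons], by simp⟩

theorem gen_proj_mul_mem_weightPart {b : ℕ} (e : E) {x : SuperSym K E O}
    (hx : x ∈ weightPart q b) : gen (q e, 0) * x ∈ weightPart q b :=
  gen_mul_mem_weightPart (Sum.inl e) hx

theorem gen_even_mul_mem_weightPart {b : ℕ} (e : E) (he : q e = 0) {x : SuperSym K E O}
    (hx : x ∈ weightPart q b) : gen (e, 0) * x ∈ weightPart q (b + 1) := by
  have := gen_mul_mem_weightPart (Sum.inr (Sum.inl e)) hx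
  simpa [adaptedLetter, he] using this

theorem gen_odd_mul_mem_weightPart {b : ℕ} (o : O) {x : SuperSym K E O}
    (hx : x ∈ weightPart q b) : gen (0, o) * x ∈ weightPart q (b + 1) :=
  gen_mul_mem_weightPart (Sum.inr (Sum.inr o)) hx

theorem one_mem_weightPart : (1 : SuperSym K E O) ∈ weightPart q 0 :=
  Submodule.subset_span ⟨[], by simp, by simp⟩

theorem weightPart_induction (hqq : ∀ e, q (q e) = q e) {P : ℕ → SuperSym K E O → Prop}
    (one : P 0 1) (zero : ∀ b, P b 0)
    (add : ∀ b x y, P b x → P b y → P b (x + y)) (smul : ∀ b (c : K) x, P b x → P b (c • x))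
    (proj : ∀ b e x, x ∈ weightPart q b → P b x → P b (gen (q e, 0) * x))
    (even : ∀ b e x, q e = 0 → x ∈ weightPart q b → P b x → P (b + 1) (gen (e, 0) * x))
    (odd : ∀ b o x, x ∈ weightPart q b → P b x → P (b + 1) (gen (0, o) * x))
    {b : ℕ} {x : SuperSym K E O} (hx : x ∈ weightPart q b) : P b x := by
  induction hx using Submodule.span_induction with
  | zero => exact zero b
  | add p q _ _ hp hq => exact add b p q hp hq
  | smul c p _ hp => exact smul b c p hp
  | mem p hp =>
    obtain ⟨l, rfl, rfl⟩ := hp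
    induction l with
    | nil => simpa using one
    | cons a l ih =>
      have hl : (l.map (gen ∘ adaptedLetter q)).prod ∈
          weightPart (K := K) (O := O) q (l.countP Sum.isRight) :=
        Submodule.subset_span ⟨l, rfl, rfl⟩
      rw [List.countP_cons, List.map_cons, List.prod_cons]
      rcases a with e | e | o
      · exact proj _ e _ hl ih
      · exact even _ (e - q e) _ (by rw [map_sub, hqq, sub_self]) hl ih
      · exact odd _ o _ hl ih

/-- Every element of degree `k` is a sum of elements of degree `k` of definite weights. -/
theorem cohDegree_le_iSup_weightPart (hqq : ∀ e, q (q e) = q e) (k : ℤ) :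
    cohDegree K E O k ≤ ⨆ b, weightPart q b ⊓ cohDegree K E O k := by
  intro x hx
  refine cohDegree_induction
    (P := fun k x => x ∈ ⨆ b, weightPart q b ⊓ cohDegree K E O k) ?_ ?_ ?_ ?_ ?_ ?_ hx
  · exact Submodule.mem_iSup_of_mem 0 ⟨one_mem_weightPart, one_mem_cohDegree⟩
  · intro k; exact Submodule.zero_mem _
  · intro k x y hx hy; exact Submodule.add_mem _ hx hy
  · intro k c x hx; exact Submodule.smul_mem _ _ hx
  · intro k e x hk hx
    clear hk
    induction hx using Submodule.iSup_induction' with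
    | zero => simp
    | add x y _ _ hx hy => rw [mul_add]; exact Submodule.add_mem _ hx hy
    | mem b x hx =>
      have he : ((e, 0) : E × O) = (q e, 0) + (e - q e, 0) := by simp
      rw [he, map_add, add_mul]
      refine Submodule.add_mem _ (Submodule.mem_iSup_of_mem b ?_)
        (Submodule.mem_iSup_of_mem (b + 1) ?_)
      · exact ⟨gen_proj_mul_mem_weightPart e hx.1, gen_even_mul_mem_cohDegree _ hx.2⟩
      · exact ⟨gen_even_mul_mem_weightPart _ (by rw [map_sub, hqq, sub_self]) hx.1,
          gen_even_mul_mem_cohDegree _ hx.2⟩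
  · intro k o x hk hx
    clear hk
    induction hx using Submodule.iSup_induction' with
    | zero => simp
    | add x y _ _ hx hy => rw [mul_add]; exact Submodule.add_mem _ hx hy
    | mem b x hx =>
      exact Submodule.mem_iSup_of_mem (b + 1)
        ⟨gen_odd_mul_mem_weightPart o hx.1, gen_odd_mul_mem_cohDegree o hx.2⟩

theorem weightPart_iSup_induction (hqq : ∀ e, q (q e) = q e) {P : SuperSym K E O → Prop}
    (mem : ∀ b, ∀ x ∈ weightPart q b, P x) (add : ∀ x y, P x → P y → P (x + y))
    (x : SuperSym K E O) : P x := by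
  have hx : x ∈ ⨆ b, weightPart q b := by
    induction x using induction_left with
    | one => exact Submodule.mem_iSup_of_mem 0 one_mem_weightPart
    | add x y hx hy => exact Submodule.add_mem _ hx hy
    | smul c x hx => exact Submodule.smul_mem _ _ hx
    | gen_mul v x hx =>
      induction hx using Submodule.iSup_induction' with
      | zero => simp
      | add x y _ _ hx hy => rw [mul_add]; exact Submodule.add_mem _ hx hy
      | mem b x hx =>
        have hv : v = (q v.1, 0) + (v.1 - q v.1, 0) + (0, v.2) := by ext <;> simp
        rw [hv, map_add, map_add, add_mul, add_mul]
        refine Submodule.add_mem _ (Submodule.add_mem _ (Submodule.mem_iSup_of_mem b ?_)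
          (Submodule.mem_iSup_of_mem (b + 1) ?_)) (Submodule.mem_iSup_of_mem (b + 1) ?_)
        · exact gen_proj_mul_mem_weightPart v.1 hx
        · exact gen_even_mul_mem_weightPart _ (by rw [map_sub, hqq, sub_self]) hx
        · exact gen_odd_mul_mem_weightPart v.2 hx
  induction hx using Submodule.iSup_induction' with
  | zero => exact mem 0 0 (Submodule.zero_mem _)
  | add x y _ _ hx hy => exact add x y hx hy
  | mem b x hx => exact mem b x hx

theorem countP_eq_card_filter {α : Type*} (p : α → Bool) (l : List α) :
    l.countP p = (Finset.univ.filter fun i : Fin l.length => p (l.get i) = true).card := by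
  induction l with
  | nil => simp
  | cons a l ih =>
    rw [List.countP_cons, ih]
    refine Eq.trans ?_ (Fin.card_filter_univ_succ (fun i : Fin (l.length + 1) =>
      p ((a :: l).get i) = true)).symm
    by_cases h : p a = true <;> simp [h]

variable {h : E →ₗ[K] O}

/-- On the part of weight `b`, the symmetrized homotopy is `1 / b` times the derivation that
extends `h`, and it is zero for `b = 0`. -/
theorem smul_symHomotopy_weightPart [CharZero K] (hqq : ∀ e, q (q e) = q e)
    (hhq : ∀ e, h (q e) = 0) {b : ℕ} {x : SuperSym K E O} (hx : x ∈ weightPart q b) :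
    (b : K) • symHomotopy (evenToOdd h) (evenToEven q) x = homotopyDer h x ∧
      (b = 0 → symHomotopy (evenToOdd h) (evenToEven q) x = 0) := by
  induction hx using Submodule.span_induction with
  | zero => simp
  | add p r _ _ hp hr =>
    simp only [map_add, smul_add]
    exact ⟨by rw [hp.1, hr.1], fun hb => by rw [hp.2 hb, hr.2 hb, add_zero]⟩
  | smul c p _ hp =>
    simp only [map_smul]
    exact ⟨by rw [smul_comm, hp.1], fun hb => by rw [hp.2 hb, smul_zero]⟩
  | mem p hp =>
    obtain ⟨l, rfl, rfl⟩ := hp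
    have e : (l.map (gen ∘ adaptedLetter q : E ⊕ (E ⊕ O) → SuperSym K E O)).prod =
        (List.ofFn fun i => (gen (adaptedLetter q (l.get i)) : SuperSym K E O)).prod := by
      congr 1
      conv_lhs => rw [← List.ofFn_get l, List.map_ofFn]
      rfl
    set ε : E ⊕ (E ⊕ O) → Bool := Sum.elim (fun _ => false) Sum.isRight with hε
    have hv : ∀ a : E ⊕ (E ⊕ O), homPart K (ε a) (adaptedLetter q a) = adaptedLetter q a := by
      rintro (e | e | o) <;> simp [hε, homPart, adaptedLetter]
    have h1 : ∀ a : E ⊕ (E ⊕ O), a.isRight = true → evenToEven q (adaptedLetter q a) = 0 := by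
      rintro (e | e | o) <;> simp [evenToEven_apply, adaptedLetter, hqq]
    have h2 : ∀ a : E ⊕ (E ⊕ O), ¬a.isRight = true →
        evenToEven q (adaptedLetter q a) = adaptedLetter q a := by
      rintro (e | e | o) <;> simp [evenToEven_apply, adaptedLetter, hqq]
    rw [e]
    constructor
    · rw [countP_eq_card_filter]
      exact card_smul_symHomotopy _ (fun i => ε (l.get i)) (fun i => hv _) _
        (fun i hi => h1 _ (Finset.mem_filter.1 hi).2)
        (fun i hi => h2 _ fun hi' => hi (Finset.mem_filter.2 ⟨Finset.mem_univ _, hi'⟩)) hhq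
    · intro h0
      exact symHomotopy_eq_zero _ (fun i => ε (l.get i)) (fun i => hv _)
        (fun i => h2 _ (List.countP_eq_zero.1 h0 _ (List.get_mem _ _))) hhq

theorem symHomotopy_of_mem_weightPart_zero [CharZero K] (hqq : ∀ e, q (q e) = q e)
    (hhq : ∀ e, h (q e) = 0) {x : SuperSym K E O} (hx : x ∈ weightPart q 0) :
    symHomotopy (evenToOdd h) (evenToEven q) x = 0 :=
  (smul_symHomotopy_weightPart hqq hhq hx).2 rfl

theorem symHomotopy_of_mem_weightPart_succ [CharZero K] (hqq : ∀ e, q (q e) = q e)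
    (hhq : ∀ e, h (q e) = 0) {b : ℕ} {x : SuperSym K E O} (hx : x ∈ weightPart q (b + 1)) :
    symHomotopy (evenToOdd h) (evenToEven q) x = ((b + 1 : ℕ) : K)⁻¹ • homotopyDer h x := by
  have hb : ((b + 1 : ℕ) : K) ≠ 0 := Nat.cast_ne_zero.2 b.succ_ne_zero
  rw [← (smul_symHomotopy_weightPart hqq hhq hx).1, smul_smul, inv_mul_cancel₀ hb, one_smul]

theorem symHomotopy_mem_cohDegree [CharZero K] (hqq : ∀ e, q (q e) = q e)
    (hhq : ∀ e, h (q e) = 0) {k : ℤ} {x : SuperSym K E O} (hx : x ∈ cohDegree K E O k) :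
    symHomotopy (evenToOdd h) (evenToEven q) x ∈ cohDegree K E O (k - 1) := by
  have hx' := cohDegree_le_iSup_weightPart hqq k hx
  clear hx
  induction hx' using Submodule.iSup_induction' with
  | zero => simp
  | add x y _ _ hx hy => rw [map_add]; exact Submodule.add_mem _ hx hy
  | mem b x hx =>
    cases b with
    | zero => rw [symHomotopy_of_mem_weightPart_zero hqq hhq hx.1]; exact Submodule.zero_mem _
    | succ b =>
      rw [symHomotopy_of_mem_weightPart_succ hqq hhq hx.1]
      exact Submodule.smul_mem _ _ (homotopyDer_mem_cohDegree h hx.2)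

theorem homotopyDer_mem_weightPart (hqq : ∀ e, q (q e) = q e) (hhq : ∀ e, h (q e) = 0) {b : ℕ}
    {x : SuperSym K E O} (hx : x ∈ weightPart q b) : homotopyDer h x ∈ weightPart q b := by
  have hH := isOddDer_homotopyDer h
  refine weightPart_induction hqq (P := fun b x => homotopyDer h x ∈ weightPart q b)
    ?_ ?_ ?_ ?_ ?_ ?_ ?_ hx
  · rw [hH.map_one]; exact Submodule.zero_mem _
  · intro b; simp
  · intro b x y hx hy; rw [map_add]; exact Submodule.add_mem _ hx hy
  · intro b c x hx; rw [map_smul]; exact Submodule.smul_mem _ _ hx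
  · intro b e x _ hx
    rw [hH.gen_mul, evenToOdd_apply, hhq, gen_zero_zero, zero_mul, zero_add, parityGen_apply,
      neg_zero]
    exact gen_proj_mul_mem_weightPart e hx
  · intro b e x he hx hx'
    rw [hH.gen_mul, parityGen_apply, neg_zero]
    exact Submodule.add_mem _ (gen_odd_mul_mem_weightPart _ hx)
      (gen_even_mul_mem_weightPart _ he hx')
  · intro b o x _ hx
    rw [hH.gen_mul, evenToOdd_apply, map_zero, gen_zero_zero, zero_mul, zero_add]
    exact gen_odd_mul_mem_weightPart (-o) hx

theorem oddDer_mem_weightPart (hqq : ∀ e, q (q e) = q e) {D : O →ₗ[K] E} (hqD : ∀ o, q (D o) = 0)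
    {b : ℕ} {x : SuperSym K E O} (hx : x ∈ weightPart q b) : oddDer D x ∈ weightPart q b := by
  refine weightPart_induction hqq (P := fun b x => oddDer D x ∈ weightPart q b)
    ?_ ?_ ?_ ?_ ?_ ?_ ?_ hx
  · rw [oddDer_one]; exact Submodule.zero_mem _
  · intro b; simp
  · intro b x y hx hy; rw [map_add]; exact Submodule.add_mem _ hx hy
  · intro b c x hx; rw [map_smul]; exact Submodule.smul_mem _ _ hx
  · intro b e x _ hx
    rw [oddDer_gen_mul, map_zero, gen_zero_zero, zero_mul, zero_add, neg_zero]
    exact gen_proj_mul_mem_weightPart e hx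
  · intro b e x he _ hx
    rw [oddDer_gen_mul, map_zero, gen_zero_zero, zero_mul, zero_add, neg_zero]
    exact gen_even_mul_mem_weightPart e he hx
  · intro b o x hx hx'
    rw [oddDer_gen_mul]
    exact Submodule.add_mem _ (gen_even_mul_mem_weightPart _ (hqD o) hx)
      (gen_odd_mul_mem_weightPart (-o) hx')

/-- The algebra homomorphism that extends `q` is the identity in weight zero. -/
theorem map_of_mem_weightPart_zero (hqq : ∀ e, q (q e) = q e) {x : SuperSym K E O}
    (hx : x ∈ weightPart q 0) : map q (0 : O →ₗ[K] O) x = x := by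
  refine weightPart_induction hqq (P := fun b x => b = 0 → map q (0 : O →ₗ[K] O) x = x)
    ?_ ?_ ?_ ?_ ?_ ?_ ?_ hx rfl
  · intro _; simp
  · intro b _; simp
  · intro b x y hx hy hb; rw [_root_.map_add, hx hb, hy hb]
  · intro b c x hx hb; rw [_root_.map_smul, hx hb]
  · intro b e x _ hx hb; rw [map_mul, hx hb, map_gen]; simp [hqq]
  · intro b e x _ _ _ hb; omega
  · intro b o x _ _ hb; omega

theorem map_mem_weightPart_zero (x : SuperSym K E O) :
    map q (0 : O →ₗ[K] O) x ∈ weightPart q 0 := by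
  induction x using induction_left with
  | one => rw [_root_.map_one]; exact one_mem_weightPart
  | add x y hx hy => rw [_root_.map_add]; exact Submodule.add_mem _ hx hy
  | smul c x hx => rw [_root_.map_smul]; exact Submodule.smul_mem _ _ hx
  | gen_mul v x hx => rw [map_mul, map_gen]; exact gen_proj_mul_mem_weightPart v.1 hx

/-- An algebra homomorphism that kills the letters killed by `q` is zero in positive weight. -/
theorem algHom_eq_zero_of_mem_weightPart (hqq : ∀ e, q (q e) = q e) {B : Type*} [Ring B]
    [Algebra K B] (p : SuperSym K E O →ₐ[K] B) (hp : ∀ e, q e = 0 → p (gen (e, 0)) = 0)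
    (hp' : ∀ o, p (gen (0, o)) = 0) {b : ℕ} (hb : b ≠ 0) {x : SuperSym K E O}
    (hx : x ∈ weightPart q b) : p x = 0 := by
  revert hb
  refine weightPart_induction hqq (P := fun b x => b ≠ 0 → p x = 0) ?_ ?_ ?_ ?_ ?_ ?_ ?_ hx
  · intro h; exact absurd rfl h
  · intro b _; exact map_zero p
  · intro b x y hx hy hb; rw [map_add, hx hb, hy hb, add_zero]
  · intro b c x hx hb; rw [map_smul, hx hb, smul_zero]
  · intro b e x _ hx hb; rw [map_mul, hx hb, mul_zero]
  · intro b e x he _ _ _; rw [map_mul, hp e he, zero_mul]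
  · intro b o x _ _ _; rw [map_mul, hp', zero_mul]

end Weight

/-! ### The unperturbed deformation retract -/

section Retract

variable {K E O : Type*} [Field K] [AddCommGroup E] [Module K E] [AddCommGroup O] [Module K O]

/-- A deformation retraction `D h = q - 1`, `h D = -1`, `h q = 0` of the two term complex
`D : O → E` onto the image of the projection `q` of `E`. -/
structure IsRetractionOfGenerators (D : O →ₗ[K] E) (h : E →ₗ[K] O) (q : E →ₗ[K] E) : Prop where
  d_h : ∀ e, D (h e) = q e - e
  h_d : ∀ o, h (D o) = -o
  h_q : ∀ e, h (q e) = 0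

variable {D : O →ₗ[K] E} {h : E →ₗ[K] O} {q : E →ₗ[K] E}

namespace IsRetractionOfGenerators

variable (H : IsRetractionOfGenerators D h q)

include H

theorem q_q (e : E) : q (q e) = q e := by
  have := H.d_h (q e)
  rw [H.h_q, map_zero] at this
  exact sub_eq_zero.1 this.symm

theorem q_d (o : O) : q (D o) = 0 := by
  have := H.d_h (D o)
  rw [H.h_d, map_neg] at this
  have h2 : q (D o) = -D o + D o := by rw [this]; abel
  rw [h2, neg_add_cancel]

theorem oddDer_homotopyDer {b : ℕ} {x : SuperSym K E O} (hx : x ∈ weightPart q b) :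
    oddDer D (homotopyDer h x) + homotopyDer h (oddDer D x) = -((b : K) • x) := by
  have hN := (isOddDer_oddDer D).anticommutator (isOddDer_homotopyDer h) (oddToEven_parityGen D)
    (evenToOdd_parityGen h)
  refine weightPart_induction H.q_q (P := fun b x =>
    oddDer D (homotopyDer h x) + homotopyDer h (oddDer D x) = -((b : K) • x))
    ?_ ?_ ?_ ?_ ?_ ?_ ?_ hx
  · simp [oddDer_one, (isOddDer_homotopyDer h).map_one]
  · intro b; simp
  · intro b x y hx hy
    rw [smul_add, neg_add, ← hx, ← hy]
    simp only [map_add]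
    abel
  · intro b c x hx
    rw [smul_comm, ← smul_neg, ← hx]
    simp only [map_smul, smul_add]
  · intro b e x _ hx
    have := hN.gen_mul (q e, 0) x
    simp only [LinearMap.add_apply, LinearMap.comp_apply] at this
    rw [this, hx]
    simp [oddToEven_apply, evenToOdd_apply, H.h_q, gen_zero_zero]
  · intro b e x he _ hx
    have := hN.gen_mul (e, 0) x
    simp only [LinearMap.add_apply, LinearMap.comp_apply] at this
    have h1 : (gen (-e, (0 : O)) : SuperSym K E O) = -gen (e, (0 : O)) := by
      rw [← map_neg]; simp
    rw [this, hx]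
    simp [oddToEven_apply, evenToOdd_apply, H.d_h, he, h1, add_smul]
  · intro b o x _ hx
    have := hN.gen_mul (0, o) x
    simp only [LinearMap.add_apply, LinearMap.comp_apply] at this
    have h1 : (gen ((0 : E), -o) : SuperSym K E O) = -gen ((0 : E), o) := by
      rw [← map_neg]; simp
    rw [this, hx]
    simp [oddToEven_apply, evenToOdd_apply, H.h_d, h1, add_smul]

theorem symHomotopy_mem_weightPart [CharZero K] {b : ℕ} {x : SuperSym K E O} (hx : x ∈ weightPart q b) :
    symHomotopy (evenToOdd h) (evenToEven q) x ∈ weightPart q b := by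
  cases b with
  | zero =>
    rw [symHomotopy_of_mem_weightPart_zero H.q_q H.h_q hx]; exact Submodule.zero_mem _
  | succ b =>
    rw [symHomotopy_of_mem_weightPart_succ H.q_q H.h_q hx]
    exact Submodule.smul_mem _ _ (homotopyDer_mem_weightPart H.q_q H.h_q hx)

/-- The symmetrized homotopy contracts the symmetric algebra onto the symmetric algebra of the
image of `q`. -/
theorem oddDer_symHomotopy [CharZero K] (x : SuperSym K E O) :
    oddDer D (symHomotopy (evenToOdd h) (evenToEven q) x) +
      symHomotopy (evenToOdd h) (evenToEven q) (oddDer D x) = map q (0 : O →ₗ[K] O) x - x := by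
  induction x using weightPart_iSup_induction H.q_q with
  | add x y hx hy =>
    simp only [_root_.map_add]
    rw [add_sub_add_comm, ← hx, ← hy]
    abel
  | mem b x hx =>
    have hdx := oddDer_mem_weightPart H.q_q H.q_d hx
    have hDH := H.oddDer_homotopyDer hx
    cases b with
    | zero =>
      rw [symHomotopy_of_mem_weightPart_zero H.q_q H.h_q hx,
        symHomotopy_of_mem_weightPart_zero H.q_q H.h_q hdx, map_of_mem_weightPart_zero H.q_q hx]
      simp
    | succ b =>
      have hb : ((b + 1 : ℕ) : K) ≠ 0 := Nat.cast_ne_zero.2 b.succ_ne_zero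
      have h0 : map q (0 : O →ₗ[K] O) x = 0 :=
        algHom_eq_zero_of_mem_weightPart H.q_q _ (fun e he => by simp [he, gen_zero_zero])
          (fun o => by simp [gen_zero_zero]) b.succ_ne_zero hx
      rw [symHomotopy_of_mem_weightPart_succ H.q_q H.h_q hx,
        symHomotopy_of_mem_weightPart_succ H.q_q H.h_q hdx, _root_.map_smul, ← smul_add, hDH, h0,
        smul_neg, smul_smul, inv_mul_cancel₀ hb, one_smul, zero_sub]

theorem symHomotopy_symHomotopy [CharZero K] (x : SuperSym K E O) :
    symHomotopy (evenToOdd h) (evenToEven q) (symHomotopy (evenToOdd h) (evenToEven q) x) = 0 := by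
  induction x using weightPart_iSup_induction H.q_q with
  | add x y hx hy => simp only [map_add, hx, hy, add_zero]
  | mem b x hx =>
    cases b with
    | zero =>
      rw [symHomotopy_of_mem_weightPart_zero H.q_q H.h_q hx, map_zero]
    | succ b =>
      rw [symHomotopy_of_mem_weightPart_succ H.q_q H.h_q hx, map_smul,
        symHomotopy_of_mem_weightPart_succ H.q_q H.h_q
          (homotopyDer_mem_weightPart H.q_q H.h_q hx),
        (isOddDer_homotopyDer h).comp_self (fun v => by simp [evenToOdd_apply])
          (evenToOdd_parityGen h), smul_zero, smul_zero]

theorem algHom_symHomotopy [CharZero K] {B : Type*} [Ring B] [Algebra K B] (p : SuperSym K E O →ₐ[K] B)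
    (hp : ∀ e, q e = 0 → p (gen (e, 0)) = 0) (hp' : ∀ o, p (gen (0, o)) = 0)
    (x : SuperSym K E O) : p (symHomotopy (evenToOdd h) (evenToEven q) x) = 0 := by
  induction x using weightPart_iSup_induction H.q_q with
  | add x y hx hy => simp only [map_add, hx, hy, add_zero]
  | mem b x hx =>
    cases b with
    | zero =>
      rw [symHomotopy_of_mem_weightPart_zero H.q_q H.h_q hx, map_zero]
    | succ b =>
      exact algHom_eq_zero_of_mem_weightPart H.q_q p hp hp' b.succ_ne_zero
        (H.symHomotopy_mem_weightPart hx)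

end IsRetractionOfGenerators

end Retract

/-! ### The perturbation series -/

section Perturbation

variable {K M : Type*} [Field K] [AddCommGroup M] [Module K M] (β : M →ₗ[K] M →ₗ[K] M)
  (hβ : ∀ x y, β x y = -β y x) (h q : M × M →ₗ[K] M × M)

theorem perturbationSeries_eq_sum (x : SuperSym K M M) : ∃ N : ℕ, ∀ n, N ≤ n →
    perturbationSeries β hβ h q x = ∑ j ∈ Finset.range n,
      ((chevalleyEilenberg β hβ ∘ₗ symHomotopy h q : Module.End K (SuperSym K M M)) ^ j) x := by
  obtain ⟨N, hN⟩ := exists_pow_apply_eq_zero β hβ h q x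
  refine ⟨N, fun n hn => finsum_eq_sum_of_support_subset _ fun j hj => ?_⟩
  by_contra hlt
  exact hj (hN j (hn.trans (by simpa using hlt)))

theorem perturbationSeries_eq_add_right (x : SuperSym K M M) :
    perturbationSeries β hβ h q x =
      x + perturbationSeries β hβ h q (chevalleyEilenberg β hβ (symHomotopy h q x)) := by
  obtain ⟨N, hN⟩ := perturbationSeries_eq_sum β hβ h q x
  obtain ⟨N', hN'⟩ := perturbationSeries_eq_sum β hβ h q
    (chevalleyEilenberg β hβ (symHomotopy h q x))
  rw [hN (max N N' + 1) (by omega), hN' (max N N') (by omega), Finset.sum_range_succ', add_comm]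
  rfl

theorem perturbationSeries_eq_add_left (x : SuperSym K M M) :
    perturbationSeries β hβ h q x =
      x + chevalleyEilenberg β hβ (symHomotopy h q (perturbationSeries β hβ h q x)) := by
  obtain ⟨N, hN⟩ := perturbationSeries_eq_sum β hβ h q x
  conv_lhs => rw [hN (N + 1) (by omega), Finset.sum_range_succ', add_comm]
  rw [hN N le_rfl, map_sum, map_sum]
  simp only [pow_succ']
  rfl

theorem perturbationSeries_of_eq_zero {x : SuperSym K M M}
    (hx : chevalleyEilenberg β hβ (symHomotopy h q x) = 0) :
    perturbationSeries β hβ h q x = x := by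
  rw [perturbationSeries_eq_add_right, hx, map_zero, add_zero]

theorem perturbationSeries_mem (W : Submodule K (SuperSym K M M))
    (hW : ∀ x ∈ W, chevalleyEilenberg β hβ (symHomotopy h q x) ∈ W) {x : SuperSym K M M}
    (hx : x ∈ W) : perturbationSeries β hβ h q x ∈ W := by
  obtain ⟨N, hN⟩ := perturbationSeries_eq_sum β hβ h q x
  rw [hN N le_rfl]
  refine Submodule.sum_mem _ fun j hj => ?_
  clear hj
  induction j with
  | zero => exact hx
  | succ j ih => rw [pow_succ']; exact hW _ ih

end Perturbation

end SuperSym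

/-! ### Compactly supported forms -/

namespace FactorizationEnvelope

section Forms

variable {𝕜 : Type*} [RCLike 𝕜] {D D' : Disk}

theorem hasDerivAt_integral_Iic (f : CptFun 𝕜 D) (x : ℝ) :
    HasDerivAt (fun x => ∫ t in Set.Iic x, f t) (f x) x := by
  have h1 : (fun x => ∫ t in Set.Iic x, f t) =
      fun x => (∫ t in Set.Iic (0 : ℝ), f t) + ∫ t in (0 : ℝ)..x, f t := by
    funext y
    rw [← intervalIntegral.integral_Iic_sub_Iic (integrable_cptFun f).integrableOn
      (integrable_cptFun f).integrableOn]
    ring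
  rw [h1]
  exact ((f.continuous.integral_hasStrictDerivAt 0 x).hasDerivAt).const_add _

theorem homotopyForm_apply (ω : UnitForm 𝕜 D) (f : CptFun 𝕜 D) (x : ℝ) :
    homotopyForm ω f x = ∫ t in Set.Iic x, (f t - (∫ x, f x) * ω.1 t) := rfl

theorem deRham_homotopyForm (ω : UnitForm 𝕜 D) (f : CptFun 𝕜 D) :
    deRham D (homotopyForm ω f) = f - integralForm D f • ω.1 := by
  ext x
  have h := (hasDerivAt_integral_Iic (f - (∫ x, f x) • ω.1) x).deriv
  change deriv (fun x => ∫ t in Set.Iic x, (f - (∫ x, f x) • ω.1) t) x = _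
  rw [h]
  rfl

theorem homotopyForm_unitForm (ω : UnitForm 𝕜 D) : homotopyForm ω ω.1 = 0 := by
  ext x
  rw [homotopyForm_apply, ω.2]
  simp

theorem integral_Iic_deRham (f : CptFun 𝕜 D) (x : ℝ) : ∫ t in Set.Iic x, deRham D f t = f x :=
  f.hasCompactSupport.integral_Iic_deriv_eq (f.contDiff.of_le (by simp)) x

theorem integral_deRham (f : CptFun 𝕜 D) : ∫ t, deRham D f t = 0 := by
  have h1 := f.hasCompactSupport.integral_Iic_deriv_eq (f.contDiff.of_le (by simp)) 0
  have h2 := f.hasCompactSupport.integral_Ioi_deriv_eq (f.contDiff.of_le (by simp)) 0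
  have h3 := intervalIntegral.integral_Iic_add_Ioi (b := (0 : ℝ)) (μ := volume)
    (integrable_cptFun (deRham D f)).integrableOn (integrable_cptFun (deRham D f)).integrableOn
  rw [← h3]
  change (∫ t in Set.Iic (0 : ℝ), deriv f t) + ∫ t in Set.Ioi (0 : ℝ), deriv f t = 0
  rw [h1, h2, add_neg_cancel]

theorem homotopyForm_deRham (ω : UnitForm 𝕜 D) (f : CptFun 𝕜 D) :
    homotopyForm ω (deRham D f) = f := by
  ext x
  rw [homotopyForm_apply, integral_deRham]
  simpa using integral_Iic_deRham f x

theorem deRham_mulFun (f g : CptFun 𝕜 D) :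
    deRham D (mulFun D f g) = mulFun D (deRham D f) g + mulFun D f (deRham D g) := by
  ext x
  exact deriv_fun_mul (f.contDiff.differentiable (by simp) x) (g.contDiff.differentiable (by simp) x)

end Forms

/-! ### The factorization envelope on a disk -/

section Envelope

variable {𝕜 : Type*} [RCLike 𝕜] {𝔤 : Type*} [LieRing 𝔤] [LieAlgebra 𝕜 𝔤]

theorem bracket_jacobi (D : Disk) (x y z : LieForms 𝕜 𝔤 D) :
    bracket 𝕜 𝔤 D x (bracket 𝕜 𝔤 D y z) =
      bracket 𝕜 𝔤 D (bracket 𝕜 𝔤 D x y) z + bracket 𝕜 𝔤 D y (bracket 𝕜 𝔤 D x z) := by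
  induction x using TensorProduct.induction_on with
  | zero => simp
  | add x x' hx hx' => simp only [map_add, LinearMap.add_apply, hx, hx']; abel
  | tmul X f =>
    induction y using TensorProduct.induction_on with
    | zero => simp
    | add y y' hy hy' => simp only [map_add, LinearMap.add_apply, hy, hy']; abel
    | tmul Y g =>
      induction z using TensorProduct.induction_on with
      | zero => simp
      | add z z' hz hz' => simp only [map_add, hz, hz']; abel
      | tmul Z k =>
        have e1 : mulFun D (mulFun D f g) k = mulFun D f (mulFun D g k) := by
          ext x; exact mul_assoc _ _ _
        have e2 : mulFun D g (mulFun D f k) = mulFun D f (mulFun D g k) := by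
          ext x; exact mul_left_comm _ _ _
        simp only [bracket_tmul, e1, e2]
        rw [← TensorProduct.add_tmul, ← leibniz_lie]

theorem bracket_deRham (D : Disk) (x y : LieForms 𝕜 𝔤 D) :
    (-(deRham D).lTensor 𝔤) (bracket 𝕜 𝔤 D x y) =
      bracket 𝕜 𝔤 D ((-(deRham D).lTensor 𝔤) x) y +
        bracket 𝕜 𝔤 D x ((-(deRham D).lTensor 𝔤) y) := by
  induction x using TensorProduct.induction_on with
  | zero => simp
  | add x x' hx hx' => simp only [map_add, LinearMap.add_apply, hx, hx']; abel
  | tmul X f =>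
    induction y using TensorProduct.induction_on with
    | zero => simp
    | add y y' hy hy' => simp only [map_add, hy, hy']; abel
    | tmul Y g =>
      simp only [LinearMap.neg_apply, LinearMap.lTensor_tmul, bracket_tmul, map_neg, deRham_mulFun,
        TensorProduct.tmul_add, neg_add]

theorem bracket_extend {D D' : Disk} (h : D.1 ≤ D'.1) (x y : LieForms 𝕜 𝔤 D) :
    bracket 𝕜 𝔤 D' ((extend h).lTensor 𝔤 x) ((extend h).lTensor 𝔤 y) =
      (extend h).lTensor 𝔤 (bracket 𝕜 𝔤 D x y) := by
  induction x using TensorProduct.induction_on with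
  | zero => simp
  | add x x' hx hx' => simp only [map_add, LinearMap.add_apply, hx, hx']
  | tmul X f =>
    induction y using TensorProduct.induction_on with
    | zero => simp
    | add y y' hy hy' => simp only [map_add, hy, hy']
    | tmul Y g => rfl

theorem bracket_extend_disjoint {D₁ D₂ D : Disk} (h₁ : D₁.1 ≤ D.1) (h₂ : D₂.1 ≤ D.1)
    (h : Disjoint (D₁.1 : Set ℝ) (D₂.1 : Set ℝ)) (x : LieForms 𝕜 𝔤 D₁) (y : LieForms 𝕜 𝔤 D₂) :
    bracket 𝕜 𝔤 D ((extend h₁).lTensor 𝔤 x) ((extend h₂).lTensor 𝔤 y) = 0 := by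
  induction x using TensorProduct.induction_on with
  | zero => simp
  | add x x' hx hx' => simp only [map_add, LinearMap.add_apply, hx, hx', add_zero]
  | tmul X f =>
    induction y using TensorProduct.induction_on with
    | zero => simp
    | add y y' hy hy' => simp only [map_add, hy, hy', add_zero]
    | tmul Y g =>
      have : mulFun D (extend h₁ f) (extend h₂ g) = 0 := by
        ext t
        change f t * g t = 0
        by_cases ht : t ∈ (D₁.1 : Set ℝ)
        · have : t ∉ tsupport g := fun h' => Set.disjoint_left.1 h ht (g.tsupport_subset h')
          rw [image_eq_zero_of_notMem_tsupport this, mul_zero]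
        · have : t ∉ tsupport f := fun h' => ht (f.tsupport_subset h')
          rw [image_eq_zero_of_notMem_tsupport this, zero_mul]
      rw [LinearMap.lTensor_tmul, LinearMap.lTensor_tmul, bracket_tmul, this,
        TensorProduct.tmul_zero]

theorem deRham_extend {D D' : Disk} (h : D.1 ≤ D'.1) (x : LieForms 𝕜 𝔤 D) :
    (-(deRham D').lTensor 𝔤) ((extend h).lTensor 𝔤 x) =
      (extend h).lTensor 𝔤 ((-(deRham D).lTensor 𝔤) x) := by
  induction x using TensorProduct.induction_on with
  | zero => simp
  | add x x' hx hx' => simp only [map_add, hx, hx']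
  | tmul X f => simp only [LinearMap.neg_apply, LinearMap.lTensor_tmul, map_neg]; rfl

variable (𝔤) in
theorem isRetractionOfGenerators {D : Disk} (ω : UnitForm 𝕜 D) :
    SuperSym.IsRetractionOfGenerators (-(deRham D).lTensor 𝔤) ((homotopyForm ω).lTensor 𝔤)
      (((integralForm D).smulRight ω.1).lTensor 𝔤) where
  d_h x := by
    induction x using TensorProduct.induction_on with
    | zero => simp
    | add x x' hx hx' => simp only [map_add, hx, hx']; abel
    | tmul X f =>
      simp only [LinearMap.neg_apply, LinearMap.lTensor_tmul, LinearMap.smulRight_apply]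
      rw [deRham_homotopyForm, ← TensorProduct.tmul_sub, ← TensorProduct.tmul_neg,
        neg_sub]
  h_d x := by
    induction x using TensorProduct.induction_on with
    | zero => simp
    | add x x' hx hx' => simp only [map_add, hx, hx', neg_add]
    | tmul X f =>
      simp only [LinearMap.neg_apply, LinearMap.lTensor_tmul, map_neg, homotopyForm_deRham]
  h_q x := by
    induction x using TensorProduct.induction_on with
    | zero => simp
    | add x x' hx hx' => simp only [map_add, hx, hx', add_zero]
    | tmul X f =>
      simp only [LinearMap.lTensor_tmul, LinearMap.smulRight_apply, map_smul,
        homotopyForm_unitForm, smul_zero, TensorProduct.tmul_zero]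

theorem dDR_dDR (D : Disk) (x : FactEnv 𝕜 𝔤 D) : dDR 𝕜 𝔤 D (dDR 𝕜 𝔤 D x) = 0 :=
  (SuperSym.isOddDer_oddDer _).comp_self (fun v => by simp [SuperSym.oddToEven_apply])
    (SuperSym.oddToEven_parityGen _) x

theorem dCE_dCE (D : Disk) (x : FactEnv 𝕜 𝔤 D) : dCE 𝕜 𝔤 D (dCE 𝕜 𝔤 D x) = 0 :=
  SuperSym.chevalleyEilenberg_comp_self _ (bracket_jacobi D) x

theorem dDR_dCE (D : Disk) (x : FactEnv 𝕜 𝔤 D) :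
    dDR 𝕜 𝔤 D (dCE 𝕜 𝔤 D x) = -dCE 𝕜 𝔤 D (dDR 𝕜 𝔤 D x) :=
  SuperSym.oddDer_chevalleyEilenberg _ (bracket_deRham D) x

theorem differential_apply (D : Disk) (x : FactEnv 𝕜 𝔤 D) :
    differential 𝕜 𝔤 D x = dDR 𝕜 𝔤 D x + dCE 𝕜 𝔤 D x := rfl

theorem differential_differential (D : Disk) (x : FactEnv 𝕜 𝔤 D) :
    differential 𝕜 𝔤 D (differential 𝕜 𝔤 D x) = 0 := by
  simp only [differential_apply, map_add, dDR_dDR, dCE_dCE, dDR_dCE]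
  abel

theorem differential_mem_cohDegree {D : Disk} {k : ℤ} {x : FactEnv 𝕜 𝔤 D}
    (hx : x ∈ SuperSym.cohDegree 𝕜 (LieForms 𝕜 𝔤 D) (LieForms 𝕜 𝔤 D) k) :
    differential 𝕜 𝔤 D x ∈ SuperSym.cohDegree 𝕜 (LieForms 𝕜 𝔤 D) (LieForms 𝕜 𝔤 D) (k + 1) :=
  Submodule.add_mem _ (SuperSym.oddDer_mem_cohDegree _ hx)
    (SuperSym.chevalleyEilenberg_mem_cohDegree _ _ hx)

variable {D : Disk} (ω : UnitForm 𝕜 D)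

theorem iMap_mem_cohDegree (a : SymmetricAlgebra 𝕜 𝔤) :
    iMap 𝔤 ω a ∈ SuperSym.cohDegree 𝕜 (LieForms 𝕜 𝔤 D) (LieForms 𝕜 𝔤 D) 0 := by
  induction a using SymmetricAlgebra.induction with
  | algebraMap r =>
    rw [AlgHom.commutes, Algebra.algebraMap_eq_smul_one]
    exact Submodule.smul_mem _ _ SuperSym.one_mem_cohDegree
  | ι X =>
    rw [iMap_ι, ← mul_one (SuperSym.gen _)]
    exact SuperSym.gen_even_mul_mem_cohDegree _ SuperSym.one_mem_cohDegree
  | mul a b ha hb => rw [map_mul]; simpa using SuperSym.mul_mem_cohDegree ha hb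
  | add a b ha hb => rw [map_add]; exact Submodule.add_mem _ ha hb

theorem differential_of_mem_cohDegree_zero {x : FactEnv 𝕜 𝔤 D}
    (hx : x ∈ SuperSym.cohDegree 𝕜 (LieForms 𝕜 𝔤 D) (LieForms 𝕜 𝔤 D) 0) :
    differential 𝕜 𝔤 D x = 0 :=
  SuperSym.cohDegree_eq_zero (by norm_num) (differential_mem_cohDegree hx)

theorem dCE_of_mem_cohDegree_zero {x : FactEnv 𝕜 𝔤 D}
    (hx : x ∈ SuperSym.cohDegree 𝕜 (LieForms 𝕜 𝔤 D) (LieForms 𝕜 𝔤 D) 0) :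
    dCE 𝕜 𝔤 D x = 0 :=
  SuperSym.cohDegree_eq_zero (by norm_num) (SuperSym.chevalleyEilenberg_mem_cohDegree _ _ hx)

theorem pMap_gen (v : LieForms 𝕜 𝔤 D × LieForms 𝕜 𝔤 D) :
    pMap 𝔤 D (SuperSym.gen v) = SymmetricAlgebra.ι 𝕜 𝔤
      (TensorProduct.rid 𝕜 𝔤 ((integralForm D).lTensor 𝔤 v.1)) :=
  SuperSym.lift_gen _ _ _ v

theorem pMap_gen_odd (o : LieForms 𝕜 𝔤 D) :
    pMap 𝔤 D (SuperSym.gen ((0 : LieForms 𝕜 𝔤 D), o)) = 0 := by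
  simp [pMap_gen]

theorem pMap_gen_tmul (X : 𝔤) (f : CptFun 𝕜 D) (o : LieForms 𝕜 𝔤 D) :
    pMap 𝔤 D (SuperSym.gen (X ⊗ₜ f, o)) = (∫ x, f x) • SymmetricAlgebra.ι 𝕜 𝔤 X := by
  rw [pMap_gen, LinearMap.lTensor_tmul, TensorProduct.rid_tmul, map_smul]
  rfl

theorem pMap_iMap (a : SymmetricAlgebra 𝕜 𝔤) : pMap 𝔤 D (iMap 𝔤 ω a) = a := by
  induction a using SymmetricAlgebra.induction with
  | algebraMap r => rw [AlgHom.commutes, AlgHom.commutes]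
  | ι X => rw [iMap_ι, pMap_gen_tmul, ω.2, one_smul]
  | mul a b ha hb => rw [map_mul, map_mul, ha, hb]
  | add a b ha hb => rw [map_add, map_add, ha, hb]

theorem iMap_pMap (x : FactEnv 𝕜 𝔤 D) :
    iMap 𝔤 ω (pMap 𝔤 D x) =
      SuperSym.map (((integralForm D).smulRight ω.1).lTensor 𝔤)
        (0 : LieForms 𝕜 𝔤 D →ₗ[𝕜] LieForms 𝕜 𝔤 D) x := by
  induction x using SuperSym.induction_left with
  | one => simp
  | add x y hx hy => simp only [map_add, hx, hy]
  | smul c x hx => simp only [map_smul, hx]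
  | gen_mul v x hx =>
    rw [map_mul, map_mul, map_mul, hx, SuperSym.map_gen, pMap_gen, iMap_ι]
    congr 2
    refine Prod.ext ?_ rfl
    simp only
    induction v.1 using TensorProduct.induction_on with
    | zero => simp
    | add x y hx hy => simp only [map_add, TensorProduct.add_tmul, hx, hy]
    | tmul X f =>
      simp [TensorProduct.smul_tmul]

theorem dDR_hMap (x : FactEnv 𝕜 𝔤 D) :
    dDR 𝕜 𝔤 D (hMap 𝔤 ω x) + hMap 𝔤 ω (dDR 𝕜 𝔤 D x) = iMap 𝔤 ω (pMap 𝔤 D x) - x := by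
  rw [iMap_pMap]
  exact (isRetractionOfGenerators 𝔤 ω).oddDer_symHomotopy x

theorem hMap_hMap (x : FactEnv 𝕜 𝔤 D) : hMap 𝔤 ω (hMap 𝔤 ω x) = 0 :=
  (isRetractionOfGenerators 𝔤 ω).symHomotopy_symHomotopy x

theorem hMap_iMap (a : SymmetricAlgebra 𝕜 𝔤) : hMap 𝔤 ω (iMap 𝔤 ω a) = 0 := by
  have H := isRetractionOfGenerators 𝔤 ω
  have h := iMap_pMap ω (iMap 𝔤 ω a)
  rw [pMap_iMap] at h
  rw [h]
  exact SuperSym.symHomotopy_of_mem_weightPart_zero H.q_q H.h_q (SuperSym.map_mem_weightPart_zero _)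

theorem pMap_hMap (x : FactEnv 𝕜 𝔤 D) : pMap 𝔤 D (hMap 𝔤 ω x) = 0 := by
  refine (isRetractionOfGenerators 𝔤 ω).algHom_symHomotopy (pMap 𝔤 D) (fun e he => ?_)
    pMap_gen_odd x
  have h := iMap_pMap ω (SuperSym.gen (e, (0 : LieForms 𝕜 𝔤 D)))
  rw [SuperSym.map_gen, he, map_zero] at h
  rw [← pMap_iMap ω (pMap 𝔤 D _), h]
  exact (congrArg _ SuperSym.gen_zero_zero).trans (map_zero _)

theorem hMap_mem_cohDegree {k : ℤ} {x : FactEnv 𝕜 𝔤 D}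
    (hx : x ∈ SuperSym.cohDegree 𝕜 (LieForms 𝕜 𝔤 D) (LieForms 𝕜 𝔤 D) k) :
    hMap 𝔤 ω x ∈ SuperSym.cohDegree 𝕜 (LieForms 𝕜 𝔤 D) (LieForms 𝕜 𝔤 D) (k - 1) :=
  have H := isRetractionOfGenerators 𝔤 ω
  SuperSym.symHomotopy_mem_cohDegree H.q_q H.h_q hx

/-! ### The perturbed deformation retract -/

theorem pertSeries_eq_add_right (x : FactEnv 𝕜 𝔤 D) :
    pertSeries 𝔤 ω x = x + pertSeries 𝔤 ω (dCE 𝕜 𝔤 D (hMap 𝔤 ω x)) :=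
  SuperSym.perturbationSeries_eq_add_right ..

theorem pertSeries_eq_add_left (x : FactEnv 𝕜 𝔤 D) :
    pertSeries 𝔤 ω x = x + dCE 𝕜 𝔤 D (hMap 𝔤 ω (pertSeries 𝔤 ω x)) :=
  SuperSym.perturbationSeries_eq_add_left ..

theorem pertSeries_of_eq_zero {x : FactEnv 𝕜 𝔤 D} (hx : dCE 𝕜 𝔤 D (hMap 𝔤 ω x) = 0) :
    pertSeries 𝔤 ω x = x :=
  SuperSym.perturbationSeries_of_eq_zero _ _ _ _ hx

theorem pertSeries_mem_cohDegree {k : ℤ} {x : FactEnv 𝕜 𝔤 D}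
    (hx : x ∈ SuperSym.cohDegree 𝕜 (LieForms 𝕜 𝔤 D) (LieForms 𝕜 𝔤 D) k) :
    pertSeries 𝔤 ω x ∈ SuperSym.cohDegree 𝕜 (LieForms 𝕜 𝔤 D) (LieForms 𝕜 𝔤 D) k := by
  refine SuperSym.perturbationSeries_mem _ _ _ _ _ (fun y hy => ?_) hx
  have := SuperSym.chevalleyEilenberg_mem_cohDegree (bracket 𝕜 𝔤 D) (bracket_skew 𝕜 𝔤 D)
    (hMap_mem_cohDegree ω hy)
  rwa [sub_add_cancel] at this

/-- The perturbation series intertwines the perturbed and the unperturbed differential. -/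
theorem pertSeries_differential (x : FactEnv 𝕜 𝔤 D) :
    pertSeries 𝔤 ω (differential 𝕜 𝔤 D x) = dDR 𝕜 𝔤 D (pertSeries 𝔤 ω x) := by
  set y := pertSeries 𝔤 ω x with hy
  have hx : x = y - dCE 𝕜 𝔤 D (hMap 𝔤 ω y) := eq_sub_of_add_eq (pertSeries_eq_add_left ω x).symm
  have hi : dCE 𝕜 𝔤 D (iMap 𝔤 ω (pMap 𝔤 D y)) = 0 :=
    dCE_of_mem_cohDegree_zero (iMap_mem_cohDegree ω _)
  have hd : dDR 𝕜 𝔤 D (hMap 𝔤 ω y) = iMap 𝔤 ω (pMap 𝔤 D y) - y - hMap 𝔤 ω (dDR 𝕜 𝔤 D y) :=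
    eq_sub_of_add_eq (dDR_hMap ω y)
  have e : differential 𝕜 𝔤 D x = dDR 𝕜 𝔤 D y - dCE 𝕜 𝔤 D (hMap 𝔤 ω (dDR 𝕜 𝔤 D y)) := by
    rw [hx]
    simp only [differential_apply, map_sub, dDR_dCE, dCE_dCE, hd, hi]
    abel
  rw [e, map_sub, sub_eq_iff_eq_add]
  exact pertSeries_eq_add_right ω _

theorem pertSeries_hMap (x : FactEnv 𝕜 𝔤 D) : pertSeries 𝔤 ω (hMap 𝔤 ω x) = hMap 𝔤 ω x :=
  pertSeries_of_eq_zero ω (by rw [hMap_hMap, map_zero])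

theorem pertSeries_iMap (a : SymmetricAlgebra 𝕜 𝔤) :
    pertSeries 𝔤 ω (iMap 𝔤 ω a) = iMap 𝔤 ω a :=
  pertSeries_of_eq_zero ω (by rw [hMap_iMap, map_zero])

theorem pHat_apply (x : FactEnv 𝕜 𝔤 D) : pHat 𝔤 ω x = pMap 𝔤 D (pertSeries 𝔤 ω x) := rfl

theorem hHat_apply (x : FactEnv 𝕜 𝔤 D) : hHat 𝔤 ω x = hMap 𝔤 ω (pertSeries 𝔤 ω x) := rfl

theorem pMap_dDR (x : FactEnv 𝕜 𝔤 D) : pMap 𝔤 D (dDR 𝕜 𝔤 D x) = 0 := by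
  induction x using SuperSym.induction_left with
  | one => rw [dDR, SuperSym.oddDer_one, map_zero]
  | add x y hx hy => simp only [map_add, hx, hy, add_zero]
  | smul c x hx => simp only [map_smul, hx, smul_zero]
  | gen_mul v x hx =>
    have h : ∀ o : LieForms 𝕜 𝔤 D, (integralForm D).lTensor 𝔤 ((deRham D).lTensor 𝔤 o) = 0 := by
      intro o
      rw [← LinearMap.comp_apply, ← LinearMap.lTensor_comp]
      have : integralForm D ∘ₗ deRham D = (0 : CptFun 𝕜 D →ₗ[𝕜] 𝕜) :=
        LinearMap.ext fun f => integral_deRham f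
      rw [this, LinearMap.lTensor_zero, LinearMap.zero_apply]
    rw [dDR] at hx ⊢
    rw [SuperSym.oddDer_gen_mul, map_add, map_mul, map_mul, hx, pMap_gen, LinearMap.neg_apply,
      map_neg, h]
    simp

variable (𝔤) in
/-- The homological perturbation lemma for the perturbation `d_CE` of `d_dR`. -/
theorem isStrongDeformationRetract : IsStrongDeformationRetract 𝔤 ω where
  d_degree _ _ hx := differential_mem_cohDegree hx
  d_d := differential_differential D
  i_degree := iMap_mem_cohDegree ω
  d_i a := differential_of_mem_cohDegree_zero (iMap_mem_cohDegree ω a)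
  p_degree k hk x hx :=
    SuperSym.algHom_eq_zero_of_mem_cohDegree (pMap 𝔤 D) pMap_gen_odd hk
      (pertSeries_mem_cohDegree ω hx)
  p_d x := by rw [pHat_apply, pertSeries_differential, pMap_dDR]
  p_i a := by rw [pHat_apply, pertSeries_iMap, pMap_iMap]
  h_degree k x hx := hMap_mem_cohDegree ω (pertSeries_mem_cohDegree ω hx)
  d_h x := by
    have h1 := dDR_hMap ω (pertSeries 𝔤 ω x)
    have h2 := eq_sub_of_add_eq' (pertSeries_eq_add_left ω x).symm
    rw [hHat_apply, hHat_apply, pHat_apply, pertSeries_differential, differential_apply,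
      add_right_comm, h1, h2]
    abel
  h_i a := by rw [hHat_apply, pertSeries_iMap, hMap_iMap]
  p_h x := by rw [pHat_apply, hHat_apply, pertSeries_hMap, pMap_hMap]
  h_h x := by
    rw [hHat_apply ω (hHat 𝔤 ω x), hHat_apply, pertSeries_hMap, hMap_hMap]

/-! ### The structure maps -/

theorem extend_lTensor_differential {D D' : Disk} (h : D.1 ≤ D'.1) (x : FactEnv 𝕜 𝔤 D) :
    differential 𝕜 𝔤 D' (SuperSym.map ((extend h).lTensor 𝔤) ((extend h).lTensor 𝔤) x) =
      SuperSym.map ((extend h).lTensor 𝔤) ((extend h).lTensor 𝔤) (differential 𝕜 𝔤 D x) := by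
  rw [differential_apply, differential_apply, map_add]
  congr 1
  · exact SuperSym.oddDer_map _ _ _ _ (deRham_extend h) x
  · exact SuperSym.chevalleyEilenberg_map _ _ (bracket_extend h) x

theorem differential_one (D : Disk) : differential 𝕜 𝔤 D 1 = 0 := by
  rw [differential_apply, dDR, dCE, SuperSym.oddDer_one, SuperSym.chevalleyEilenberg_one, add_zero]

/-- The elements of the factorization envelope of `D` whose bracket with the forms on a disk
`D₁ ⊆ D` vanishes. -/
def BracketsTrivially {D₁ D : Disk} (h₁ : D₁.1 ≤ D.1) (y : FactEnv 𝕜 𝔤 D) : Prop :=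
  ∀ m : LieForms 𝕜 𝔤 D₁,
    SuperSym.adEven (bracket 𝕜 𝔤 D) ((extend h₁).lTensor 𝔤 m) y = 0 ∧
    SuperSym.adOdd (bracket 𝕜 𝔤 D) ((extend h₁).lTensor 𝔤 m) y = 0

theorem BracketsTrivially.one {D₁ D : Disk} (h₁ : D₁.1 ≤ D.1) :
    BracketsTrivially h₁ (1 : FactEnv 𝕜 𝔤 D) :=
  fun _ => ⟨SuperSym.adEven_one _ _, SuperSym.adOdd_one _ _⟩

theorem BracketsTrivially.mul {D₁ D : Disk} {h₁ : D₁.1 ≤ D.1} {x y : FactEnv 𝕜 𝔤 D}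
    (hx : BracketsTrivially h₁ x) (hy : BracketsTrivially h₁ y) :
    BracketsTrivially h₁ (x * y) := fun m => by
  rw [(SuperSym.isOddDer_adEven _ _).leibniz, (SuperSym.isEvenDer_adOdd _ _).leibniz, (hx m).1,
    (hx m).2, (hy m).1, (hy m).2]
  simp

theorem BracketsTrivially.list_prod {D₁ D : Disk} {h₁ : D₁.1 ≤ D.1} {l : List (FactEnv 𝕜 𝔤 D)}
    (hl : ∀ x ∈ l, BracketsTrivially h₁ x) : BracketsTrivially h₁ l.prod := by
  induction l with
  | nil => exact .one h₁
  | cons x l ih =>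
    rw [List.prod_cons]
    exact (hl x (by simp)).mul (ih fun y hy => hl y (by simp [hy]))

theorem bracketsTrivially_extend {D₁ D₂ D : Disk} (h₁ : D₁.1 ≤ D.1) (h₂ : D₂.1 ≤ D.1)
    (h : Disjoint (D₁.1 : Set ℝ) (D₂.1 : Set ℝ)) (y : FactEnv 𝕜 𝔤 D₂) :
    BracketsTrivially h₁ (SuperSym.map ((extend h₂).lTensor 𝔤) ((extend h₂).lTensor 𝔤) y) := by
  intro m
  induction y using SuperSym.induction_left with
  | one => rw [map_one]; exact BracketsTrivially.one h₁ m
  | add x y hx hy => simp only [map_add, hx.1, hx.2, hy.1, hy.2, add_zero, and_self]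
  | smul c x hx => simp only [map_smul, hx.1, hx.2, smul_zero, and_self]
  | gen_mul v x hx =>
    rw [map_mul, SuperSym.map_gen, SuperSym.adEven_gen_mul, SuperSym.adOdd_gen_mul, hx.1, hx.2]
    simp [bracket_extend_disjoint h₁ h₂ h, SuperSym.gen_zero_zero]

/-- The Leibniz rule of the differential for factors that do not interact. -/
theorem differential_extend_mul {D₁ D : Disk} (h₁ : D₁.1 ≤ D.1) (x : FactEnv 𝕜 𝔤 D₁)
    {y : FactEnv 𝕜 𝔤 D} (hy : BracketsTrivially h₁ y) :
    differential 𝕜 𝔤 D (SuperSym.map ((extend h₁).lTensor 𝔤) ((extend h₁).lTensor 𝔤) x * y) =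
      differential 𝕜 𝔤 D (SuperSym.map ((extend h₁).lTensor 𝔤) ((extend h₁).lTensor 𝔤) x) * y +
        SuperSym.parity (SuperSym.map ((extend h₁).lTensor 𝔤) ((extend h₁).lTensor 𝔤) x) *
          differential 𝕜 𝔤 D y := by
  have h1 := (SuperSym.isOddDer_oddDer (-(deRham D).lTensor 𝔤)).leibniz
    (SuperSym.map ((extend h₁).lTensor 𝔤) ((extend h₁).lTensor 𝔤) x) y
  have h2 := SuperSym.chevalleyEilenberg_map_mul (bracket_skew 𝕜 𝔤 D) y
    (fun v : LieForms 𝕜 𝔤 D₁ × LieForms 𝕜 𝔤 D₁ => ⟨(hy v.1).1, (hy v.2).2⟩) x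
  simp only [differential_apply, add_mul, mul_add]
  rw [dDR, dCE, h1, h2]
  abel

variable {n : ℕ} {Ds : Fin n → Disk}

theorem structureMap_apply (h : IsOperation Ds D) (x : ∀ k, FactEnv 𝕜 𝔤 (Ds k)) :
    structureMap 𝔤 h x = (List.ofFn fun k =>
      SuperSym.map ((extend (h.1 k)).lTensor 𝔤) ((extend (h.1 k)).lTensor 𝔤) (x k)).prod := by
  rw [structureMap, MultilinearMap.compLinearMap_apply, MultilinearMap.mkPiAlgebraFin_apply]
  rfl

variable (𝕜 𝔤) in
theorem isCochainMap (h : IsOperation Ds D) : IsCochainMap (𝕜 := 𝕜) 𝔤 h := by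
  intro x
  rw [structureMap_apply, SuperSym.map_prod_ofFn_of_leibniz _ (differential_one D)]
  · refine Finset.sum_congr rfl fun k _ => ?_
    rw [structureMap_apply]
    congr 2
    funext l
    split_ifs
    · exact SuperSym.parity_map _ _ _
    · exact extend_lTensor_differential _ _
    · rfl
  · intro k
    refine differential_extend_mul (h.1 k) (x k) (BracketsTrivially.list_prod fun y hy => ?_)
    obtain ⟨i, hi, rfl⟩ := List.mem_iff_getElem.1 hy
    rw [List.getElem_drop, List.getElem_ofFn]
    refine bracketsTrivially_extend _ _ (h.2 fun hk => ?_) _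
    have := congrArg Fin.val hk
    simp only at this
    omega

end Envelope

end FactorizationEnvelope

/-! ### Polarization -/

section Polarization

variable {K : Type*} [Field K] [Infinite K]

/-- If the values of a polynomial with vector coefficients lie in a subspace, so do its
coefficients. -/
theorem Submodule.coeff_mem_of_forall_sum_pow_smul_mem {V : Type*} [AddCommGroup V] [Module K V]
    (W : Submodule K V) (n : ℕ) (c : ℕ → V)
    (h : ∀ t : K, ∑ i ∈ Finset.range n, t ^ i • c i ∈ W) {i : ℕ} (hi : i < n) : c i ∈ W := by
  rw [← Submodule.Quotient.mk_eq_zero, ← Module.forall_dual_apply_eq_zero_iff K]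
  intro φ
  set p : Polynomial K := ∑ i ∈ Finset.range n, Polynomial.monomial i (φ (W.mkQ (c i))) with hp
  have h0 : p = 0 := by
    refine Polynomial.funext fun t => ?_
    rw [hp, Polynomial.eval_finsetSum, Polynomial.eval_zero]
    have := congrArg φ ((Submodule.Quotient.mk_eq_zero W).2 (h t))
    rw [map_zero] at this
    rw [← this]
    change _ = φ (W.mkQ _)
    rw [map_sum, map_sum]
    refine Finset.sum_congr rfl fun i _ => ?_
    rw [Polynomial.eval_monomial, map_smul, map_smul, smul_eq_mul, mul_comm]
  have h1 : p.coeff i = φ (W.mkQ (c i)) := by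
    rw [hp, Polynomial.finsetSum_coeff]
    simp only [Polynomial.coeff_monomial]
    rw [Finset.sum_ite_eq' (Finset.range n) i, if_pos (Finset.mem_range.2 hi)]
  rw [h0, Polynomial.coeff_zero] at h1
  exact h1.symm

variable {A : Type*} [Ring A] [Algebra K A]

omit [Infinite K] in
theorem add_smul_pow_eq_sum (x y : A) (n : ℕ) : ∃ c : ℕ → A, c 0 = x ^ n ∧
    c 1 = ∑ i ∈ Finset.range n, x ^ i * y * x ^ (n - 1 - i) ∧ (∀ i, n < i → c i = 0) ∧
    ∀ t : K, (x + t • y) ^ n = ∑ i ∈ Finset.range (n + 1), t ^ i • c i := by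
  induction n with
  | zero => exact ⟨fun i => if i = 0 then 1 else 0, by simp, by simp, fun i hi => by simp; omega,
      fun t => by simp⟩
  | succ n ih =>
    obtain ⟨c, h0, h1, hz, hc⟩ := ih
    refine ⟨fun i => c i * x + (if i = 0 then 0 else c (i - 1)) * y, ?_, ?_, ?_, ?_⟩
    · simp [h0, pow_succ]
    · simp only [h0, h1, Nat.sub_self, one_ne_zero, if_false]
      rw [Finset.sum_range_succ, Finset.sum_mul]
      congr 1
      · refine Finset.sum_congr rfl fun i hi => ?_
        have : n + 1 - 1 - i = n - 1 - i + 1 := by have := Finset.mem_range.1 hi; omega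
        rw [this, pow_succ]
        simp only [mul_assoc]
      · simp
    · intro i hi
      have h2 : i ≠ 0 := by omega
      simp only [h2, if_false]
      rw [hz i (by omega), hz (i - 1) (by omega)]
      simp
    · intro t
      rw [pow_succ, hc t, mul_add, Finset.sum_mul, Finset.sum_mul]
      simp only [smul_add, Finset.sum_add_distrib]
      congr 1
      · rw [Finset.sum_range_succ (n := n + 1), hz (n + 1) (by omega)]
        simp
      · rw [Finset.sum_range_succ' (n := n + 1)]
        simp [pow_succ', smul_smul]

/-- Polarization: a subspace that contains the powers `(x + t y)^(n + 1)` contains their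
derivative at `t = 0`. -/
theorem Submodule.sum_pow_mul_mul_pow_mem (W : Submodule K A) (x y : A) (n : ℕ)
    (h : ∀ t : K, (x + t • y) ^ (n + 1) ∈ W) :
    ∑ i ∈ Finset.range (n + 1), x ^ i * y * x ^ (n - i) ∈ W := by
  obtain ⟨c, -, h1, -, hc⟩ := add_smul_pow_eq_sum (K := K) x y (n + 1)
  rw [Nat.add_sub_cancel] at h1
  rw [← h1]
  exact W.coeff_mem_of_forall_sum_pow_smul_mem (n + 1 + 1) c (fun t => hc t ▸ h t) (by omega)

/-- In characteristic zero the symmetric algebra is spanned by the powers of vectors. -/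
theorem SymmetricAlgebra.span_pow_eq_top [CharZero K] (V : Type*) [AddCommGroup V] [Module K V] :
    Submodule.span K {a | ∃ (X : V) (n : ℕ), SymmetricAlgebra.ι K V X ^ n = a} = ⊤ := by
  set W := Submodule.span K {a | ∃ (X : V) (n : ℕ), SymmetricAlgebra.ι K V X ^ n = a} with hW
  have key : ∀ a : SymmetricAlgebra K V, ∀ w ∈ W, w * a ∈ W := by
    intro a
    induction a using SymmetricAlgebra.induction with
    | algebraMap r =>
      intro w hw
      rw [mul_comm, ← Algebra.smul_def]
      exact W.smul_mem r hw
    | mul a b ha hb => intro w hw; rw [← mul_assoc]; exact hb _ (ha _ hw)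
    | add a b ha hb => intro w hw; rw [mul_add]; exact W.add_mem (ha _ hw) (hb _ hw)
    | ι Y =>
      intro w hw
      induction hw using Submodule.span_induction with
      | zero => simp
      | add p q _ _ hp hq => rw [add_mul]; exact W.add_mem hp hq
      | smul c p _ hp => rw [smul_mul_assoc]; exact W.smul_mem c hp
      | mem p hp =>
        obtain ⟨X, n, rfl⟩ := hp
        have h := W.sum_pow_mul_mul_pow_mem (SymmetricAlgebra.ι K V X) (SymmetricAlgebra.ι K V Y) n
          fun t => Submodule.subset_span ⟨X + t • Y, n + 1, by simp⟩
        have e : ∑ i ∈ Finset.range (n + 1), SymmetricAlgebra.ι K V X ^ i *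
            SymmetricAlgebra.ι K V Y * SymmetricAlgebra.ι K V X ^ (n - i) =
            ((n + 1 : ℕ) : K) • (SymmetricAlgebra.ι K V X ^ n * SymmetricAlgebra.ι K V Y) := by
          rw [Finset.sum_congr rfl (g := fun _ =>
            SymmetricAlgebra.ι K V X ^ n * SymmetricAlgebra.ι K V Y)]
          · rw [Finset.sum_const, Finset.card_range, Nat.cast_smul_eq_nsmul]
          · intro i hi
            have : n = i + (n - i) := by have := Finset.mem_range.1 hi; omega
            conv_rhs => rw [this, pow_add]
            ring
        rw [e] at h
        exact (Submodule.smul_mem_iff _ (Nat.cast_ne_zero.2 n.succ_ne_zero)).1 h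
  refine eq_top_iff.2 fun a _ => ?_
  rw [← one_mul a]
  exact key a 1 (Submodule.subset_span ⟨0, 0, by simp⟩)

theorem SymmetricAlgebra.linearMap_ext_pow [CharZero K] {V W : Type*} [AddCommGroup V] [Module K V]
    [AddCommGroup W] [Module K W] {f g : SymmetricAlgebra K V →ₗ[K] W}
    (h : ∀ (X : V) (n : ℕ), f (SymmetricAlgebra.ι K V X ^ n) = g (SymmetricAlgebra.ι K V X ^ n)) :
    f = g := by
  refine LinearMap.ext_on (SymmetricAlgebra.span_pow_eq_top V) ?_
  rintro _ ⟨X, n, rfl⟩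
  exact h X n

end Polarization

/-! ### Subalgebras of abelian forms -/

namespace SuperSym

section Adjoin

variable {K E O : Type*} [Field K] [AddCommGroup E] [Module K E] [AddCommGroup O] [Module K O]

theorem adjoin_gen_eq_span (S : Set (E × O)) :
    Subalgebra.toSubmodule (Algebra.adjoin K (gen '' S : Set (SuperSym K E O))) =
      Submodule.span K {x | ∃ l : List (E × O), (∀ v ∈ l, v ∈ S) ∧ (l.map gen).prod = x} := by
  rw [Algebra.adjoin_eq_span]
  congr 1
  ext x
  constructor
  · intro hx
    induction hx using Submonoid.closure_induction_left with
    | one => exact ⟨[], by simp, by simp⟩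
    | mul_left y hy x _ ih =>
      obtain ⟨v, hv, rfl⟩ := hy
      obtain ⟨l, hl, rfl⟩ := ih
      exact ⟨v :: l, by simpa [hv] using hl, by simp⟩
  · rintro ⟨l, hl, rfl⟩
    refine Submonoid.list_prod_mem _ fun x hx => ?_
    obtain ⟨v, hv, rfl⟩ := List.mem_map.1 hx
    exact Submonoid.subset_closure ⟨v, hl v hv, rfl⟩

/-- The symmetrized homotopy preserves the subalgebra generated by a graded subspace that `h` and
`q` preserve. -/
theorem symHomotopy_mem_adjoin {h q : E × O →ₗ[K] E × O} {S : Submodule K (E × O)}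
    (hh : ∀ v ∈ S, h v ∈ S) (hq : ∀ v ∈ S, q v ∈ S) (hS : ∀ b, ∀ v ∈ S, homPart K b v ∈ S)
    {x : SuperSym K E O} (hx : x ∈ Algebra.adjoin K (gen '' S : Set (SuperSym K E O))) :
    symHomotopy h q x ∈ Algebra.adjoin K (gen '' S : Set (SuperSym K E O)) := by
  rw [← Subalgebra.mem_toSubmodule, adjoin_gen_eq_span] at hx
  induction hx using Submodule.span_induction with
  | zero => rw [map_zero]; exact Subalgebra.zero_mem _
  | add x y _ _ hx hy => rw [map_add]; exact Subalgebra.add_mem _ hx hy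
  | smul c x _ hx => rw [map_smul]; exact Subalgebra.smul_mem _ hx c
  | mem x hx =>
    obtain ⟨l, hl, rfl⟩ := hx
    have e : (l.map (gen : E × O →ₗ[K] SuperSym K E O)).prod =
        (List.ofFn fun i => (gen (l.get i) : SuperSym K E O)).prod := by
      congr 1
      conv_lhs => rw [← List.ofFn_get l, List.map_ofFn]
      rfl
    have hpar : ∀ v ∈ S, (v.1, -v.2) ∈ S := by
      intro v hv
      have : (v.1, -v.2) = homPart K false v - homPart K true v := by
        simp [homPart]
      rw [this]
      exact S.sub_mem (hS _ v hv) (hS _ v hv)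
    rw [e, symHomotopy, symLift_prod, gradedSymm_apply]
    refine Subalgebra.smul_mem _ (Subalgebra.sum_mem _ fun σ _ => Subalgebra.sum_mem _ fun ε _ =>
      Subalgebra.smul_mem _ ?_ _) _
    rw [sum_apply]
    refine Subalgebra.sum_mem _ fun j _ => ?_
    rw [MultilinearMap.compLinearMap_apply, MultilinearMap.mkPiAlgebraFin_apply]
    refine Subalgebra.list_prod_mem _ fun x hx => ?_
    rw [List.mem_ofFn] at hx
    obtain ⟨k, rfl⟩ := hx
    have hk := hS (ε (σ k)) _ (hl _ (List.get_mem l (σ k)))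
    refine Algebra.subset_adjoin ?_
    split_ifs
    · exact ⟨_, hpar _ hk, rfl⟩
    · exact ⟨_, hh _ hk, rfl⟩
    · exact ⟨_, hq _ hk, rfl⟩

variable {M : Type*} [AddCommGroup M] [Module K M] {β : M →ₗ[K] M →ₗ[K] M}

/-- The Chevalley-Eilenberg differential vanishes on the subalgebra generated by an abelian
subspace. -/
theorem chevalleyEilenberg_of_mem_adjoin (hβ : ∀ x y, β x y = -β y x) {S : Submodule K M}
    (hS : ∀ a ∈ S, ∀ b ∈ S, β a b = 0) {x : SuperSym K M M}
    (hx : x ∈ Algebra.adjoin K (gen '' (S.prod S) : Set (SuperSym K M M))) :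
    chevalleyEilenberg β hβ x = 0 := by
  rw [← Subalgebra.mem_toSubmodule, adjoin_gen_eq_span] at hx
  induction hx using Submodule.span_induction with
  | zero => exact map_zero _
  | add x y _ _ hx hy => rw [map_add, hx, hy, add_zero]
  | smul c x _ hx => rw [map_smul, hx, smul_zero]
  | mem x hx =>
    obtain ⟨l, hl, rfl⟩ := hx
    have had : ∀ v ∈ S.prod S, ∀ l : List (M × M), (∀ w ∈ l, w ∈ S.prod S) →
        adGen β v (l.map gen).prod = 0 := by
      intro v hv l hl
      rw [adGen_apply]
      have : adEven β v.1 (l.map gen).prod = 0 ∧ adOdd β v.2 (l.map gen).prod = 0 := by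
        induction l with
        | nil => exact ⟨adEven_one β _, adOdd_one β _⟩
        | cons w l ih =>
          have ih' := ih fun z hz => hl z (by simp [hz])
          have hw := hl w (by simp)
          rw [List.map_cons, List.prod_cons, adEven_gen_mul, adOdd_gen_mul, ih'.1, ih'.2,
            hS _ hv.1 _ hw.2, hS _ hv.2 _ hw.1, hS _ hv.2 _ hw.2]
          simp [gen_zero_zero]
      rw [this.1, this.2, add_zero]
    induction l with
    | nil => exact chevalleyEilenberg_one β hβ
    | cons v l ih =>
      have hl' : ∀ w ∈ l, w ∈ S.prod S := fun z hz => hl z (by simp [hz])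
      rw [List.map_cons, List.prod_cons, chevalleyEilenberg_gen_mul, ih hl', mul_zero, add_zero,
        had v (hl v (by simp)) l hl']

end Adjoin

end SuperSym

namespace FactorizationEnvelope

section Abelian

variable {𝕜 : Type*} [RCLike 𝕜] {𝔤 : Type*} [LieRing 𝔤] [LieAlgebra 𝕜 𝔤] {D : Disk}

variable (𝕜) in
/-- The subalgebra of the factorization envelope generated by the forms with values in the line
spanned by `X`. -/
noncomputable def lineSubalgebra (D : Disk) (X : 𝔤) : Subalgebra 𝕜 (FactEnv 𝕜 𝔤 D) :=
  Algebra.adjoin 𝕜 (SuperSym.gen ''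
    ((LinearMap.range (TensorProduct.mk 𝕜 𝔤 (CptFun 𝕜 D) X)).prod
      (LinearMap.range (TensorProduct.mk 𝕜 𝔤 (CptFun 𝕜 D) X)) : Set _))

theorem gen_mem_lineSubalgebra (X : 𝔤) (f : CptFun 𝕜 D) :
    SuperSym.gen (X ⊗ₜ f, 0) ∈ lineSubalgebra 𝕜 D X :=
  Algebra.subset_adjoin ⟨_, ⟨⟨f, rfl⟩, ⟨0, by simp⟩⟩, rfl⟩

variable (ω : UnitForm 𝕜 D)

/-- The perturbation vanishes on forms with values in a line of `𝔤`. -/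
theorem pHat_of_mem_lineSubalgebra (X : 𝔤) {x : FactEnv 𝕜 𝔤 D} (hx : x ∈ lineSubalgebra 𝕜 D X) :
    pHat 𝔤 ω x = pMap 𝔤 D x := by
  rw [pHat_apply, pertSeries_of_eq_zero]
  refine SuperSym.chevalleyEilenberg_of_mem_adjoin _
    (S := LinearMap.range (TensorProduct.mk 𝕜 𝔤 (CptFun 𝕜 D) X)) ?_
    (SuperSym.symHomotopy_mem_adjoin ?_ ?_ ?_ hx)
  · rintro _ ⟨f, rfl⟩ _ ⟨g, rfl⟩
    simp [bracket_tmul]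
  · rintro ⟨_, _⟩ ⟨⟨f, rfl⟩, -⟩
    exact ⟨⟨0, by simp [homotopyGen]⟩, ⟨homotopyForm ω f, by simp [homotopyGen]⟩⟩
  · rintro ⟨_, _⟩ ⟨⟨f, rfl⟩, -⟩
    exact ⟨⟨integralForm D f • ω.1, by simp [projGen]⟩, ⟨0, by simp [projGen]⟩⟩
  · rintro b ⟨_, _⟩ ⟨hf, hg⟩
    cases b
    · exact ⟨by simpa [SuperSym.homPart] using hf, by simp [SuperSym.homPart]⟩
    · exact ⟨by simp [SuperSym.homPart], by simpa [SuperSym.homPart] using hg⟩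

/-- The perturbed projection splits the inclusions for all choices of the unit form. -/
theorem pHat_iMap (ω' : UnitForm 𝕜 D) (a : SymmetricAlgebra 𝕜 𝔤) :
    pHat 𝔤 ω (iMap 𝔤 ω' a) = a := by
  have : pHat 𝔤 ω ∘ₗ (iMap 𝔤 ω').toLinearMap = LinearMap.id := by
    refine SymmetricAlgebra.linearMap_ext_pow fun X n => ?_
    rw [LinearMap.comp_apply, AlgHom.toLinearMap_apply, pHat_of_mem_lineSubalgebra ω X, pMap_iMap,
      LinearMap.id_apply]
    rw [map_pow, iMap_ι]
    exact Subalgebra.pow_mem _ (gen_mem_lineSubalgebra X _) n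
  exact LinearMap.congr_fun this a

end Abelian

end FactorizationEnvelope

/-! ### Disks and local elements -/

namespace FactorizationEnvelope

/-- The disk `ℝ`. -/
def lineDisk : Disk := ⟨⊤, isConnected_univ⟩

/-- The disk `(-∞, s)`. -/
def leftDisk (s : ℝ) : Disk := ⟨⟨Set.Iio s, isOpen_Iio⟩, isConnected_Iio⟩

/-- The disk `(s, ∞)`. -/
def rightDisk (s : ℝ) : Disk := ⟨⟨Set.Ioi s, isOpen_Ioi⟩, isConnected_Ioi⟩

theorem le_lineDisk (D : Disk) : D.1 ≤ lineDisk.1 := fun _ _ => trivial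

theorem disjoint_leftDisk_rightDisk (s : ℝ) :
    Disjoint ((leftDisk s).1 : Set ℝ) ((rightDisk s).1 : Set ℝ) :=
  Set.disjoint_left.2 fun _ (h : _ < s) (h' : s < _) => lt_asymm h h'

theorem leftDisk_le {s t : ℝ} (h : s ≤ t) : (leftDisk s).1 ≤ (leftDisk t).1 :=
  fun _ (hx : _ < s) => hx.trans_le h

theorem rightDisk_le {s t : ℝ} (h : s ≤ t) : (rightDisk t).1 ≤ (rightDisk s).1 :=
  fun _ (hx : t < _) => h.trans_lt hx

/-- Two disks in order are separated by a point. -/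
theorem Disk.LeftOf.exists_separating {D D' : Disk} (h : Disk.LeftOf D D') :
    ∃ s, D.1 ≤ (leftDisk s).1 ∧ ∀ D'' : Disk, Disk.LeftOf D D'' → D''.1 ≤ (rightDisk s).1 := by
  obtain ⟨c, hc⟩ := D.2.nonempty
  obtain ⟨c', hc'⟩ := D'.2.nonempty
  have hb : BddAbove (D.1 : Set ℝ) := ⟨c', fun x hx => (h x hx c' hc').le⟩
  refine ⟨sSup D.1, fun x hx => ?_, fun D'' h'' y hy => ?_⟩
  · obtain ⟨y, hy, hxy⟩ := (Filter.Eventually.and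
      (mem_nhdsWithin_of_mem_nhds (D.1.isOpen.mem_nhds hx)) self_mem_nhdsWithin :
        ∀ᶠ y in nhdsWithin x (Set.Ioi x), y ∈ (D.1 : Set ℝ) ∧ x < y).exists
    exact hxy.trans_le (le_csSup hb hy)
  · obtain ⟨z, hz, hzy⟩ := (Filter.Eventually.and
      (mem_nhdsWithin_of_mem_nhds (D''.1.isOpen.mem_nhds hy)) self_mem_nhdsWithin :
        ∀ᶠ z in nhdsWithin y (Set.Iio y), z ∈ (D''.1 : Set ℝ) ∧ z < y).exists
    exact (csSup_le ⟨c, hc⟩ fun x hx => (h'' x hx z hz).le).trans_lt hzy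

theorem Disk.leftOf_of_disjoint {D D' : Disk} (h : Disjoint (D.1 : Set ℝ) (D'.1 : Set ℝ))
    {c c' : ℝ} (hc : c ∈ D.1) (hc' : c' ∈ D'.1) (hcc : c ≤ c') : Disk.LeftOf D D' := by
  intro x hx y hy
  by_contra hxy
  rw [not_lt] at hxy
  rcases le_total y c with hyc | hyc
  · exact Set.disjoint_left.1 h hc (D'.2.isPreconnected.ordConnected.out hy hc' ⟨hyc, hcc⟩)
  · exact Set.disjoint_left.1 h (D.2.isPreconnected.ordConnected.out hc hx ⟨hyc, hxy⟩) hy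

theorem exists_perm_leftOf {n : ℕ} {Ds : Fin n → Disk}
    (h : Pairwise fun k l => Disjoint ((Ds k).1 : Set ℝ) ((Ds l).1 : Set ℝ)) :
    ∃ σ : Equiv.Perm (Fin n), ∀ k l, k < l → Disk.LeftOf (Ds (σ k)) (Ds (σ l)) := by
  choose c hc using fun k => (Ds k).2.nonempty
  refine ⟨Tuple.sort c, fun k l hkl => ?_⟩
  exact Disk.leftOf_of_disjoint (h ((Tuple.sort c).injective.ne hkl.ne)) (hc _) (hc _)
    (Tuple.monotone_sort c hkl.le)

section Star

variable {𝕜 : Type*} [RCLike 𝕜] {𝔤 : Type*} [LieRing 𝔤] [LieAlgebra 𝕜 𝔤]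

variable (𝕜 𝔤) in
/-- The structure map of the inclusion of a disk into `ℝ`. -/
noncomputable def toLine (D : Disk) : FactEnv 𝕜 𝔤 D →ₐ[𝕜] FactEnv 𝕜 𝔤 lineDisk :=
  SuperSym.map ((extend (le_lineDisk D)).lTensor 𝔤) ((extend (le_lineDisk D)).lTensor 𝔤)

/-- A unit form on a disk as a unit form on `ℝ`. -/
noncomputable def UnitForm.toLine {D : Disk} (ω : UnitForm 𝕜 D) : UnitForm 𝕜 lineDisk :=
  ⟨extend (le_lineDisk D) ω.1, ω.2⟩

theorem toLine_iMap {D : Disk} (ω : UnitForm 𝕜 D) (a : SymmetricAlgebra 𝕜 𝔤) :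
    toLine 𝕜 𝔤 D (iMap 𝔤 ω a) = iMap 𝔤 ω.toLine a := by
  induction a using SymmetricAlgebra.induction with
  | algebraMap r => simp only [AlgHom.commutes]
  | ι X =>
    rw [iMap_ι, iMap_ι, toLine, SuperSym.map_gen, map_zero]
    rfl
  | mul a b ha hb => rw [map_mul, map_mul, map_mul, ha, hb]
  | add a b ha hb => rw [map_add, map_add, map_add, ha, hb]

theorem toLine_extend {D D' : Disk} (h : D.1 ≤ D'.1) (x : FactEnv 𝕜 𝔤 D) :
    toLine 𝕜 𝔤 D' (SuperSym.map ((extend h).lTensor 𝔤) ((extend h).lTensor 𝔤) x) =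
      toLine 𝕜 𝔤 D x := by
  rw [toLine, SuperSym.map_map, ← LinearMap.lTensor_comp]
  rfl

theorem differential_toLine (D : Disk) (x : FactEnv 𝕜 𝔤 D) :
    differential 𝕜 𝔤 lineDisk (toLine 𝕜 𝔤 D x) = toLine 𝕜 𝔤 D (differential 𝕜 𝔤 D x) :=
  extend_lTensor_differential (le_lineDisk D) x

/-- For an element of degree zero, `i p̂ x` and `x` are cohomologous. -/
theorem differential_hHat {D : Disk} (ω : UnitForm 𝕜 D) {x : FactEnv 𝕜 𝔤 D}
    (hx : x ∈ SuperSym.cohDegree 𝕜 (LieForms 𝕜 𝔤 D) (LieForms 𝕜 𝔤 D) 0) :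
    differential 𝕜 𝔤 D (hHat 𝔤 ω x) = iMap 𝔤 ω (pHat 𝔤 ω x) - x := by
  have := (isStrongDeformationRetract 𝔤 ω).d_h x
  rwa [differential_of_mem_cohDegree_zero hx, map_zero, add_zero] at this

/-- The perturbed projections are compatible with the inclusions of disks into `ℝ`. -/
theorem pHat_toLine {D : Disk} (ω : UnitForm 𝕜 D) (ω' : UnitForm 𝕜 lineDisk) {x : FactEnv 𝕜 𝔤 D}
    (hx : x ∈ SuperSym.cohDegree 𝕜 (LieForms 𝕜 𝔤 D) (LieForms 𝕜 𝔤 D) 0) :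
    pHat 𝔤 ω' (toLine 𝕜 𝔤 D x) = pHat 𝔤 ω x := by
  have h := congrArg (fun y => pHat 𝔤 ω' (toLine 𝕜 𝔤 D y)) (differential_hHat ω hx)
  simp only [← differential_toLine] at h
  rw [(isStrongDeformationRetract 𝔤 ω').p_d, map_sub, map_sub] at h
  rw [← sub_eq_zero.1 h.symm, toLine_iMap, pHat_iMap]

/-- The elements of degree zero on `ℝ` that come from the disk `D`. -/
def IsLocal (D : Disk) (u : FactEnv 𝕜 𝔤 lineDisk) : Prop :=
  ∃ x ∈ SuperSym.cohDegree 𝕜 (LieForms 𝕜 𝔤 D) (LieForms 𝕜 𝔤 D) 0, toLine 𝕜 𝔤 D x = u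

theorem IsLocal.mem_cohDegree {D : Disk} {u : FactEnv 𝕜 𝔤 lineDisk} (hu : IsLocal D u) :
    u ∈ SuperSym.cohDegree 𝕜 (LieForms 𝕜 𝔤 lineDisk) (LieForms 𝕜 𝔤 lineDisk) 0 := by
  obtain ⟨x, hx, rfl⟩ := hu
  exact SuperSym.map_mem_cohDegree _ _ hx

theorem IsLocal.one (D : Disk) : IsLocal D (1 : FactEnv 𝕜 𝔤 lineDisk) :=
  ⟨1, SuperSym.one_mem_cohDegree, map_one _⟩

theorem IsLocal.mul {D : Disk} {u v : FactEnv 𝕜 𝔤 lineDisk} (hu : IsLocal D u)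
    (hv : IsLocal D v) : IsLocal D (u * v) := by
  obtain ⟨x, hx, rfl⟩ := hu
  obtain ⟨y, hy, rfl⟩ := hv
  exact ⟨x * y, by simpa using SuperSym.mul_mem_cohDegree hx hy, map_mul _ _ _⟩

theorem IsLocal.mono {D D' : Disk} (h : D.1 ≤ D'.1) {u : FactEnv 𝕜 𝔤 lineDisk}
    (hu : IsLocal D u) : IsLocal D' u := by
  obtain ⟨x, hx, rfl⟩ := hu
  exact ⟨_, SuperSym.map_mem_cohDegree _ _ hx, toLine_extend h x⟩

theorem IsLocal.list_prod {D : Disk} {l : List (FactEnv 𝕜 𝔤 lineDisk)}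
    (hl : ∀ u ∈ l, IsLocal D u) : IsLocal D l.prod := by
  induction l with
  | nil => exact .one D
  | cons u l ih =>
    rw [List.prod_cons]
    exact (hl u (by simp)).mul (ih fun v hv => hl v (by simp [hv]))

theorem isLocal_iMap {D : Disk} (ω : UnitForm 𝕜 D) (a : SymmetricAlgebra 𝕜 𝔤) :
    IsLocal D (iMap 𝔤 ω.toLine a) :=
  ⟨_, iMap_mem_cohDegree ω a, toLine_iMap ω a⟩

/-! ### The star product -/

variable (𝕜) in
/-- A choice of unit forms. -/
noncomputable def someUnitForm (D : Disk) : UnitForm 𝕜 D := (nonempty_unitForm 𝕜 D).some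

variable (𝕜 𝔤) in
/-- The perturbed projection on `ℝ`. On elements of degree zero it depends on the cohomology class
only, and not on the unit form. -/
noncomputable def linePHat : FactEnv 𝕜 𝔤 lineDisk →ₗ[𝕜] SymmetricAlgebra 𝕜 𝔤 :=
  pHat 𝔤 (someUnitForm 𝕜 lineDisk)

theorem linePHat_toLine {D : Disk} (ω : UnitForm 𝕜 D) {x : FactEnv 𝕜 𝔤 D}
    (hx : x ∈ SuperSym.cohDegree 𝕜 (LieForms 𝕜 𝔤 D) (LieForms 𝕜 𝔤 D) 0) :
    linePHat 𝕜 𝔤 (toLine 𝕜 𝔤 D x) = pHat 𝔤 ω x :=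
  pHat_toLine ω _ hx

theorem linePHat_iMap (ω : UnitForm 𝕜 lineDisk) (a : SymmetricAlgebra 𝕜 𝔤) :
    linePHat 𝕜 𝔤 (iMap 𝔤 ω a) = a :=
  pHat_iMap _ ω a

/-- In a product of elements from disjoint disks, a factor can be replaced by any factor from the
same disk with the same projection, because the two are cohomologous there. -/
theorem linePHat_mul_congr {D₁ D₂ : Disk} (h : Disjoint (D₁.1 : Set ℝ) (D₂.1 : Set ℝ))
    {u u' z : FactEnv 𝕜 𝔤 lineDisk} (hu : IsLocal D₁ u) (hu' : IsLocal D₁ u') (hz : IsLocal D₂ z)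
    (huu : linePHat 𝕜 𝔤 u = linePHat 𝕜 𝔤 u') : linePHat 𝕜 𝔤 (u * z) = linePHat 𝕜 𝔤 (u' * z) := by
  obtain ⟨x, hx, rfl⟩ := hu
  obtain ⟨x', hx', rfl⟩ := hu'
  set ω := someUnitForm 𝕜 D₁
  rw [linePHat_toLine ω hx, linePHat_toLine ω hx'] at huu
  have hd : x - x' = differential 𝕜 𝔤 D₁ (hHat 𝔤 ω x' - hHat 𝔤 ω x) := by
    rw [map_sub, differential_hHat ω hx, differential_hHat ω hx', huu]
    abel
  have hbr : BracketsTrivially (le_lineDisk D₁) z := by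
    obtain ⟨y, -, rfl⟩ := hz
    exact bracketsTrivially_extend _ _ h y
  have key : differential 𝕜 𝔤 lineDisk (toLine 𝕜 𝔤 D₁ (hHat 𝔤 ω x' - hHat 𝔤 ω x) * z) = _ :=
    differential_extend_mul _ (hHat 𝔤 ω x' - hHat 𝔤 ω x) hbr
  rw [differential_of_mem_cohDegree_zero hz.mem_cohDegree, mul_zero, add_zero] at key
  have key' := key.trans (congrArg (· * z) (differential_toLine D₁ _))
  rw [← hd] at key'
  have h0 := (isStrongDeformationRetract 𝔤 (someUnitForm 𝕜 lineDisk)).p_d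
    (toLine 𝕜 𝔤 D₁ (hHat 𝔤 ω x' - hHat 𝔤 ω x) * z)
  rw [key', map_sub, sub_mul, map_sub] at h0
  exact sub_eq_zero.1 h0

variable (𝕜 𝔤) in
/-- The star product: the projection of a product of two elements, the first one from `(-∞, 0)` and
the second one from `(0, ∞)`. -/
noncomputable def star :
    SymmetricAlgebra 𝕜 𝔤 →ₗ[𝕜] SymmetricAlgebra 𝕜 𝔤 →ₗ[𝕜] SymmetricAlgebra 𝕜 𝔤 :=
  ((LinearMap.mul 𝕜 (FactEnv 𝕜 𝔤 lineDisk)).compl₁₂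
    (iMap 𝔤 (someUnitForm 𝕜 (leftDisk 0)).toLine).toLinearMap
    (iMap 𝔤 (someUnitForm 𝕜 (rightDisk 0)).toLine).toLinearMap).compr₂ (linePHat 𝕜 𝔤)

theorem star_apply (a b : SymmetricAlgebra 𝕜 𝔤) :
    star 𝕜 𝔤 a b = linePHat 𝕜 𝔤 (iMap 𝔤 (someUnitForm 𝕜 (leftDisk 0)).toLine a *
      iMap 𝔤 (someUnitForm 𝕜 (rightDisk 0)).toLine b) := rfl

/-- The projection of a product of two elements that are separated by a point. -/
theorem linePHat_mul {s : ℝ} {u v : FactEnv 𝕜 𝔤 lineDisk} (hu : IsLocal (leftDisk s) u)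
    (hv : IsLocal (rightDisk s) v) :
    linePHat 𝕜 𝔤 (u * v) = star 𝕜 𝔤 (linePHat 𝕜 𝔤 u) (linePHat 𝕜 𝔤 v) := by
  rw [star_apply]
  set u₀ := iMap 𝔤 (someUnitForm 𝕜 (leftDisk 0)).toLine (linePHat 𝕜 𝔤 u)
  set v₀ := iMap 𝔤 (someUnitForm 𝕜 (rightDisk 0)).toLine (linePHat 𝕜 𝔤 v)
  have hu₀ : IsLocal (leftDisk 0) u₀ := isLocal_iMap _ _
  have hv₀ : IsLocal (rightDisk 0) v₀ := isLocal_iMap _ _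
  have eu : linePHat 𝕜 𝔤 u = linePHat 𝕜 𝔤 u₀ := (linePHat_iMap _ _).symm
  have ev : linePHat 𝕜 𝔤 v = linePHat 𝕜 𝔤 v₀ := (linePHat_iMap _ _).symm
  have comm : ∀ {x : FactEnv 𝕜 𝔤 lineDisk} {t : ℝ}, IsLocal (leftDisk t) x →
      ∀ y, x * y = y * x := fun hx y => SuperSym.commute_of_mem_cohDegree_zero hx.mem_cohDegree y
  rcases le_total 0 s with hs | hs
  · rw [linePHat_mul_congr (disjoint_leftDisk_rightDisk s) hu (hu₀.mono (leftDisk_le hs)) hv eu,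
      comm hu₀, comm hu₀]
    exact linePHat_mul_congr (disjoint_leftDisk_rightDisk 0).symm (hv.mono (rightDisk_le hs)) hv₀
      hu₀ ev
  · rw [comm hu, linePHat_mul_congr (disjoint_leftDisk_rightDisk s).symm hv
      (hv₀.mono (rightDisk_le hs)) hu ev, ← comm hu]
    exact linePHat_mul_congr (disjoint_leftDisk_rightDisk 0) (hu.mono (leftDisk_le hs)) hu₀ hv₀ eu

theorem one_star (a : SymmetricAlgebra 𝕜 𝔤) : star 𝕜 𝔤 1 a = a := by
  rw [star_apply, map_one, one_mul, linePHat_iMap]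

theorem star_one (a : SymmetricAlgebra 𝕜 𝔤) : star 𝕜 𝔤 a 1 = a := by
  rw [star_apply, map_one, mul_one, linePHat_iMap]

theorem linePHat_one : linePHat 𝕜 𝔤 1 = 1 := by
  have := linePHat_iMap (𝔤 := 𝔤) (someUnitForm 𝕜 lineDisk) 1
  rwa [map_one] at this

/-- Associativity holds since a product of three elements on disks `D₁ < D₂ < D₃` can be split
before or after the second one. -/
theorem star_assoc (a b c : SymmetricAlgebra 𝕜 𝔤) :
    star 𝕜 𝔤 (star 𝕜 𝔤 a b) c = star 𝕜 𝔤 a (star 𝕜 𝔤 b c) := by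
  let D : Disk := ⟨⟨Set.Ioo 0 1, isOpen_Ioo⟩, isConnected_Ioo zero_lt_one⟩
  have hD0 : D.1 ≤ (rightDisk 0).1 := fun _ h => h.1
  have hD1 : D.1 ≤ (leftDisk 1).1 := fun _ h => h.2
  set u := iMap 𝔤 (someUnitForm 𝕜 (leftDisk 0)).toLine a
  set v := iMap 𝔤 (someUnitForm 𝕜 D).toLine b
  set w := iMap 𝔤 (someUnitForm 𝕜 (rightDisk 1)).toLine c
  have hu : IsLocal (leftDisk 0) u := isLocal_iMap _ _
  have hv : IsLocal D v := isLocal_iMap _ _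
  have hw : IsLocal (rightDisk 1) w := isLocal_iMap _ _
  have hw0 := hw.mono (rightDisk_le zero_le_one)
  have hu1 := hu.mono (leftDisk_le zero_le_one)
  have h1 := linePHat_mul (hu1.mul (hv.mono hD1)) hw
  have h2 := linePHat_mul hu ((hv.mono hD0).mul hw0)
  rw [linePHat_mul hu (hv.mono hD0), mul_assoc, h2, linePHat_mul (hv.mono hD1) hw,
    linePHat_iMap, linePHat_iMap, linePHat_iMap] at h1
  exact h1.symm

/-- The projection of a product of elements on disks in increasing order. -/
theorem linePHat_list_prod (l : List (Disk × FactEnv 𝕜 𝔤 lineDisk))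
    (hl : ∀ p ∈ l, IsLocal p.1 p.2) (hs : l.Pairwise fun p p' => Disk.LeftOf p.1 p'.1) :
    linePHat 𝕜 𝔤 (l.map Prod.snd).prod =
      (l.map fun p => linePHat 𝕜 𝔤 p.2).foldr (fun b c => star 𝕜 𝔤 b c) 1 := by
  induction l with
  | nil => exact linePHat_one
  | cons p l ih =>
    rw [List.pairwise_cons] at hs
    have ih' := ih (fun p' hp' => hl p' (by simp [hp'])) hs.2
    rw [List.map_cons, List.prod_cons, List.map_cons, List.foldr_cons, ← ih']
    cases l with
    | nil => simp [linePHat_one, star_one]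
    | cons p' l =>
      obtain ⟨s, hs1, hs2⟩ := (hs.1 p' (by simp)).exists_separating
      refine linePHat_mul ((hl p (by simp)).mono hs1) (IsLocal.list_prod fun u hu => ?_)
      obtain ⟨p'', hp'', rfl⟩ := List.mem_map.1 hu
      exact (hl p'' (by simp only [List.mem_cons] at hp'' ⊢; tauto)).mono (hs2 _ (hs.1 p'' hp''))

variable {n : ℕ} {Ds : Fin n → Disk} {D : Disk}

/-- The transferred structure maps are the star products in the order of the disks. -/
theorem transferred_eq_foldr (ω : ∀ D : Disk, UnitForm 𝕜 D) (h : IsOperation Ds D)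
    (σ : Equiv.Perm (Fin n)) (hσ : ∀ k l, k < l → Disk.LeftOf (Ds (σ k)) (Ds (σ l)))
    (a : Fin n → SymmetricAlgebra 𝕜 𝔤) :
    transferred 𝔤 ω h a =
      (List.ofFn fun k => a (σ k)).foldr (fun b c => star 𝕜 𝔤 b c) 1 := by
  set u : Fin n → FactEnv 𝕜 𝔤 lineDisk := fun k => iMap 𝔤 (ω (Ds k)).toLine (a k) with hu
  have hloc : ∀ k, IsLocal (Ds k) (u k) := fun k => isLocal_iMap _ _
  set x := structureMap 𝔤 h fun k => iMap 𝔤 (ω (Ds k)) (a k) with hx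
  have hx0 : x ∈ SuperSym.cohDegree 𝕜 (LieForms 𝕜 𝔤 D) (LieForms 𝕜 𝔤 D) 0 := by
    rw [hx, structureMap_apply]
    refine List.prod_induction (· ∈ SuperSym.cohDegree 𝕜 (LieForms 𝕜 𝔤 D) (LieForms 𝕜 𝔤 D) 0)
      (fun x y hx hy => by simpa using SuperSym.mul_mem_cohDegree hx hy)
      SuperSym.one_mem_cohDegree fun y hy => ?_
    obtain ⟨k, rfl⟩ := (List.mem_ofFn' _ _).1 hy
    exact SuperSym.map_mem_cohDegree _ _ (iMap_mem_cohDegree _ _)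
  have hxu : toLine 𝕜 𝔤 D x = (List.ofFn u).prod := by
    rw [hx, structureMap_apply, map_list_prod, List.map_ofFn]
    congr 2
    funext k
    simp only [Function.comp, hu]
    rw [toLine_extend, toLine_iMap]
  have hperm : (List.ofFn u).prod = (List.ofFn fun k => u (σ k)).prod := by
    refine ((Equiv.Perm.ofFn_comp_perm σ u).prod_eq' ?_).symm
    refine List.pairwise_of_forall_mem_list fun y hy z _ => ?_
    obtain ⟨k, rfl⟩ := (List.mem_ofFn' _ _).1 hy
    exact SuperSym.commute_of_mem_cohDegree_zero (hloc _).mem_cohDegree _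
  have key := linePHat_list_prod (List.ofFn fun k => (Ds (σ k), u (σ k)))
    (fun p hp => by
      obtain ⟨k, rfl⟩ := (List.mem_ofFn' _ _).1 hp
      exact hloc _)
    (by
      rw [List.pairwise_ofFn]
      exact fun k l hkl => hσ k l hkl)
  rw [List.map_ofFn, List.map_ofFn] at key
  change pHat 𝔤 (ω D) x = _
  rw [← linePHat_toLine (ω D) hx0, hxu, hperm]
  refine key.trans ?_
  congr 2
  funext k
  exact linePHat_iMap _ _

end Star

end FactorizationEnvelope

/-! ### The universal enveloping algebra -/

section EnvelopingAlgebra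

attribute [local instance] LieRing.ofAssociativeRing

namespace UniversalEnvelopingAlgebra

section Spanning

variable {K L : Type*} [Field K] [LieRing L] [LieAlgebra K L]

theorem induction {P : UniversalEnvelopingAlgebra K L → Prop}
    (algebraMap : ∀ r, P (algebraMap K (UniversalEnvelopingAlgebra K L) r))
    (ι : ∀ X, P (UniversalEnvelopingAlgebra.ι K X)) (mul : ∀ u v, P u → P v → P (u * v))
    (add : ∀ u v, P u → P v → P (u + v)) (u : UniversalEnvelopingAlgebra K L) : P u := by
  obtain ⟨t, rfl⟩ : ∃ t, mkAlgHom K L t = u := RingCon.mkₐ_surjective (α := K) _ u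
  induction t using TensorAlgebra.induction with
  | algebraMap r => rw [AlgHom.commutes]; exact algebraMap r
  | ι X => exact ι X
  | mul a b ha hb => rw [map_mul]; exact mul _ _ ha hb
  | add a b ha hb => rw [map_add]; exact add _ _ ha hb

theorem ι_mul_ι (X Y : L) : UniversalEnvelopingAlgebra.ι K X * UniversalEnvelopingAlgebra.ι K Y =
    UniversalEnvelopingAlgebra.ι K Y * UniversalEnvelopingAlgebra.ι K X +
      UniversalEnvelopingAlgebra.ι K ⁅X, Y⁆ := by
  rw [LieHom.map_lie, LieRing.of_associative_ring_bracket]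
  abel

/-- In characteristic zero the universal enveloping algebra is spanned by the powers of elements
of the Lie algebra: the symmetrization of a monomial lies in this span by polarization, and it
differs from the monomial by terms of lower order. -/
theorem span_pow_eq_top [CharZero K] : Submodule.span K
    {u | ∃ (X : L) (n : ℕ), UniversalEnvelopingAlgebra.ι K X ^ n = u} = ⊤ := by
  set W := Submodule.span K {u | ∃ (X : L) (n : ℕ), UniversalEnvelopingAlgebra.ι K X ^ n = u}
  have insert : ∀ (n : ℕ) (X Y : L) (a b : ℕ), a + b = n → UniversalEnvelopingAlgebra.ι K X ^ a *
      UniversalEnvelopingAlgebra.ι K Y * UniversalEnvelopingAlgebra.ι K X ^ b ∈ W := by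
    intro n
    induction n with
    | zero =>
      intro X Y a b hab
      obtain ⟨rfl, rfl⟩ : a = 0 ∧ b = 0 := by omega
      exact Submodule.subset_span ⟨Y, 1, by simp⟩
    | succ n ih =>
      intro X Y a b hab
      set x := UniversalEnvelopingAlgebra.ι K X
      set y := UniversalEnvelopingAlgebra.ι K Y
      -- Moving `y` through the powers of `x` changes the product by elements of `W`.
      have shift : ∀ i, i ≤ n + 1 → y * x ^ (n + 1) - x ^ i * y * x ^ (n + 1 - i) ∈ W := by
        intro i
        induction i with
        | zero => intro _; simp
        | succ i ihi =>
          intro hi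
          have h1 := ih X ⁅X, Y⁆ i (n - i) (by omega)
          have e : x ^ (i + 1) * y * x ^ (n + 1 - (i + 1)) = x ^ i * y * x ^ (n + 1 - i) +
              x ^ i * UniversalEnvelopingAlgebra.ι K ⁅X, Y⁆ * x ^ (n - i) := by
            rw [show n + 1 - (i + 1) = n - i by omega, show n + 1 - i = n - i + 1 by omega,
              pow_succ, pow_succ' x (n - i), mul_assoc (x ^ i) x y, ι_mul_ι]
            simp only [mul_add, add_mul, mul_assoc]
            rfl
          rw [e, ← sub_sub]
          exact W.sub_mem (ihi (by omega)) h1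
      have hsum := W.sum_pow_mul_mul_pow_mem x y (n + 1)
        fun t => Submodule.subset_span ⟨X + t • Y, n + 1 + 1, by simp [x, y]⟩
      have h2 : ((n + 1 + 1 : ℕ) : K) • (y * x ^ (n + 1)) ∈ W := by
        have h3 : ∑ i ∈ Finset.range (n + 1 + 1),
            (y * x ^ (n + 1) - x ^ i * y * x ^ (n + 1 - i)) ∈ W :=
          W.sum_mem fun i hi => shift i (by have := Finset.mem_range.1 hi; omega)
        rw [Finset.sum_sub_distrib, Finset.sum_const, Finset.card_range,
          ← Nat.cast_smul_eq_nsmul K] at h3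
        have := W.add_mem h3 hsum
        rwa [sub_add_cancel] at this
      have h4 := (W.smul_mem_iff (Nat.cast_ne_zero.2 (n + 1).succ_ne_zero)).1 h2
      have h5 := W.sub_mem h4 (shift a (by omega))
      rw [sub_sub_cancel, show n + 1 - a = b by omega] at h5
      exact h5
  have key : ∀ u w : UniversalEnvelopingAlgebra K L, w ∈ W → w * u ∈ W := by
    intro u
    induction u using UniversalEnvelopingAlgebra.induction with
    | algebraMap r =>
      intro w hw
      rw [← Algebra.commutes, ← Algebra.smul_def]
      exact W.smul_mem r hw
    | mul a b ha hb => intro w hw; rw [← mul_assoc]; exact hb _ (ha _ hw)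
    | add a b ha hb => intro w hw; rw [mul_add]; exact W.add_mem (ha _ hw) (hb _ hw)
    | ι Y =>
      intro w hw
      induction hw using Submodule.span_induction with
      | zero => simp
      | add p q _ _ hp hq => rw [add_mul]; exact W.add_mem hp hq
      | smul c p _ hp => rw [smul_mul_assoc]; exact W.smul_mem c hp
      | mem p hp =>
        obtain ⟨X, n, rfl⟩ := hp
        simpa using insert n X Y n 0 rfl
  refine eq_top_iff.2 fun u _ => ?_
  rw [← one_mul u]
  exact key u 1 (Submodule.subset_span ⟨0, 0, by simp⟩)

end Spanning

/-! ### The Bernoulli formula -/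

section Bernoulli

variable {K L : Type*} [Field K] [LieRing L] [LieAlgebra K L]

theorem ι_mul_pow (X Z : L) (r : ℕ) :
    UniversalEnvelopingAlgebra.ι K Z * UniversalEnvelopingAlgebra.ι K X ^ r =
      ∑ k ∈ Finset.range (r + 1), ((-1) ^ k * (r.choose k : K)) •
        (UniversalEnvelopingAlgebra.ι K X ^ (r - k) *
          UniversalEnvelopingAlgebra.ι K ((LieAlgebra.ad K L X ^ k) Z)) := by
  set x := UniversalEnvelopingAlgebra.ι K X
  set l := LinearMap.mulLeft K x
  set ρ := LinearMap.mulRight K x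
  have hcomm : Commute l ρ := LinearMap.commute_mulLeft_right x x
  have hc : Commute (ρ - l) l := (hcomm.symm).sub_left (Commute.refl l)
  have hpow : ∀ k, ((ρ - l) ^ k) (UniversalEnvelopingAlgebra.ι K Z) =
      (-1 : K) ^ k • UniversalEnvelopingAlgebra.ι K ((LieAlgebra.ad K L X ^ k) Z) := by
    intro k
    induction k with
    | zero => simp
    | succ k ih =>
      rw [pow_succ', Module.End.mul_apply, ih, map_smul, pow_succ' (LieAlgebra.ad K L X),
        Module.End.mul_apply, LieAlgebra.ad_apply, pow_succ, mul_smul]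
      congr 1
      rw [LinearMap.sub_apply, LinearMap.mulRight_apply, LinearMap.mulLeft_apply, neg_smul,
        one_smul, ι_mul_ι X]
      abel
  have h := congrArg (fun f => f (UniversalEnvelopingAlgebra.ι K Z)) (hc.add_pow r)
  simp only [sub_add_cancel] at h
  rw [LinearMap.pow_mulRight, LinearMap.mulRight_apply] at h
  rw [h, LinearMap.sum_apply]
  refine Finset.sum_congr rfl fun k _ => ?_
  rw [(hc.pow_pow k (r - k)).eq, ← nsmul_eq_mul', LinearMap.smul_apply, Module.End.mul_apply, hpow,
    map_smul, LinearMap.pow_mulLeft, LinearMap.mulLeft_apply, ← Nat.cast_smul_eq_nsmul K, smul_smul,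
    mul_comm]

theorem sum_range_choose_eq (m k : ℕ) :
    ∑ r ∈ Finset.range (m + 1), r.choose k = (m + 1).choose (k + 1) := by
  induction m with
  | zero => cases k <;> simp [Nat.choose_eq_zero_of_lt]
  | succ m ih => rw [Finset.sum_range_succ, ih, Nat.choose_succ_succ (m + 1), add_comm]

/-- The symmetric product of `X ^ m` and `Z` in terms of the products `X ^ (m - k) (ad X ^ k) Z`. -/
theorem sum_pow_mul_ι_mul_pow (X Z : L) (m : ℕ) :
    ∑ i ∈ Finset.range (m + 1), UniversalEnvelopingAlgebra.ι K X ^ i *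
        UniversalEnvelopingAlgebra.ι K Z * UniversalEnvelopingAlgebra.ι K X ^ (m - i) =
      ∑ k ∈ Finset.range (m + 1), ((-1) ^ k * ((m + 1).choose (k + 1) : K)) •
        (UniversalEnvelopingAlgebra.ι K X ^ (m - k) *
          UniversalEnvelopingAlgebra.ι K ((LieAlgebra.ad K L X ^ k) Z)) := by
  have h1 : ∀ r ∈ Finset.range (m + 1), UniversalEnvelopingAlgebra.ι K X ^ (m - r) *
      UniversalEnvelopingAlgebra.ι K Z * UniversalEnvelopingAlgebra.ι K X ^ r =
      ∑ k ∈ Finset.range (m + 1), ((-1) ^ k * (r.choose k : K)) •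
        (UniversalEnvelopingAlgebra.ι K X ^ (m - k) *
          UniversalEnvelopingAlgebra.ι K ((LieAlgebra.ad K L X ^ k) Z)) := by
    intro r hr
    have hr' := Finset.mem_range.1 hr
    rw [mul_assoc, ι_mul_pow, Finset.mul_sum]
    refine Finset.sum_subset_zero_on_sdiff (Finset.range_subset_range.2 (by omega)) ?_ ?_
    · intro k hk
      rw [Finset.mem_sdiff, Finset.mem_range, Finset.mem_range] at hk
      rw [Nat.choose_eq_zero_of_lt (by omega)]
      simp
    · intro k hk
      have hk' := Finset.mem_range.1 hk
      rw [mul_smul_comm, ← mul_assoc, ← pow_add, show m - r + (r - k) = m - k by omega]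
  rw [← Finset.sum_range_reflect]
  rw [Finset.sum_congr rfl fun r hr => ?_, Finset.sum_congr rfl h1, Finset.sum_comm]
  · refine Finset.sum_congr rfl fun k _ => ?_
    rw [← Finset.sum_smul, ← Finset.mul_sum, ← Nat.cast_sum, sum_range_choose_eq]
  · have hr' := Finset.mem_range.1 hr
    rw [show m + 1 - 1 - r = m - r by omega, show m - (m - r) = r by omega]

/-- The identity of Bernoulli numbers that makes the coefficients of the Gutt product collapse. Up to
a common factor the summands are `(s + 1).choose j * bernoulli j`, so that it reduces to the
recursion of the Bernoulli numbers. -/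
theorem sum_choose_mul_bernoulli (n s : ℕ) (hs : s ≤ n) :
    ∑ j ∈ Finset.range (s + 1), (n.choose j : ℚ) * bernoulli j *
      ((n - j + 1 : ℕ) : ℚ)⁻¹ * ((n - j + 1).choose (s - j + 1) : ℚ) = if s = 0 then 1 else 0 := by
  have h : ∀ j ∈ Finset.range (s + 1), (n.choose j : ℚ) * bernoulli j *
      ((n - j + 1 : ℕ) : ℚ)⁻¹ * ((n - j + 1).choose (s - j + 1) : ℚ) =
      ((n + 1 : ℕ) : ℚ)⁻¹ * ((n + 1).choose (s + 1) : ℚ) *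
        (((s + 1).choose j : ℚ) * bernoulli j) := by
    intro j hj
    have hj' := Finset.mem_range.1 hj
    have e1 : (n.choose j : ℚ) * ((n + 1 : ℕ) : ℚ) =
        ((n + 1).choose j : ℚ) * ((n - j + 1 : ℕ) : ℚ) := by
      have := Nat.choose_mul_succ_eq n j
      rw [show n + 1 - j = n - j + 1 by omega] at this
      exact_mod_cast this
    have e2 : ((n + 1).choose (s + 1) : ℚ) * ((s + 1).choose j : ℚ) =
        ((n + 1).choose j : ℚ) * ((n - j + 1).choose (s - j + 1) : ℚ) := by
      have := Nat.choose_mul (n := n + 1) (k := s + 1) (s := j) (by omega)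
      rw [show n + 1 - j = n - j + 1 by omega, show s + 1 - j = s - j + 1 by omega] at this
      exact_mod_cast this
    have n1 : ((n + 1 : ℕ) : ℚ) ≠ 0 := Nat.cast_ne_zero.2 (by omega)
    have n2 : ((n - j + 1 : ℕ) : ℚ) ≠ 0 := Nat.cast_ne_zero.2 (by omega)
    have e3 : (n.choose j : ℚ) * ((n - j + 1 : ℕ) : ℚ)⁻¹ =
        ((n + 1).choose j : ℚ) * ((n + 1 : ℕ) : ℚ)⁻¹ := by
      rw [← div_eq_mul_inv, ← div_eq_mul_inv, div_eq_div_iff n2 n1, e1]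
    calc _ = ((n.choose j : ℚ) * ((n - j + 1 : ℕ) : ℚ)⁻¹) *
          ((n - j + 1).choose (s - j + 1) : ℚ) * bernoulli j := by ring
      _ = ((n + 1 : ℕ) : ℚ)⁻¹ * (((n + 1).choose j : ℚ) *
          ((n - j + 1).choose (s - j + 1) : ℚ)) * bernoulli j := by rw [e3]; ring
      _ = _ := by rw [← e2]; ring
  rw [Finset.sum_congr rfl h, ← Finset.mul_sum, sum_bernoulli]
  have n1 : ((n + 1 : ℕ) : ℚ) ≠ 0 := Nat.cast_ne_zero.2 (by omega)
  by_cases h0 : s = 0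
  · subst h0
    simp only [zero_add, if_true, Nat.choose_one_right, mul_one]
    exact inv_mul_cancel₀ n1
  · simp [h0]

/-- The product `X ^ n Y` in terms of symmetric products. -/
theorem pow_mul_ι [CharZero K] (X Y : L) (n : ℕ) :
    ∑ j ∈ Finset.range (n + 1), ((-1) ^ j * (n.choose j : K) * ((bernoulli j : ℚ) : K)) •
      ((n - j + 1 : ℕ) : K)⁻¹ • ∑ i ∈ Finset.range (n - j + 1), UniversalEnvelopingAlgebra.ι K X ^ i *
        UniversalEnvelopingAlgebra.ι K ((LieAlgebra.ad K L X ^ j) Y) *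
          UniversalEnvelopingAlgebra.ι K X ^ (n - j - i) =
      UniversalEnvelopingAlgebra.ι K X ^ n * UniversalEnvelopingAlgebra.ι K Y := by
  set V : ℕ → UniversalEnvelopingAlgebra K L := fun s => UniversalEnvelopingAlgebra.ι K X ^ (n - s) *
    UniversalEnvelopingAlgebra.ι K ((LieAlgebra.ad K L X ^ s) Y)
  set f : ℕ → ℕ → UniversalEnvelopingAlgebra K L := fun j k =>
    ((-1 : K) ^ (j + k) * (((n.choose j : ℚ) * bernoulli j * ((n - j + 1 : ℕ) : ℚ)⁻¹ *
      ((n - j + 1).choose (k + 1) : ℚ) : ℚ) : K)) • V (j + k)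
  have h1 : ∀ j ∈ Finset.range (n + 1), ((-1) ^ j * (n.choose j : K) * ((bernoulli j : ℚ) : K)) •
      ((n - j + 1 : ℕ) : K)⁻¹ • ∑ i ∈ Finset.range (n - j + 1), UniversalEnvelopingAlgebra.ι K X ^ i *
        UniversalEnvelopingAlgebra.ι K ((LieAlgebra.ad K L X ^ j) Y) *
          UniversalEnvelopingAlgebra.ι K X ^ (n - j - i) =
      ∑ k ∈ Finset.range (n + 1 - j), f j k := by
    intro j hj
    have hj' := Finset.mem_range.1 hj
    rw [sum_pow_mul_ι_mul_pow, show n + 1 - j = n - j + 1 by omega, Finset.smul_sum,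
      Finset.smul_sum]
    refine Finset.sum_congr rfl fun k _ => ?_
    simp only [f, V]
    rw [smul_smul, smul_smul, ← Module.End.mul_apply, ← pow_add, Nat.sub_sub, add_comm k j]
    congr 1
    push_cast
    ring
  rw [Finset.sum_congr rfl h1, ← Finset.sum_range_diag_flip, Finset.sum_range_succ']
  have h2 : ∀ s ∈ Finset.range (n + 1), ∑ j ∈ Finset.range (s + 1), f j (s - j) =
      ((-1 : K) ^ s * ((if s = 0 then 1 else 0 : ℚ) : K)) • V s := by
    intro s hs
    rw [← sum_choose_mul_bernoulli n s (by have := Finset.mem_range.1 hs; omega), Rat.cast_sum,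
      Finset.mul_sum, Finset.sum_smul]
    refine Finset.sum_congr rfl fun j hj => ?_
    have hj' := Finset.mem_range.1 hj
    simp only [f]
    rw [show j + (s - j) = s by omega]
  rw [h2 0 (by simp), Finset.sum_eq_zero fun s hs => ?_]
  · simp [V]
  · rw [h2 (s + 1) (by have := Finset.mem_range.1 hs; simp; omega)]
    simp

end Bernoulli

end UniversalEnvelopingAlgebra

/-! ### Comparison with the universal enveloping algebra -/

namespace FactorizationEnvelope

section Comparison

variable {𝕜 : Type*} [RCLike 𝕜] {𝔤 : Type*} [LieRing 𝔤] [LieAlgebra 𝕜 𝔤]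

theorem iMap_ι_pow_mem_lineSubalgebra {D : Disk} (ω : UnitForm 𝕜 D) (X : 𝔤) (n : ℕ) :
    iMap 𝔤 ω (SymmetricAlgebra.ι 𝕜 𝔤 X ^ n) ∈ lineSubalgebra 𝕜 D X := by
  rw [map_pow, iMap_ι]
  exact Subalgebra.pow_mem _ (gen_mem_lineSubalgebra X _) n

theorem star_pow (X : 𝔤) (m n : ℕ) :
    star 𝕜 𝔤 (SymmetricAlgebra.ι 𝕜 𝔤 X ^ m) (SymmetricAlgebra.ι 𝕜 𝔤 X ^ n) =
      SymmetricAlgebra.ι 𝕜 𝔤 X ^ (m + n) := by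
  rw [star_apply, linePHat, pHat_of_mem_lineSubalgebra _ X (Subalgebra.mul_mem _
    (iMap_ι_pow_mem_lineSubalgebra _ X m) (iMap_ι_pow_mem_lineSubalgebra _ X n)), map_mul,
    pMap_iMap, pMap_iMap, pow_add]

theorem UnitForm.toLine_apply_eq_zero {D : Disk} (ω : UnitForm 𝕜 D) {t : ℝ} (ht : t ∉ D.1) :
    ω.toLine.1 t = 0 :=
  image_eq_zero_of_notMem_tsupport fun h => ht (ω.1.tsupport_subset h)

/-- The primitive of the difference of a unit form left of `s` and a unit form right of `t` is `1`
between `s` and `t`. -/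
theorem homotopyForm_toLine_apply {s t x : ℝ} (ω₁ : UnitForm 𝕜 (leftDisk s))
    (ω₂ : UnitForm 𝕜 (rightDisk t)) (hs : s ≤ x) (ht : x ≤ t) :
    homotopyForm ω₂.toLine ω₁.toLine.1 x = 1 := by
  rw [homotopyForm_apply, ω₁.toLine.2]
  have h : ∀ y ∈ Set.Iic x, ω₁.toLine.1 y - 1 * ω₂.toLine.1 y = ω₁.toLine.1 y := by
    intro y (hy : y ≤ x)
    rw [ω₂.toLine_apply_eq_zero fun h : t < y => absurd (hy.trans ht) (not_le.2 h), mul_zero,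
      sub_zero]
  rw [setIntegral_congr_fun measurableSet_Iic h,
    setIntegral_eq_integral_of_forall_compl_eq_zero, ω₁.toLine.2]
  intro y hy
  exact ω₁.toLine_apply_eq_zero fun h : y < s => hy (h.le.trans hs)

theorem differential_gen_mul_gen (D : Disk) (X Y : 𝔤) (f g : CptFun 𝕜 D) :
    differential 𝕜 𝔤 D (SuperSym.gen (0, X ⊗ₜ f) * SuperSym.gen (Y ⊗ₜ g, 0)) =
      SuperSym.gen (⁅X, Y⁆ ⊗ₜ mulFun D f g, 0) -
        SuperSym.gen (X ⊗ₜ deRham D f, 0) * SuperSym.gen (Y ⊗ₜ g, 0) := by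
  have h1 : dDR 𝕜 𝔤 D (SuperSym.gen (0, X ⊗ₜ f) * SuperSym.gen (Y ⊗ₜ g, 0)) =
      -(SuperSym.gen (X ⊗ₜ deRham D f, 0) * SuperSym.gen (Y ⊗ₜ g, 0)) := by
    have h0 : SuperSym.oddDer (-(deRham D).lTensor 𝔤)
        (SuperSym.gen ((Y ⊗ₜ g, 0) : LieForms 𝕜 𝔤 D × LieForms 𝕜 𝔤 D)) = 0 := by
      rw [← mul_one (SuperSym.gen _), SuperSym.oddDer_gen_mul, SuperSym.oddDer_one]
      simp [SuperSym.gen_zero_zero]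
    rw [dDR, SuperSym.oddDer_gen_mul, h0, mul_zero, add_zero, LinearMap.neg_apply,
      LinearMap.lTensor_tmul, ← neg_mul, ← map_neg, Prod.neg_mk, neg_zero]
  have h2 : dCE 𝕜 𝔤 D (SuperSym.gen (0, X ⊗ₜ f) * SuperSym.gen (Y ⊗ₜ g, 0)) =
      SuperSym.gen (⁅X, Y⁆ ⊗ₜ mulFun D f g, 0) := by
    have h0 : SuperSym.chevalleyEilenberg (bracket 𝕜 𝔤 D) (bracket_skew 𝕜 𝔤 D)
        (SuperSym.gen ((Y ⊗ₜ g, 0) : LieForms 𝕜 𝔤 D × LieForms 𝕜 𝔤 D)) = 0 := by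
      rw [← mul_one (SuperSym.gen _), SuperSym.chevalleyEilenberg_gen_mul,
        SuperSym.chevalleyEilenberg_one, SuperSym.adGen_one, mul_zero, add_zero]
    rw [dCE, SuperSym.chevalleyEilenberg_gen_mul, h0, mul_zero, add_zero, SuperSym.adGen_odd,
      ← mul_one (SuperSym.gen (Y ⊗ₜ g, _)), SuperSym.adOdd_gen_mul, SuperSym.adOdd_one, mul_zero,
      add_zero, mul_one, map_zero, bracket_tmul]
  rw [differential_apply, h1, h2]
  abel

/-- The commutator of the star product: let `ω₁`, `η`, `ω₃` be unit forms on disks in increasing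
order and let `g` be the primitive of `ω₁ - ω₃`, which is `1` on the support of `η`. Then the
differential of `(X ⊗ g) (Y ⊗ η)` is `[X, Y] ⊗ η - (X ⊗ ω₁) (Y ⊗ η) + (Y ⊗ η) (X ⊗ ω₃)`. -/
theorem star_ι_sub_star_ι (X Y : 𝔤) :
    star 𝕜 𝔤 (SymmetricAlgebra.ι 𝕜 𝔤 X) (SymmetricAlgebra.ι 𝕜 𝔤 Y) -
      star 𝕜 𝔤 (SymmetricAlgebra.ι 𝕜 𝔤 Y) (SymmetricAlgebra.ι 𝕜 𝔤 X) =
      SymmetricAlgebra.ι 𝕜 𝔤 ⁅X, Y⁆ := by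
  let D : Disk := ⟨⟨Set.Ioo 0 1, isOpen_Ioo⟩, isConnected_Ioo zero_lt_one⟩
  have hD0 : D.1 ≤ (rightDisk 0).1 := fun _ h => h.1
  have hD1 : D.1 ≤ (leftDisk 1).1 := fun _ h => h.2
  set ω₁ := (someUnitForm 𝕜 (leftDisk 0)).toLine with hω₁
  set η := (someUnitForm 𝕜 D).toLine with hη
  set ω₃ := (someUnitForm 𝕜 (rightDisk 1)).toLine with hω₃
  set g := homotopyForm ω₃ ω₁.1 with hg
  have hdg : deRham lineDisk g = ω₁.1 - ω₃.1 := by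
    rw [hg, deRham_homotopyForm]
    change _ - (∫ x, ω₁.1 x) • _ = _
    rw [ω₁.2, one_smul]
  have hgη : mulFun lineDisk g η.1 = η.1 := by
    ext t
    change g t * η.1 t = η.1 t
    by_cases ht : t ∈ D.1
    · rw [hg, hω₁, hω₃, homotopyForm_toLine_apply _ _ ht.1.le ht.2.le, one_mul]
    · rw [hη, UnitForm.toLine_apply_eq_zero _ ht, mul_zero]
  have h := (isStrongDeformationRetract 𝔤 (someUnitForm 𝕜 lineDisk)).p_d
    (SuperSym.gen (0, X ⊗ₜ g) * SuperSym.gen (Y ⊗ₜ η.1, 0))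
  rw [differential_gen_mul_gen, hgη, hdg, TensorProduct.tmul_sub] at h
  have e : (SuperSym.gen (X ⊗ₜ[𝕜] ω₁.1 - X ⊗ₜ[𝕜] ω₃.1, 0) : FactEnv 𝕜 𝔤 lineDisk) =
      iMap 𝔤 ω₁ (SymmetricAlgebra.ι 𝕜 𝔤 X) - iMap 𝔤 ω₃ (SymmetricAlgebra.ι 𝕜 𝔤 X) := by
    rw [iMap_ι, iMap_ι, ← map_sub, Prod.mk_sub_mk, sub_zero]
  rw [e, ← iMap_ι 𝔤 η, ← iMap_ι 𝔤 η, sub_mul,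
    (SuperSym.commute_of_mem_cohDegree_zero (iMap_mem_cohDegree ω₃ _) _ :
      iMap 𝔤 ω₃ (SymmetricAlgebra.ι 𝕜 𝔤 X) * _ = _)] at h
  change linePHat 𝕜 𝔤 _ = 0 at h
  rw [map_sub, map_sub, linePHat_iMap,
    linePHat_mul (isLocal_iMap _ _) ((isLocal_iMap (someUnitForm 𝕜 D) _).mono hD0),
    linePHat_mul ((isLocal_iMap (someUnitForm 𝕜 D) _).mono hD1) (isLocal_iMap _ _),
    linePHat_iMap, linePHat_iMap, linePHat_iMap] at h
  exact (sub_eq_zero.1 h).symm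

variable (𝕜 𝔤) in
/-- The algebra homomorphism from the universal enveloping algebra to the endomorphisms of `Sym 𝔤`
under which `X` acts by left multiplication with `X` for the star product. -/
noncomputable def starAction :
    UniversalEnvelopingAlgebra 𝕜 𝔤 →ₐ[𝕜] Module.End 𝕜 (SymmetricAlgebra 𝕜 𝔤) :=
  UniversalEnvelopingAlgebra.lift 𝕜
    { (star 𝕜 𝔤 ∘ₗ SymmetricAlgebra.ι 𝕜 𝔤 : 𝔤 →ₗ[𝕜] Module.End 𝕜 (SymmetricAlgebra 𝕜 𝔤)) with
      map_lie' := by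
        intro X Y
        refine LinearMap.ext fun a => ?_
        change star 𝕜 𝔤 (SymmetricAlgebra.ι 𝕜 𝔤 ⁅X, Y⁆) a =
          star 𝕜 𝔤 (SymmetricAlgebra.ι 𝕜 𝔤 X) (star 𝕜 𝔤 (SymmetricAlgebra.ι 𝕜 𝔤 Y) a) -
            star 𝕜 𝔤 (SymmetricAlgebra.ι 𝕜 𝔤 Y) (star 𝕜 𝔤 (SymmetricAlgebra.ι 𝕜 𝔤 X) a)
        rw [← star_ι_sub_star_ι, map_sub, LinearMap.sub_apply, star_assoc, star_assoc] }

theorem starAction_ι (X : 𝔤) : starAction 𝕜 𝔤 (UniversalEnvelopingAlgebra.ι 𝕜 X) =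
    star 𝕜 𝔤 (SymmetricAlgebra.ι 𝕜 𝔤 X) :=
  UniversalEnvelopingAlgebra.lift_ι_apply _ _ X

/-- The action of the universal enveloping algebra is by left star multiplications. -/
theorem starAction_eq (u : UniversalEnvelopingAlgebra 𝕜 𝔤) :
    starAction 𝕜 𝔤 u = star 𝕜 𝔤 (starAction 𝕜 𝔤 u 1) := by
  refine LinearMap.ext fun a => ?_
  induction u using UniversalEnvelopingAlgebra.induction generalizing a with
  | algebraMap r =>
    rw [AlgHom.commutes, Module.algebraMap_end_apply, Module.algebraMap_end_apply, map_smul,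
      LinearMap.smul_apply, one_star]
  | ι X => rw [starAction_ι, star_one]
  | mul u v hu hv =>
    rw [map_mul, Module.End.mul_apply, Module.End.mul_apply, hv, hu, hu (starAction 𝕜 𝔤 v 1),
      star_assoc]
  | add u v hu hv =>
    rw [map_add, LinearMap.add_apply, LinearMap.add_apply, map_add, LinearMap.add_apply, hu, hv]

theorem starAction_ι_pow (X : 𝔤) (n : ℕ) :
    starAction 𝕜 𝔤 (UniversalEnvelopingAlgebra.ι 𝕜 X ^ n) 1 = SymmetricAlgebra.ι 𝕜 𝔤 X ^ n := by
  induction n with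
  | zero => simp
  | succ n ih =>
    have := star_pow (𝕜 := 𝕜) X 1 n
    rw [pow_one] at this
    rw [pow_succ', map_mul, Module.End.mul_apply, ih, starAction_ι, this, add_comm]

variable (𝕜 𝔤) in
/-- The symmetrization map `X₁ ⋯ Xₙ ↦ (1 / n!) ∑ σ, X_{σ 1} ⋯ X_{σ n}` from the symmetric algebra
to the universal enveloping algebra, obtained from the symmetrization on the even generators of the
factorization envelope on `ℝ`. -/
noncomputable def symmetrization :
    SymmetricAlgebra 𝕜 𝔤 →ₗ[𝕜] UniversalEnvelopingAlgebra 𝕜 𝔤 :=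
  SuperSym.symLift (fun n =>
    (MultilinearMap.mkPiAlgebraFin 𝕜 n (UniversalEnvelopingAlgebra 𝕜 𝔤)).compLinearMap fun _ =>
      ((UniversalEnvelopingAlgebra.ι 𝕜 : 𝔤 →ₗ⁅𝕜⁆ UniversalEnvelopingAlgebra 𝕜 𝔤) :
        𝔤 →ₗ[𝕜] UniversalEnvelopingAlgebra 𝕜 𝔤) ∘ₗ
        (TensorProduct.rid 𝕜 𝔤).toLinearMap ∘ₗ (integralForm lineDisk).lTensor 𝔤 ∘ₗ
          LinearMap.fst 𝕜 _ _) ∘ₗ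
    (iMap 𝔤 (someUnitForm 𝕜 lineDisk)).toLinearMap

theorem symmetrization_ι_pow (X : 𝔤) (n : ℕ) :
    symmetrization 𝕜 𝔤 (SymmetricAlgebra.ι 𝕜 𝔤 X ^ n) = UniversalEnvelopingAlgebra.ι 𝕜 X ^ n := by
  have e : iMap 𝔤 (someUnitForm 𝕜 lineDisk) (SymmetricAlgebra.ι 𝕜 𝔤 X ^ n) =
      (List.ofFn fun _ : Fin n => SuperSym.gen (X ⊗ₜ[𝕜] (someUnitForm 𝕜 lineDisk).1, 0)).prod := by
    rw [map_pow, iMap_ι, List.ofFn_const, List.prod_replicate]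
  rw [symmetrization, LinearMap.comp_apply, AlgHom.toLinearMap_apply, e, SuperSym.symLift_prod,
    SuperSym.gradedSymm_homogeneous _ _ (fun _ => false) (fun i => by simp [SuperSym.homPart])]
  have h1 : integralForm lineDisk (someUnitForm 𝕜 lineDisk).1 = 1 := (someUnitForm 𝕜 lineDisk).2
  have hn : (n.factorial : 𝕜) ≠ 0 := Nat.cast_ne_zero.2 n.factorial_ne_zero
  simp only [MultilinearMap.compLinearMap_apply, MultilinearMap.mkPiAlgebraFin_apply,
    LinearMap.comp_apply, LinearMap.fst_apply, LinearMap.lTensor_tmul, h1,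
    LinearEquiv.coe_coe, TensorProduct.rid_tmul, one_smul]
  have hk : ∀ σ : Equiv.Perm (Fin n), SuperSym.koszul 𝕜 σ (fun _ => false) = 1 := by
    intro σ
    simp [SuperSym.koszul]
  simp only [hk, one_smul, Finset.sum_const, Finset.card_univ, Fintype.card_perm, Fintype.card_fin,
    List.ofFn_const, List.prod_replicate]
  rw [← Nat.cast_smul_eq_nsmul 𝕜, smul_smul, inv_mul_cancel₀ hn, one_smul]
  rfl

variable (𝕜 𝔤) in
/-- Symmetrization is a linear isomorphism, with inverse `u ↦ u · 1` for the action of the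
universal enveloping algebra on `Sym 𝔤` by star multiplications. -/
noncomputable def symmetrizationEquiv :
    SymmetricAlgebra 𝕜 𝔤 ≃ₗ[𝕜] UniversalEnvelopingAlgebra 𝕜 𝔤 :=
  LinearEquiv.ofLinearMap (symmetrization 𝕜 𝔤)
    (LinearMap.applyₗ (1 : SymmetricAlgebra 𝕜 𝔤) ∘ₗ (starAction 𝕜 𝔤).toLinearMap)
    (LinearMap.ext_on UniversalEnvelopingAlgebra.span_pow_eq_top <| by
      rintro _ ⟨X, n, rfl⟩
      exact (congrArg _ (starAction_ι_pow X n)).trans (symmetrization_ι_pow X n))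
    (SymmetricAlgebra.linearMap_ext_pow fun X n =>
      (congrArg (fun u => starAction 𝕜 𝔤 u 1) (symmetrization_ι_pow X n)).trans
        (starAction_ι_pow X n))

theorem symmetrizationEquiv_ι_pow (X : 𝔤) (n : ℕ) :
    symmetrizationEquiv 𝕜 𝔤 (SymmetricAlgebra.ι 𝕜 𝔤 X ^ n) = UniversalEnvelopingAlgebra.ι 𝕜 X ^ n :=
  symmetrization_ι_pow X n

theorem symmetrizationEquiv_star (a b : SymmetricAlgebra 𝕜 𝔤) :
    symmetrizationEquiv 𝕜 𝔤 (star 𝕜 𝔤 a b) =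
      symmetrizationEquiv 𝕜 𝔤 a * symmetrizationEquiv 𝕜 𝔤 b := by
  have hs : ∀ u, (symmetrizationEquiv 𝕜 𝔤).symm u = starAction 𝕜 𝔤 u 1 := fun _ => rfl
  rw [← LinearEquiv.eq_symm_apply, hs, map_mul, Module.End.mul_apply, ← hs, starAction_eq, ← hs,
    LinearEquiv.symm_apply_apply, LinearEquiv.symm_apply_apply]

/-- The derivative of `symmetrizationEquiv_ι_pow` in the direction of `Z`. -/
theorem symmetrizationEquiv_ι_pow_mul (X Z : 𝔤) (m : ℕ) :
    symmetrizationEquiv 𝕜 𝔤 (SymmetricAlgebra.ι 𝕜 𝔤 X ^ m * SymmetricAlgebra.ι 𝕜 𝔤 Z) =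
      ((m + 1 : ℕ) : 𝕜)⁻¹ • ∑ i ∈ Finset.range (m + 1), UniversalEnvelopingAlgebra.ι 𝕜 X ^ i *
        UniversalEnvelopingAlgebra.ι 𝕜 Z * UniversalEnvelopingAlgebra.ι 𝕜 X ^ (m - i) := by
  -- The graph of the symmetrization contains the powers of `(X + t Z, X + t Z)`.
  have h := (symmetrization 𝕜 𝔤).graph.sum_pow_mul_mul_pow_mem
    (SymmetricAlgebra.ι 𝕜 𝔤 X, UniversalEnvelopingAlgebra.ι 𝕜 X)
    (SymmetricAlgebra.ι 𝕜 𝔤 Z, UniversalEnvelopingAlgebra.ι 𝕜 Z) m fun t => by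
      have := symmetrization_ι_pow (𝕜 := 𝕜) (X + t • Z) (m + 1)
      rw [map_add, map_smul, map_add, map_smul] at this
      exact (LinearMap.mem_graph_iff _ _).2 this.symm
  rw [LinearMap.mem_graph_iff, Prod.fst_sum, Prod.snd_sum] at h
  have hm : ((m + 1 : ℕ) : 𝕜) ≠ 0 := Nat.cast_ne_zero.2 m.succ_ne_zero
  have e : ∑ i ∈ Finset.range (m + 1), SymmetricAlgebra.ι 𝕜 𝔤 X ^ i * SymmetricAlgebra.ι 𝕜 𝔤 Z *
      SymmetricAlgebra.ι 𝕜 𝔤 X ^ (m - i) =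
      ((m + 1 : ℕ) : 𝕜) • (SymmetricAlgebra.ι 𝕜 𝔤 X ^ m * SymmetricAlgebra.ι 𝕜 𝔤 Z) := by
    rw [Finset.sum_congr rfl fun i hi => ?_, Finset.sum_const, Finset.card_range,
      Nat.cast_smul_eq_nsmul]
    rw [mul_right_comm, ← pow_add, Nat.add_sub_cancel' (Nat.lt_succ_iff.1 (Finset.mem_range.1 hi))]
  simp only [Prod.fst_mul, Prod.snd_mul, Prod.pow_fst, Prod.pow_snd] at h
  rw [h, e, map_smul, smul_smul, inv_mul_cancel₀ hm, one_smul]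
  rfl

theorem star_ι_pow_ι (X Y : 𝔤) (n : ℕ) :
    star 𝕜 𝔤 (SymmetricAlgebra.ι 𝕜 𝔤 X ^ n) (SymmetricAlgebra.ι 𝕜 𝔤 Y) =
      ∑ j ∈ Finset.range (n + 1), ((-1) ^ j * (n.choose j : 𝕜) * ((bernoulli j : ℚ) : 𝕜)) •
        (SymmetricAlgebra.ι 𝕜 𝔤 X ^ (n - j) *
          SymmetricAlgebra.ι 𝕜 𝔤 ((LieAlgebra.ad 𝕜 𝔤 X ^ j) Y)) := by
  have h1 := symmetrizationEquiv_ι_pow (𝕜 := 𝕜) Y 1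
  rw [pow_one, pow_one] at h1
  refine (symmetrizationEquiv 𝕜 𝔤).injective ?_
  rw [symmetrizationEquiv_star, symmetrizationEquiv_ι_pow, h1, map_sum,
    ← UniversalEnvelopingAlgebra.pow_mul_ι]
  refine Finset.sum_congr rfl fun j _ => ?_
  rw [map_smul, symmetrizationEquiv_ι_pow_mul]

end Comparison

end FactorizationEnvelope

end EnvelopingAlgebra

/-- The prefactorization algebra structure of the factorization envelope on `ℝ` transfers along the
perturbed strong deformation retract to the Gutt star-product on `Sym 𝔤`. -/
theorem proposition4p5 {𝕜 : Type*} [RCLike 𝕜] {𝔤 : Type*} [LieRing 𝔤] [LieAlgebra 𝕜 𝔤]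
    [FiniteDimensional 𝕜 𝔤] :
    -- the structure maps of the factorization envelope are cochain maps
    (∀ (n : ℕ) (Ds : Fin n → Disk) (D : Disk) (h : FactorizationEnvelope.IsOperation Ds D),
      FactorizationEnvelope.IsCochainMap (𝕜 := 𝕜) 𝔤 h) ∧
    -- the perturbed deformation retracts
    (∀ (D : Disk) (ω : FactorizationEnvelope.UnitForm 𝕜 D),
      FactorizationEnvelope.IsStrongDeformationRetract 𝔤 ω) ∧
    ∃ star : SymmetricAlgebra 𝕜 𝔤 →ₗ[𝕜] SymmetricAlgebra 𝕜 𝔤 →ₗ[𝕜] SymmetricAlgebra 𝕜 𝔤,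
      -- the transferred structure maps are the iterated `⋆`-products in the order of the disks
      (∀ (ω : ∀ D : Disk, FactorizationEnvelope.UnitForm 𝕜 D) (n : ℕ) (Ds : Fin n → Disk)
        (D : Disk) (h : FactorizationEnvelope.IsOperation Ds D),
        ∃ σ : Equiv.Perm (Fin n),
          (∀ k l, k < l → FactorizationEnvelope.Disk.LeftOf (Ds (σ k)) (Ds (σ l))) ∧
          ∀ a : Fin n → SymmetricAlgebra 𝕜 𝔤,
            FactorizationEnvelope.transferred 𝔤 ω h a =
              (List.ofFn fun k => a (σ k)).foldr (fun b c => star b c) 1) ∧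
      -- `⋆` is associative and unital
      (∀ a b c, star (star a b) c = star a (star b c)) ∧
      (∀ a, star 1 a = a ∧ star a 1 = a) ∧
      -- the explicit formula
      (∀ (X Y : 𝔤) (n : ℕ),
        star (SymmetricAlgebra.ι 𝕜 𝔤 X ^ n) (SymmetricAlgebra.ι 𝕜 𝔤 Y) =
          ∑ j ∈ Finset.range (n + 1), ((-1) ^ j * (n.choose j : 𝕜) * ((bernoulli j : ℚ) : 𝕜)) •
            (SymmetricAlgebra.ι 𝕜 𝔤 X ^ (n - j) *
              SymmetricAlgebra.ι 𝕜 𝔤 ((LieAlgebra.ad 𝕜 𝔤 X ^ j) Y))) ∧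
      -- `⋆` is the Gutt star-product
      FactorizationEnvelope.IsGuttStarProduct 𝕜 𝔤 star ∧
      -- `(Sym 𝔤, ⋆)` is isomorphic to the universal enveloping algebra
      ∃ φ : SymmetricAlgebra 𝕜 𝔤 ≃ₗ[𝕜] UniversalEnvelopingAlgebra 𝕜 𝔤,
        φ 1 = 1 ∧ ∀ a b, φ (star a b) = φ a * φ b := by
  refine ⟨fun n Ds D h => FactorizationEnvelope.isCochainMap 𝕜 𝔤 h,
    fun D ω => FactorizationEnvelope.isStrongDeformationRetract 𝔤 ω,
    FactorizationEnvelope.star 𝕜 𝔤, fun ω n Ds D h => ?_, FactorizationEnvelope.star_assoc,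
    fun a => ⟨FactorizationEnvelope.one_star a, FactorizationEnvelope.star_one a⟩,
    FactorizationEnvelope.star_ι_pow_ι,
    ⟨FactorizationEnvelope.symmetrizationEquiv 𝕜 𝔤,
      FactorizationEnvelope.symmetrizationEquiv_ι_pow,
      FactorizationEnvelope.symmetrizationEquiv_star⟩,
    FactorizationEnvelope.symmetrizationEquiv 𝕜 𝔤, ?_,
    FactorizationEnvelope.symmetrizationEquiv_star⟩
  · obtain ⟨σ, hσ⟩ := FactorizationEnvelope.exists_perm_leftOf h.2
    exact ⟨σ, hσ, FactorizationEnvelope.transferred_eq_foldr ω h σ hσ⟩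
  · simpa using FactorizationEnvelope.symmetrizationEquiv_ι_pow (𝕜 := 𝕜) (0 : 𝔤) 0
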